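/- Let $\mathbb{k}$ be an algebraically closed field of characteristic zero. Let $\mathcal D=(G,\chi,g,\mu)$ be a group datum of non-nilpotent type: $G$ is a finite group, $\chi:G\to\mathbb{k}^\times$ a character, $g$ a central element of $G$, $\mu\in\mathbb{k}$, and, with $n$ the order of $\chi(g)$, $\mu(g^n-1)\neq 0$ in $\mathbb{k}G$ and $\chi^n=1$. Assume $n\ge 2$. Let $H$ be the associated Hopf algebra, generated as an algebra by $\mathbb{k}G$ and $y$ subject to $y^n=\mu(g^n-1)$ and $yh=\chi(h)hy$ for $h\in G$, with $$\Delta(y)=y\otimes g+1\otimes y,\quad \varepsilon(y)=0,\quad S(y)=-yg^{-1},\qquad \Delta(h)=h\otimes h,\quad \varepsilon(h)=1,\quad S(h)=h^{-1}\quad(h\in G).$$ All modules are finite dimensional left modules. Let $\{V_i\}_{i\in\Omega}$ be a complete set of representatives of the simple $\mathbb{k}G$-modules up to isomorphism, and let $\Omega_0$ be the set of those $i\in\Omega$ for which $g^n$ acts on $V_i$ as the identity. For $i\in\Omega_0$ and $1\le j\le n$ let $M(j,i)=V_i\oplus xV_i\oplus\cdots\oplus x^{j-1}V_i$ be the $H$-module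 with $h(x^lv)=\chi(h)^{-l}x^l(hv)$ for $h\in G$, $y(x^lv)=x^{l+1}v$ for $l<j-1$, and $y(x^{j-1}v)=0$. The Green ring $r(H)$ is generated as an abelian group by the isomorphism classes $[M]$ of $H$-modules, with relations $[M\oplus N]=[M]+[N]$ and multiplication $[M][N]=[M\otimes N]$. Let $\mathcal P$ be the ideal of $r(H)$ generated by the classes of the indecomposable projective modules. The stable category has the $H$-modules as objects and, as morphisms, the $H$-module homomorphisms modulo those that factor through a projective module; the stable Green ring $r_{st}(H)$ is the Green ring of the stable category, that is, it is defined as $r(H)$ with isomorphism in the stable category in place of isomorphism. A ring $R$ that is free as a $\mathbb{Z}$-module with a finite basis $\{b_i\}_{i\in I}$ containing $1$ is a *fusion ring* if (1) $b_ib_j=\sum_k p_{ij}^k b_k$ with integers $p_{ij}^k\ge 0$; (2) $\sum_{i\in I_0}b_i=1$ for some subset $I_0\subseteq I$; (3) there is an involution $i\mapsto i^*$ of $I$ such that the additive map with $b_i\mapsto b_{i^*}$ is an anti-involution of the ring $R$, and such that $\psi(b_ib_j)$ is $1$ if $i=j^*$ and $0$ otherwise, where $\psi:R\to\mathbb{Z}$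 is the additive map with $\psi(b_i)=1$ for $i\in I_0$ and $\psi(b_i)=0$ for $i\notin I_0$. It is *transitive* if for all $i,j\in I$ there are $k,l\in I$ such that $b_ib_k$ and $b_lb_i$ involve $b_j$ with a nonzero coefficient. **Proposition.** Let $I=\{(j,i): i\in\Omega_0,\ 1\le j\le n-1\}$. 1. There is a ring isomorphism $r(H)/\mathcal P\cong r_{st}(H)$ that sends the class of each module to its class. 2. The modules $M(j,i)$ with $(j,i)\in I$ are indecomposable and not projective, and every non-projective indecomposable $H$-module is isomorphic to $M(j,i)$ for exactly one $(j,i)\in I$. 3. The classes of the $M(j,i)$ with $(j,i)\in I$ form a $\mathbb{Z}$-basis of $r_{st}(H)$. 4. With this basis and the involution $p\mapsto p^*$ of $I$ determined by $M(p)^*\cong M(p^*)$, where the dual of an $H$-module $X$ is $\mathrm{Hom}_{\mathbb{k}}(X,\mathbb{k})$ with $(af)(v)=f(S(a)v)$, the ring $r_{st}(H)$ is a fusion ring, and this fusion ring is transitive. -/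

import Mathlib

open scoped TensorProduct

set_option linter.unusedSectionVars false

universe u v w

/-! ### Finite dimensional modules over a `k`-algebra -/

/-- A finite dimensional left module over a `k`-algebra `A`: a finite dimensional `k`-vector space
with an algebra homomorphism from `A` to its endomorphisms. -/
structure FDModule (k : Type u) [Field k] (A : Type v) [Ring A] [Algebra k A] where
  carrier : Type u
  [addCommGroup : AddCommGroup carrier]
  [module : Module k carrier]
  [finite : Module.Finite k carrier]
  ρ : A →ₐ[k] Module.End k carrier

namespace FDModule

attribute [instance] FDModule.addCommGroup FDModule.module FDModule.finite

section Basic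

variable {k : Type u} [Field k] {A : Type v} [Ring A] [Algebra k A]

instance : CoeSort (FDModule k A) (Type u) := ⟨FDModule.carrier⟩

/-- The underlying left `A`-module. -/
instance instModuleAlg (X : FDModule k A) : Module A X.carrier :=
  Module.compHom X.carrier (X.ρ : A →+* Module.End k X.carrier)

theorem smul_def (X : FDModule k A) (a : A) (x : X) : a • x = X.ρ a x := rfl

instance (X : FDModule k A) : IsScalarTower k A X.carrier :=
  ⟨fun c a x => by simp [smul_def]⟩

/-- Isomorphism of `A`-modules. -/
def Iso (X Y : FDModule k A) : Prop := Nonempty (X ≃ₗ[A] Y)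

theorem Iso.of_equiv {X Y : FDModule k A} (e : X ≃ₗ[k] Y)
    (h : ∀ (a : A) (x : X), e (X.ρ a x) = Y.ρ a (e x)) : Iso X Y :=
  ⟨{ e with map_smul' := h }⟩

/-- The direct sum of two modules. -/
def directSum (X Y : FDModule k A) : FDModule k A where
  carrier := X × Y
  ρ := AlgHom.ofLinearMap
    { toFun := fun a => (X.ρ a).prodMap (Y.ρ a)
      map_add' := fun a b => by ext <;> simp
      map_smul' := fun c a => by ext <;> simp }
    (by ext <;> simp) (fun a b => by ext <;> simp)

/-- An indecomposable module: nonzero, and not an internal direct sum of two nonzero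
submodules. -/
def IsIndecomposable (X : FDModule k A) : Prop :=
  Nontrivial X ∧ ∀ p q : Submodule A X, IsCompl p q → p = ⊥ ∨ q = ⊥

def IsProjective (X : FDModule k A) : Prop := Module.Projective A X

/-- A homomorphism which factors through a (finite dimensional) projective module. -/
def FactorsThroughProjective {X Y : FDModule k A} (f : X →ₗ[A] Y) : Prop :=
  ∃ P : FDModule k A, P.IsProjective ∧ ∃ (s : X →ₗ[A] P) (t : P →ₗ[A] Y), f = t ∘ₗ s

/-- `X` and `Y` are isomorphic in the stable category: there are homomorphisms in both directions
which are mutually inverse modulo homomorphisms that factor through projective modules. -/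
def StableIso (X Y : FDModule k A) : Prop :=
  ∃ (f : X →ₗ[A] Y) (g : Y →ₗ[A] X),
    FactorsThroughProjective (g ∘ₗ f - LinearMap.id) ∧
    FactorsThroughProjective (f ∘ₗ g - LinearMap.id)

/-- A family containing exactly one module from each isomorphism class of simple modules. -/
def IsCompleteSetOfSimples {Ω : Type w} (V : Ω → FDModule k A) : Prop :=
  (∀ i, IsSimpleModule A (V i)) ∧ (∀ i j, Iso (V i) (V j) → i = j) ∧
    ∀ X : FDModule k A, IsSimpleModule A X → ∃ i, Iso X (V i)

instance isoSetoid (k : Type u) [Field k] (A : Type v) [Ring A] [Algebra k A] :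
    Setoid (FDModule k A) where
  r := Iso
  iseqv := ⟨fun _ => ⟨LinearEquiv.refl _ _⟩, fun ⟨e⟩ => ⟨e.symm⟩, fun ⟨e⟩ ⟨f⟩ => ⟨e.trans f⟩⟩

end Basic

/-! ### Tensor products and duals of modules over a Hopf algebra -/

section TensorAct

variable {k : Type u} [Field k] {A B C : Type*} [Ring A] [Algebra k A] [Ring B] [Algebra k B]
  [Ring C] [Algebra k C]
  {U V W : Type u} [AddCommGroup U] [Module k U] [AddCommGroup V] [Module k V]
  [AddCommGroup W] [Module k W]

/-- The action of `A ⊗ B` on `U ⊗ V` given by `(a ⊗ b)(u ⊗ v) = a u ⊗ b v`. -/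
noncomputable def tensorAct (ρ : A →ₐ[k] Module.End k U) (σ : B →ₐ[k] Module.End k V) :
    A ⊗[k] B →ₐ[k] Module.End k (U ⊗[k] V) :=
  (Module.endTensorEndAlgHom (R := k) (S := k) (A := k) (M := U) (N := V)).comp
    (Algebra.TensorProduct.map ρ σ)

@[simp]
theorem tensorAct_tmul (ρ : A →ₐ[k] Module.End k U) (σ : B →ₐ[k] Module.End k V)
    (a : A) (b : B) (u : U) (v : V) :
    tensorAct ρ σ (a ⊗ₜ[k] b) (u ⊗ₜ[k] v) = ρ a u ⊗ₜ[k] σ b v := by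
  simp [tensorAct, Module.endTensorEndAlgHom_apply]

theorem tensorAct_assoc (ρ : A →ₐ[k] Module.End k U) (σ : B →ₐ[k] Module.End k V)
    (τ : C →ₐ[k] Module.End k W) (t : (A ⊗[k] B) ⊗[k] C) :
    (TensorProduct.assoc k U V W).toLinearMap ∘ₗ tensorAct (tensorAct ρ σ) τ t =
      tensorAct ρ (tensorAct σ τ) (TensorProduct.assoc k A B C t) ∘ₗ
        (TensorProduct.assoc k U V W).toLinearMap := by
  induction t with
  | zero => simp
  | add s t hs ht => simp only [map_add, LinearMap.comp_add, LinearMap.add_comp, hs, ht]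
  | tmul s c =>
    induction s with
    | zero => simp
    | add s t hs ht =>
      simp only [map_add, TensorProduct.add_tmul, LinearMap.comp_add, LinearMap.add_comp, hs, ht]
    | tmul a b => ext x y z; simp

theorem tensorAct_rTensor (ρ : B →ₐ[k] Module.End k U) (σ : C →ₐ[k] Module.End k V)
    (f : A →ₐ[k] B) (t : A ⊗[k] C) :
    tensorAct (ρ.comp f) σ t = tensorAct ρ σ (f.toLinearMap.rTensor C t) := by
  induction t with
  | zero => simp
  | add s t hs ht => simp only [map_add, hs, ht]
  | tmul a b => ext x y; simp

theorem tensorAct_lTensor (ρ : B →ₐ[k] Module.End k U) (σ : C →ₐ[k] Module.End k V)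
    (f : A →ₐ[k] C) (t : B ⊗[k] A) :
    tensorAct ρ (σ.comp f) t = tensorAct ρ σ (f.toLinearMap.lTensor B t) := by
  induction t with
  | zero => simp
  | add s t hs ht => simp only [map_add, hs, ht]
  | tmul a b => ext x y; simp

theorem tensorAct_lid (ρ : A →ₐ[k] Module.End k U) (t : k ⊗[k] A) :
    (TensorProduct.lid k U).toLinearMap ∘ₗ tensorAct (Algebra.lsmul k k k) ρ t =
      ρ (TensorProduct.lid k A t) ∘ₗ (TensorProduct.lid k U).toLinearMap := by
  induction t with
  | zero => simp
  | add s t hs ht => simp only [map_add, LinearMap.comp_add, LinearMap.add_comp, hs, ht]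
  | tmul a b => ext x; simp

theorem tensorAct_rid (ρ : A →ₐ[k] Module.End k U) (t : A ⊗[k] k) :
    (TensorProduct.rid k U).toLinearMap ∘ₗ tensorAct ρ (Algebra.lsmul k k k) t =
      ρ (TensorProduct.rid k A t) ∘ₗ (TensorProduct.rid k U).toLinearMap := by
  induction t with
  | zero => simp
  | add s t hs ht => simp only [map_add, LinearMap.comp_add, LinearMap.add_comp, hs, ht]
  | tmul a b => ext x; simp

theorem tensorAct_congr {U' V' : Type u} [AddCommGroup U'] [Module k U'] [AddCommGroup V']
    [Module k V'] (ρ : A →ₐ[k] Module.End k U) (σ : B →ₐ[k] Module.End k V)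
    (ρ' : A →ₐ[k] Module.End k U') (σ' : B →ₐ[k] Module.End k V') (e : U ≃ₗ[k] U')
    (f : V ≃ₗ[k] V') (he : ∀ a x, e (ρ a x) = ρ' a (e x)) (hf : ∀ b x, f (σ b x) = σ' b (f x))
    (t : A ⊗[k] B) :
    (TensorProduct.congr e f).toLinearMap ∘ₗ tensorAct ρ σ t =
      tensorAct ρ' σ' t ∘ₗ (TensorProduct.congr e f).toLinearMap := by
  induction t with
  | zero => simp
  | add s t hs ht => simp only [map_add, LinearMap.comp_add, LinearMap.add_comp, hs, ht]
  | tmul a b => ext x y; simp [he, hf]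

end TensorAct

section Bialg

variable {k : Type u} [Field k] {A : Type v} [Ring A] [Bialgebra k A]

/-- The trivial module `k`, on which `A` acts through the counit. -/
noncomputable def trivial (k : Type u) [Field k] (A : Type v) [Ring A] [Bialgebra k A] :
    FDModule k A where
  carrier := k
  ρ := (Algebra.lsmul k k k).comp (Bialgebra.counitAlgHom k A)

/-- The tensor product over `k`, on which `A` acts through the comultiplication. -/
noncomputable def tensor (X Y : FDModule k A) : FDModule k A where
  carrier := X ⊗[k] Y
  ρ := (tensorAct X.ρ Y.ρ).comp (Bialgebra.comulAlgHom k A)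

theorem tensor_assoc (X Y Z : FDModule k A) :
    Iso (tensor (tensor X Y) Z) (tensor X (tensor Y Z)) := by
  refine Iso.of_equiv (TensorProduct.assoc k X Y Z) fun a x => ?_
  have h := tensorAct_assoc X.ρ Y.ρ Z.ρ
    ((Bialgebra.comulAlgHom k A).toLinearMap.rTensor A (Coalgebra.comul a))
  rw [← tensorAct_rTensor, show TensorProduct.assoc k A A A
    ((Bialgebra.comulAlgHom k A).toLinearMap.rTensor A (Coalgebra.comul a)) =
    (Bialgebra.comulAlgHom k A).toLinearMap.lTensor A (Coalgebra.comul a) from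
    Coalgebra.coassoc_apply a, ← tensorAct_lTensor] at h
  exact LinearMap.congr_fun h x

theorem trivial_tensor (X : FDModule k A) : Iso (tensor (trivial k A) X) X := by
  refine Iso.of_equiv (TensorProduct.lid k X) fun a x => ?_
  have h := tensorAct_lid X.ρ
    ((Bialgebra.counitAlgHom k A).toLinearMap.rTensor A (Coalgebra.comul a))
  have h' : (Bialgebra.counitAlgHom k A).toLinearMap.rTensor A (Coalgebra.comul a) =
    1 ⊗ₜ[k] a := Coalgebra.rTensor_counit_comul a
  have h2 := LinearMap.congr_fun
    (tensorAct_rTensor (Algebra.lsmul k k k) X.ρ (Bialgebra.counitAlgHom k A)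
    (Coalgebra.comul a)) x
  refine (congrArg (TensorProduct.lid k X) h2).trans ?_
  refine (LinearMap.congr_fun h x).trans ?_
  rw [h', TensorProduct.lid_tmul, one_smul]
  rfl

theorem tensor_trivial (X : FDModule k A) : Iso (tensor X (trivial k A)) X := by
  refine Iso.of_equiv (TensorProduct.rid k X) fun a x => ?_
  have h := tensorAct_rid X.ρ
    ((Bialgebra.counitAlgHom k A).toLinearMap.lTensor A (Coalgebra.comul a))
  have h' : (Bialgebra.counitAlgHom k A).toLinearMap.lTensor A (Coalgebra.comul a) =
    a ⊗ₜ[k] 1 := Coalgebra.lTensor_counit_comul a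
  have h2 := LinearMap.congr_fun
    (tensorAct_lTensor X.ρ (Algebra.lsmul k k k) (Bialgebra.counitAlgHom k A)
    (Coalgebra.comul a)) x
  refine (congrArg (TensorProduct.rid k X) h2).trans ?_
  refine (LinearMap.congr_fun h x).trans ?_
  rw [h', TensorProduct.rid_tmul, one_smul]
  rfl

theorem tensor_congr {X X' Y Y' : FDModule k A} (h : Iso X X') (h' : Iso Y Y') :
    Iso (tensor X Y) (tensor X' Y') := by
  obtain ⟨e⟩ := h
  obtain ⟨f⟩ := h'
  refine Iso.of_equiv (TensorProduct.congr (e.restrictScalars k) (f.restrictScalars k))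
    fun a x => ?_
  exact LinearMap.congr_fun (tensorAct_congr X.ρ Y.ρ X'.ρ Y'.ρ (e.restrictScalars k)
    (f.restrictScalars k) (fun a x => e.map_smul a x) (fun a x => f.map_smul a x)
    (Coalgebra.comul a)) x

end Bialg

/-- The dual module, on which `A` acts by `(a f)(x) = f(S(a) x)`, where `S` is the antipode. -/
noncomputable def dual {k : Type u} [Field k] {A : Type v} [Ring A] [HopfAlgebra k A]
    (X : FDModule k A) : FDModule k A where
  carrier := Module.Dual k X
  ρ := AlgHom.ofLinearMap
    { toFun := fun a => (X.ρ (HopfAlgebra.antipode k a)).dualMap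
      map_add' := fun a b => by ext; simp
      map_smul' := fun c a => by ext; simp }
    (by ext; simp) (fun a b => by ext; simp [HopfAlgebra.antipode_mul_antidistrib])

end FDModule

/-! ### Green rings -/

section Green

variable (k : Type u) [Field k] (A : Type v) [Ring A]

/-- The set of isomorphism classes of finite dimensional `A`-modules. -/
def IsoClass [Algebra k A] := Quotient (FDModule.isoSetoid k A)

variable [Bialgebra k A]

/-- Isomorphism classes form a monoid under the tensor product. -/
noncomputable instance : Monoid (IsoClass k A) where
  mul := Quotient.map₂ FDModule.tensor fun _ _ h _ _ h' => FDModule.tensor_congr h h'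
  one := Quotient.mk _ (FDModule.trivial k A)
  mul_assoc := by
    rintro ⟨X⟩ ⟨Y⟩ ⟨Z⟩
    exact Quotient.sound (FDModule.tensor_assoc X Y Z)
  one_mul := by
    rintro ⟨X⟩
    exact Quotient.sound (FDModule.trivial_tensor X)
  mul_one := by
    rintro ⟨X⟩
    exact Quotient.sound (FDModule.tensor_trivial X)

variable {A} in
/-- The class `[X]` in the free abelian group on isomorphism classes, whose multiplication is
`[X][Y] = [X ⊗ Y]`. -/
def freeClass (X : FDModule k A) : FreeAbelianGroup (IsoClass k A) :=
  FreeAbelianGroup.of (Quotient.mk _ X)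

/-- The relations `[X ⊕ Y] = [X] + [Y]`. -/
inductive GreenRel : FreeAbelianGroup (IsoClass k A) → FreeAbelianGroup (IsoClass k A) → Prop
  | directSum (X Y : FDModule k A) :
      GreenRel (freeClass k (X.directSum Y)) (freeClass k X + freeClass k Y)

/-- The Green ring `r(A)`. -/
def GreenRing := RingQuot (GreenRel k A)

noncomputable instance : Ring (GreenRing k A) := inferInstanceAs (Ring (RingQuot (GreenRel k A)))

variable {k A} in
/-- The class of a module in the Green ring. -/
noncomputable def GreenRing.cls (X : FDModule k A) : GreenRing k A :=
  RingQuot.mkRingHom (GreenRel k A) (freeClass k X)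

/-- The ideal of the Green ring generated by the classes of the indecomposable projective
modules. -/
noncomputable def projIdeal : TwoSidedIdeal (GreenRing k A) :=
  TwoSidedIdeal.span {x | ∃ X : FDModule k A, X.IsIndecomposable ∧ X.IsProjective ∧
    x = GreenRing.cls X}

/-- The relations of the Green ring of the stable category: modules that are isomorphic in the
stable category have the same class, and `[X ⊕ Y] = [X] + [Y]`. -/
inductive StableGreenRel :
    FreeAbelianGroup (IsoClass k A) → FreeAbelianGroup (IsoClass k A) → Prop
  | stableIso (X Y : FDModule k A) (h : X.StableIso Y) :
      StableGreenRel (freeClass k X) (freeClass k Y)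
  | directSum (X Y : FDModule k A) :
      StableGreenRel (freeClass k (X.directSum Y)) (freeClass k X + freeClass k Y)

/-- The stable Green ring `r_st(A)`, that is, the Green ring of the stable category. -/
def StableGreenRing := RingQuot (StableGreenRel k A)

noncomputable instance : Ring (StableGreenRing k A) :=
  inferInstanceAs (Ring (RingQuot (StableGreenRel k A)))

variable {k A} in
/-- The class of a module in the stable Green ring. -/
noncomputable def StableGreenRing.cls (X : FDModule k A) : StableGreenRing k A :=
  RingQuot.mkRingHom (StableGreenRel k A) (freeClass k X)

end Green

/-! ### Fusion rings -/

section Fusion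

variable {R : Type*} [Ring R] {I : Type*}

/-- The group endomorphism `∑ pᵢ bᵢ ↦ ∑ pᵢ b_{i*}` induced by a map `i ↦ i*` of the index set. -/
noncomputable def Module.Basis.starMap (b : Module.Basis I ℤ R) (star : I → I) : R →ₗ[ℤ] R :=
  b.constr ℤ fun i => b (star i)

open Classical in
/-- `R` is a fusion ring with respect to the `ℤ`-basis `b` and the map `star` of its index set. -/
structure IsFusionRing (b : Module.Basis I ℤ R) (star : I → I) : Prop where
  finite : Finite I
  one_mem : ∃ i, b i = 1
  mul_nonneg : ∀ i j l, 0 ≤ b.repr (b i * b j) l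
  involutive : Function.Involutive star
  map_one : b.starMap star 1 = 1
  map_mul : ∀ x y, b.starMap star (x * y) = b.starMap star y * b.starMap star x
  exists_subset : ∃ I₀ : Finset I, ∑ i ∈ I₀, b i = 1 ∧
    ∀ i j, b.constr ℤ (fun i => if i ∈ I₀ then (1 : ℤ) else 0) (b i * b j) =
      if i = star j then 1 else 0

/-- Transitivity of a ring with a `ℤ`-basis: for all `i`, `j` there are `l`, `m` such that `bᵢ b_l`
and `b_m bᵢ` involve `bⱼ` with a nonzero coefficient. -/
def IsTransitiveBasis (b : Module.Basis I ℤ R) : Prop :=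
  ∀ i j, ∃ l m, b.repr (b i * b l) j ≠ 0 ∧ b.repr (b m * b i) j ≠ 0

end Fusion

/-! ### The `q`-binomial theorem at a root of unity -/

section QBinomial

variable {k : Type*} [Field k]

/-- The Gaussian binomial coefficients. -/
def gaussBinom (q : k) : ℕ → ℕ → k
  | _, 0 => 1
  | 0, _ + 1 => 0
  | m + 1, i + 1 => gaussBinom q m i + q ^ (i + 1) * gaussBinom q m (i + 1)

theorem gaussBinom_zero_right (q : k) (m : ℕ) : gaussBinom q m 0 = 1 := by
  cases m <;> rfl

theorem gaussBinom_eq_zero (q : k) : ∀ m i : ℕ, m < i → gaussBinom q m i = 0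
  | 0, 0, h => absurd h (by simp)
  | 0, _ + 1, _ => rfl
  | _ + 1, 0, h => absurd h (by simp)
  | m + 1, i + 1, h => by
    rw [gaussBinom, gaussBinom_eq_zero q m i (by omega), gaussBinom_eq_zero q m (i + 1) (by omega)]
    simp

theorem gaussBinom_succ_mul (q : k) (m i : ℕ) :
    (1 - q ^ (i + 1)) * gaussBinom q (m + 1) (i + 1) = (1 - q ^ (m + 1)) * gaussBinom q m i := by
  induction m generalizing i with
  | zero => cases i <;> simp [gaussBinom]
  | succ m ih =>
    rw [gaussBinom.eq_3 q (m + 1) i, mul_add, mul_left_comm, ih]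
    cases i with
    | zero => simp only [gaussBinom_zero_right]; ring
    | succ i =>
      have h := ih i
      rw [gaussBinom] at h ⊢
      linear_combination q * h

theorem gaussBinom_self (q : k) (m : ℕ) : gaussBinom q m m = 1 := by
  induction m with
  | zero => rfl
  | succ m ih => rw [gaussBinom, ih, gaussBinom_eq_zero q m (m + 1) (by omega)]; simp

theorem gaussBinom_eq_zero_of_primitive {q : k} {n : ℕ} (hq : IsPrimitiveRoot q n) {i : ℕ}
    (h0 : 0 < i) (hi : i < n) : gaussBinom q n i = 0 := by
  obtain ⟨i, rfl⟩ := Nat.exists_eq_succ_of_ne_zero h0.ne'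
  obtain ⟨m, rfl⟩ := Nat.exists_eq_succ_of_ne_zero (by omega : n ≠ 0)
  have h := gaussBinom_succ_mul q m i
  rw [hq.pow_eq_one, sub_self, zero_mul] at h
  refine (mul_eq_zero.mp h).resolve_left fun h' => ?_
  exact hq.pow_ne_one_of_pos_of_lt (by omega) hi (sub_eq_zero.mp h').symm

variable {R : Type*} [Ring R] [Algebra k R]

theorem pow_mul_of_qcomm {q : k} {a b : R} (h : b * a = q • (a * b)) (i : ℕ) :
    b * a ^ i = q ^ i • (a ^ i * b) := by
  induction i with
  | zero => simp
  | succ i ih =>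
    rw [pow_succ, ← mul_assoc, ih, smul_mul_assoc, mul_assoc, h, mul_smul_comm, smul_smul,
      ← pow_succ, mul_assoc]

theorem add_pow_of_qcomm {q : k} {a b : R} (h : b * a = q • (a * b)) (m : ℕ) :
    (a + b) ^ m = ∑ i ∈ Finset.range (m + 1), gaussBinom q m i • (a ^ i * b ^ (m - i)) := by
  induction m with
  | zero => simp [gaussBinom]
  | succ m ih =>
    have hb : ∀ i ∈ Finset.range (m + 1), b * (gaussBinom q m i • (a ^ i * b ^ (m - i))) =
        (q ^ i * gaussBinom q m i) • (a ^ i * b ^ (m + 1 - i)) := by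
      intro i hi
      have : m + 1 - i = (m - i) + 1 := by
        have := Finset.mem_range.mp hi
        omega
      rw [mul_smul_comm, ← mul_assoc, pow_mul_of_qcomm h, smul_mul_assoc, smul_smul, mul_assoc,
        ← pow_succ', this, mul_comm]
    have ha : ∀ i ∈ Finset.range (m + 1), a * (gaussBinom q m i • (a ^ i * b ^ (m - i))) =
        gaussBinom q m i • (a ^ (i + 1) * b ^ (m + 1 - (i + 1))) := by
      intro i _
      rw [mul_smul_comm, ← mul_assoc, ← pow_succ', Nat.add_sub_add_right]
    rw [pow_succ', ih, add_mul, Finset.mul_sum, Finset.mul_sum, Finset.sum_congr rfl ha,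
      Finset.sum_congr rfl hb, Finset.sum_range_succ' _ (m + 1)]
    have h2 : ∑ i ∈ Finset.range (m + 1), (q ^ i * gaussBinom q m i) • (a ^ i * b ^ (m + 1 - i)) =
        ∑ i ∈ Finset.range (m + 1),
          (q ^ (i + 1) * gaussBinom q m (i + 1)) • (a ^ (i + 1) * b ^ (m + 1 - (i + 1))) +
        (q ^ 0 * gaussBinom q m 0) • (a ^ 0 * b ^ (m + 1 - 0)) := by
      rw [← Finset.sum_range_succ' (fun i => (q ^ i * gaussBinom q m i) •
        (a ^ i * b ^ (m + 1 - i))) (m + 1), Finset.sum_range_succ _ (m + 1),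
        gaussBinom_eq_zero q m (m + 1) (by omega)]
      simp
    rw [h2, ← add_assoc, ← Finset.sum_add_distrib]
    simp only [gaussBinom_zero_right, gaussBinom.eq_3, add_smul, pow_zero, mul_one]

theorem add_pow_of_qcomm_primitive {q : k} {n : ℕ} (hq : IsPrimitiveRoot q n) (hn : 0 < n)
    {a b : R} (h : b * a = q • (a * b)) : (a + b) ^ n = a ^ n + b ^ n := by
  obtain ⟨m, rfl⟩ := Nat.exists_eq_succ_of_ne_zero hn.ne'
  rw [add_pow_of_qcomm h, Finset.sum_range_succ, Finset.sum_range_succ', Finset.sum_eq_zero]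
  · simp [gaussBinom_zero_right, gaussBinom_self, add_comm]
  · intro i hi
    have := Finset.mem_range.mp hi
    rw [gaussBinom_eq_zero_of_primitive hq (by omega) (by omega), zero_smul]

theorem mul_pow_of_qcomm {q : k} {a b : R} (h : b * a = q • (a * b)) (m : ℕ) :
    (a * b) ^ m = q ^ (m * (m - 1) / 2) • (a ^ m * b ^ m) := by
  induction m with
  | zero => simp
  | succ m ih =>
    have e : (m + 1) * (m + 1 - 1) / 2 = m + m * (m - 1) / 2 := by
      rw [← Finset.sum_range_id_mul_two, ← Finset.sum_range_id_mul_two,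
        Nat.mul_div_cancel _ (by norm_num), Nat.mul_div_cancel _ (by norm_num),
        Finset.sum_range_succ, add_comm]
    rw [pow_succ', ih, mul_smul_comm, mul_assoc, ← mul_assoc b, pow_mul_of_qcomm h,
      smul_mul_assoc, mul_smul_comm, smul_smul, e, pow_add, mul_comm (q ^ m), pow_succ' a,
      pow_succ' b]
    simp only [mul_assoc]

theorem neg_one_pow_mul_of_primitive {q : k} {n : ℕ} (hq : IsPrimitiveRoot q n) (hn : 0 < n) :
    (-1 : k) ^ n * q ^ (n * (n - 1) / 2) = -1 := by
  rcases Nat.even_or_odd' n with ⟨c, rfl | rfl⟩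
  · have h1 : q ^ c = -1 := by
      have h2 : (q ^ c) ^ 2 = 1 := by rw [← pow_mul, mul_comm, hq.pow_eq_one]
      exact (sq_eq_sq_iff_eq_or_eq_neg.mp (h2.trans (one_pow 2).symm)).resolve_left
        (hq.pow_ne_one_of_pos_of_lt (by omega) (by omega))
    rw [mul_assoc, Nat.mul_div_cancel_left _ (by norm_num), pow_mul, pow_mul, h1]
    have : Odd (2 * c - 1) := ⟨c - 1, by omega⟩
    simp [this.neg_one_pow]
  · have : (2 * c + 1) * (2 * c + 1 - 1) / 2 = (2 * c + 1) * c := by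
      rw [Nat.add_sub_cancel, mul_left_comm, Nat.mul_div_cancel_left _ (by norm_num)]
    rw [this, pow_mul, hq.pow_eq_one]
    simp [pow_succ, pow_mul]

end QBinomial

/-! ### Pointed Hopf algebras of rank one -/

/-- A group datum `(G, χ, g, μ)`. -/
structure GroupDatum (k : Type u) [Field k] (G : Type v) [Group G] where
  χ : G →* kˣ
  g : G
  μ : k
  g_mem_center : g ∈ Subgroup.center G
  cond : χ ^ orderOf (χ g) = 1 ∨
    μ • (MonoidAlgebra.of k G (g ^ orderOf (χ g)) - 1 : MonoidAlgebra k G) = 0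

namespace GroupDatum

section

variable {k : Type u} [Field k] {G : Type v} [Group G] (D : GroupDatum k G)

/-- The order of `q = χ(g)`. -/
noncomputable def n : ℕ := orderOf (D.χ D.g)

/-- The group datum is of non-nilpotent type. -/
def IsNonNilpotent : Prop :=
  D.μ • (MonoidAlgebra.of k G (D.g ^ D.n) - 1 : MonoidAlgebra k G) ≠ 0 ∧ D.χ ^ D.n = 1

/-- The algebra generators: `y` and the elements of `G`. -/
inductive Gen (G : Type v) : Type v
  | y : Gen G
  | grp (h : G) : Gen G

/-- The defining relations: those of the group algebra, `yⁿ = μ (gⁿ - 1)` and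
`y h = χ(h) h y`. -/
inductive Rel : FreeAlgebra k (Gen G) → FreeAlgebra k (Gen G) → Prop
  | one : Rel (FreeAlgebra.ι k (Gen.grp 1)) 1
  | mul (h h' : G) : Rel (FreeAlgebra.ι k (Gen.grp (h * h')))
      (FreeAlgebra.ι k (Gen.grp h) * FreeAlgebra.ι k (Gen.grp h'))
  | pow : Rel (FreeAlgebra.ι k Gen.y ^ D.n)
      (D.μ • (FreeAlgebra.ι k (Gen.grp (D.g ^ D.n)) - 1))
  | comm (h : G) : Rel (FreeAlgebra.ι k Gen.y * FreeAlgebra.ι k (Gen.grp h))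
      ((D.χ h : k) • (FreeAlgebra.ι k (Gen.grp h) * FreeAlgebra.ι k Gen.y))

/-- The algebra `H_D` associated to a group datum `D`. -/
def Alg := RingQuot D.Rel

noncomputable instance : Ring D.Alg := inferInstanceAs (Ring (RingQuot D.Rel))

noncomputable instance instAlgebraAlg : Algebra k D.Alg :=
  inferInstanceAs (Algebra k (RingQuot D.Rel))

noncomputable def mkAlg : FreeAlgebra k (Gen G) →ₐ[k] D.Alg := RingQuot.mkAlgHom k D.Rel

/-- The generator `y` of `H_D`. -/
noncomputable def y : D.Alg := D.mkAlg (FreeAlgebra.ι k Gen.y)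

/-- The element of `H_D` given by a group element. -/
noncomputable def grp (h : G) : D.Alg := D.mkAlg (FreeAlgebra.ι k (Gen.grp h))

theorem mkAlg_rel {a b : FreeAlgebra k (Gen G)} (h : D.Rel a b) : D.mkAlg a = D.mkAlg b :=
  RingQuot.mkAlgHom_rel k h

theorem grp_one : D.grp 1 = 1 := by
  exact (D.mkAlg_rel Rel.one).trans (_root_.map_one _)

theorem grp_mul (h h' : G) : D.grp (h * h') = D.grp h * D.grp h' := by
  exact (D.mkAlg_rel (Rel.mul h h')).trans (_root_.map_mul _ _ _)

theorem y_pow : D.y ^ D.n = D.μ • (D.grp (D.g ^ D.n) - 1) := by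
  simpa using! D.mkAlg_rel Rel.pow

theorem y_mul_grp (h : G) : D.y * D.grp h = (D.χ h : k) • (D.grp h * D.y) := by
  simpa using! D.mkAlg_rel (Rel.comm h)

theorem grp_pow (h : G) (m : ℕ) : D.grp h ^ m = D.grp (h ^ m) := by
  induction m with
  | zero => simp [grp_one]
  | succ m ih => rw [pow_succ, pow_succ, grp_mul, ih]

theorem grp_mul_inv (h : G) : D.grp h * D.grp h⁻¹ = 1 := by
  rw [← grp_mul, mul_inv_cancel, grp_one]

theorem grp_inv_mul (h : G) : D.grp h⁻¹ * D.grp h = 1 := by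
  rw [← grp_mul, inv_mul_cancel, grp_one]

section Lift

variable {B : Type*} [Ring B] [Algebra k B] (Y : B) (f : G →* B)
  (hpow : Y ^ D.n = D.μ • (f (D.g ^ D.n) - 1))
  (hcomm : ∀ h, Y * f h = (D.χ h : k) • (f h * Y))

/-- The universal property of `H_D`. -/
noncomputable def lift : D.Alg →ₐ[k] B :=
  RingQuot.liftAlgHom k ⟨FreeAlgebra.lift k fun x => match x with
    | Gen.y => Y
    | Gen.grp h => f h, by
      intro a b hab
      cases hab with
      | one => simp
      | mul h h' => simp
      | pow => simpa using hpow
      | comm h => simpa using hcomm h⟩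

@[simp]
theorem lift_y : D.lift Y f hpow hcomm D.y = Y := by
  refine (RingQuot.liftAlgHom_mkAlgHom_apply ..).trans ?_
  simp

@[simp]
theorem lift_grp (h : G) : D.lift Y f hpow hcomm (D.grp h) = f h := by
  refine (RingQuot.liftAlgHom_mkAlgHom_apply ..).trans ?_
  simp

end Lift

theorem mkAlg_surjective : Function.Surjective D.mkAlg := RingQuot.mkAlgHom_surjective k D.Rel

theorem alg_induction {P : D.Alg → Prop} (hc : ∀ c : k, P (algebraMap k D.Alg c)) (hy : P D.y)
    (hg : ∀ h, P (D.grp h)) (hadd : ∀ a b, P a → P b → P (a + b))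
    (hmul : ∀ a b, P a → P b → P (a * b)) (a : D.Alg) : P a := by
  obtain ⟨a, rfl⟩ := D.mkAlg_surjective a
  induction a using FreeAlgebra.induction with
  | grade0 c => simpa using hc c
  | grade1 x => cases x with
    | y => exact hy
    | grp h => exact hg h
  | mul a b ha hb => rw [map_mul]; exact hmul _ _ ha hb
  | add a b ha hb => rw [map_add]; exact hadd _ _ ha hb

theorem algHom_ext {B : Type*} [Ring B] [Algebra k B] {φ ψ : D.Alg →ₐ[k] B}
    (hy : φ D.y = ψ D.y) (hg : ∀ h, φ (D.grp h) = ψ (D.grp h)) : φ = ψ := by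
  ext a
  induction a using D.alg_induction with
  | hc c => simp
  | hy => exact hy
  | hg h => exact hg h
  | hadd a b ha hb => simp [ha, hb]
  | hmul a b ha hb => simp [ha, hb]

end

section Hopf

variable {k : Type u} [Field k] {G : Type v} [Group G] [Finite G] (D : GroupDatum k G)

theorem n_pos : 0 < D.n := by
  have h : IsOfFinOrder D.g := isOfFinOrder_of_finite D.g
  exact (D.χ.isOfFinOrder h).orderOf_pos

theorem isPrimitiveRoot_q : IsPrimitiveRoot (D.χ D.g : k) D.n :=
  IsPrimitiveRoot.coe_units_iff.mpr (IsPrimitiveRoot.orderOf _)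

/-- `h ↦ h ⊗ h`. -/
noncomputable def grpTensor : G →* D.Alg ⊗[k] D.Alg where
  toFun h := D.grp h ⊗ₜ D.grp h
  map_one' := by rw [grp_one]; rfl
  map_mul' h h' := by rw [grp_mul, Algebra.TensorProduct.tmul_mul_tmul]

theorem grpTensor_apply (h : G) : D.grpTensor h = D.grp h ⊗ₜ D.grp h := rfl

theorem comul_pow : (D.y ⊗ₜ[k] D.grp D.g + 1 ⊗ₜ[k] D.y) ^ D.n =
    D.μ • (D.grpTensor (D.g ^ D.n) - 1) := by
  rw [add_pow_of_qcomm_primitive (q := (D.χ D.g : k)) D.isPrimitiveRoot_q D.n_pos]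
  · rw [grpTensor_apply, Algebra.TensorProduct.tmul_pow, Algebra.TensorProduct.tmul_pow, one_pow,
      y_pow, grp_pow, ← TensorProduct.smul_tmul', TensorProduct.tmul_smul, ← smul_add,
      TensorProduct.sub_tmul, TensorProduct.tmul_sub, Algebra.TensorProduct.one_def]
    congr 1
    abel
  · rw [Algebra.TensorProduct.tmul_mul_tmul, Algebra.TensorProduct.tmul_mul_tmul, y_mul_grp,
      one_mul, mul_one, TensorProduct.tmul_smul]

theorem comul_comm (h : G) : (D.y ⊗ₜ[k] D.grp D.g + 1 ⊗ₜ[k] D.y) * D.grpTensor h =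
    (D.χ h : k) • (D.grpTensor h * (D.y ⊗ₜ[k] D.grp D.g + 1 ⊗ₜ[k] D.y)) := by
  have hg : D.grp D.g * D.grp h = D.grp h * D.grp D.g := by
    rw [← grp_mul, ← grp_mul, Subgroup.mem_center_iff.mp D.g_mem_center h]
  simp only [grpTensor_apply, add_mul, mul_add, Algebra.TensorProduct.tmul_mul_tmul, y_mul_grp, hg,
    ← TensorProduct.smul_tmul', TensorProduct.tmul_smul, one_mul, mul_one, smul_add]

/-- The comultiplication: `Δ(y) = y ⊗ g + 1 ⊗ y` and `Δ(h) = h ⊗ h`. -/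
noncomputable def comulHom : D.Alg →ₐ[k] D.Alg ⊗[k] D.Alg :=
  D.lift (D.y ⊗ₜ D.grp D.g + 1 ⊗ₜ D.y) D.grpTensor D.comul_pow D.comul_comm

/-- The counit: `ε(y) = 0` and `ε(h) = 1`. -/
noncomputable def counitHom : D.Alg →ₐ[k] k :=
  D.lift 0 1 (by simp [D.n_pos.ne']) (fun h => by simp)

/-- `h ↦ h⁻¹`, as a homomorphism to the opposite algebra. -/
noncomputable def grpOp : G →* D.Algᵐᵒᵖ where
  toFun h := MulOpposite.op (D.grp h⁻¹)
  map_one' := by rw [inv_one, grp_one, MulOpposite.op_one]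
  map_mul' h h' := by rw [mul_inv_rev, grp_mul, MulOpposite.op_mul]

theorem grpOp_apply (h : G) : D.grpOp h = MulOpposite.op (D.grp h⁻¹) := rfl

theorem antipode_pow : MulOpposite.op (-(D.y * D.grp D.g⁻¹)) ^ D.n =
    D.μ • (D.grpOp (D.g ^ D.n) - 1) := by
  have hc : D.grp D.g⁻¹ * D.y = (D.χ D.g : k) • (D.y * D.grp D.g⁻¹) := by
    rw [y_mul_grp, smul_smul]
    simp
  have e : (-1 : D.Alg) ^ D.n = algebraMap k D.Alg ((-1) ^ D.n) := by simp
  rw [grpOp_apply, ← MulOpposite.op_pow, neg_pow, mul_pow_of_qcomm hc, y_pow, grp_pow,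
    ← MulOpposite.op_one, ← MulOpposite.op_sub, ← MulOpposite.op_smul, e, ← Algebra.smul_def,
    smul_smul, neg_one_pow_mul_of_primitive D.isPrimitiveRoot_q D.n_pos, smul_mul_assoc, sub_mul,
    inv_pow, grp_mul_inv, one_mul, neg_one_smul, ← smul_neg, neg_sub]

theorem antipode_comm (h : G) : MulOpposite.op (-(D.y * D.grp D.g⁻¹)) * D.grpOp h =
    (D.χ h : k) • (D.grpOp h * MulOpposite.op (-(D.y * D.grp D.g⁻¹))) := by
  have hg : D.grp h⁻¹ * D.grp D.g⁻¹ = D.grp D.g⁻¹ * D.grp h⁻¹ := by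
    have h1 := Subgroup.mem_center_iff.mp (inv_mem D.g_mem_center) h⁻¹
    rw [← grp_mul, ← grp_mul, h1]
  rw [grpOp_apply, ← MulOpposite.op_mul, ← MulOpposite.op_mul, ← MulOpposite.op_smul]
  congr 1
  have h2 : D.y * D.grp D.g⁻¹ * D.grp h⁻¹ = (D.χ h⁻¹ : k) • (D.grp h⁻¹ * (D.y * D.grp D.g⁻¹)) := by
    rw [mul_assoc, ← hg, ← mul_assoc, y_mul_grp, smul_mul_assoc, mul_assoc]
  rw [mul_neg, neg_mul, h2, smul_neg, smul_smul]
  simp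

/-- The antipode, as a homomorphism to the opposite algebra: `S(y) = -y g⁻¹` and
`S(h) = h⁻¹`. -/
noncomputable def antipodeHom : D.Alg →ₐ[k] D.Algᵐᵒᵖ :=
  D.lift (MulOpposite.op (-(D.y * D.grp D.g⁻¹))) D.grpOp D.antipode_pow D.antipode_comm

@[simp] theorem comulHom_y : D.comulHom D.y = D.y ⊗ₜ D.grp D.g + 1 ⊗ₜ D.y := D.lift_y ..

@[simp] theorem comulHom_grp (h : G) : D.comulHom (D.grp h) = D.grp h ⊗ₜ D.grp h :=
  D.lift_grp ..

@[simp] theorem counitHom_y : D.counitHom D.y = 0 := D.lift_y ..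

@[simp] theorem counitHom_grp (h : G) : D.counitHom (D.grp h) = 1 := D.lift_grp ..

@[simp] theorem antipodeHom_y : D.antipodeHom D.y = MulOpposite.op (-(D.y * D.grp D.g⁻¹)) :=
  D.lift_y ..

@[simp] theorem antipodeHom_grp (h : G) : D.antipodeHom (D.grp h) = MulOpposite.op (D.grp h⁻¹) :=
  D.lift_grp ..

noncomputable instance instBialgebraAlg : Bialgebra k D.Alg :=
  Bialgebra.ofAlgHom D.comulHom D.counitHom
    (D.algHom_ext
      (by simp [TensorProduct.add_tmul, TensorProduct.tmul_add, Algebra.TensorProduct.one_def,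
        add_assoc])
      (fun h => by simp))
    (D.algHom_ext (by simp) (fun h => by simp))
    (D.algHom_ext (by simp) (fun h => by simp))

/-- The antipode of `H_D` as a linear map. -/
noncomputable def antipodeLin : D.Alg →ₗ[k] D.Alg :=
  (MulOpposite.opLinearEquiv k).symm.toLinearMap ∘ₗ D.antipodeHom.toLinearMap

theorem antipodeLin_mul (a b : D.Alg) :
    D.antipodeLin (a * b) = D.antipodeLin b * D.antipodeLin a := by
  simp [antipodeLin]

@[simp] theorem antipodeLin_y : D.antipodeLin D.y = -(D.y * D.grp D.g⁻¹) := by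
  simp [antipodeLin]

@[simp] theorem antipodeLin_grp (h : G) : D.antipodeLin (D.grp h) = D.grp h⁻¹ := by
  simp [antipodeLin]

@[simp] theorem antipodeLin_one : D.antipodeLin 1 = 1 := by
  simp [antipodeLin]

theorem antipode_left (a : D.Alg) :
    LinearMap.mul' k D.Alg (D.antipodeLin.rTensor D.Alg (D.comulHom a)) =
      algebraMap k D.Alg (D.counitHom a) := by
  induction a using D.alg_induction with
  | hc c => simp [Algebra.TensorProduct.one_def, Algebra.algebraMap_eq_smul_one]
  | hy => simp [mul_assoc, grp_inv_mul]
  | hg h => simp [grp_inv_mul]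
  | hadd a b ha hb => simp only [map_add, ha, hb]
  | hmul a b ha hb =>
    rw [_root_.map_mul D.comulHom, _root_.map_mul D.counitHom,
      _root_.map_mul (algebraMap k D.Alg)]
    have key : ∀ s t : D.Alg ⊗[k] D.Alg, ∀ c : k,
        LinearMap.mul' k D.Alg (D.antipodeLin.rTensor D.Alg t) = algebraMap k D.Alg c →
        LinearMap.mul' k D.Alg (D.antipodeLin.rTensor D.Alg (t * s)) =
        algebraMap k D.Alg c * LinearMap.mul' k D.Alg (D.antipodeLin.rTensor D.Alg s) := by
      intro s t c hc
      induction s with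
      | zero => simp
      | add s s' hs hs' => simp only [mul_add, map_add, hs, hs']
      | tmul x z =>
        have : LinearMap.mul' k D.Alg (D.antipodeLin.rTensor D.Alg (t * x ⊗ₜ z)) =
            D.antipodeLin x * LinearMap.mul' k D.Alg (D.antipodeLin.rTensor D.Alg t) * z := by
          clear hc
          induction t with
          | zero => simp
          | add s s' hs hs' => simp only [add_mul, mul_add, map_add, hs, hs']
          | tmul u v => simp [antipodeLin_mul, mul_assoc]
        rw [this, hc, ← Algebra.commutes]
        simp [mul_assoc]
    rw [key _ _ _ ha, hb]

theorem antipode_right (a : D.Alg) :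
    LinearMap.mul' k D.Alg (D.antipodeLin.lTensor D.Alg (D.comulHom a)) =
      algebraMap k D.Alg (D.counitHom a) := by
  induction a using D.alg_induction with
  | hc c => simp [Algebra.TensorProduct.one_def, Algebra.algebraMap_eq_smul_one]
  | hy => simp
  | hg h => simp [grp_mul_inv]
  | hadd a b ha hb => simp only [map_add, ha, hb]
  | hmul a b ha hb =>
    rw [_root_.map_mul D.comulHom, _root_.map_mul D.counitHom,
      _root_.map_mul (algebraMap k D.Alg)]
    have key : ∀ s t : D.Alg ⊗[k] D.Alg, ∀ c : k,
        LinearMap.mul' k D.Alg (D.antipodeLin.lTensor D.Alg s) = algebraMap k D.Alg c →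
        LinearMap.mul' k D.Alg (D.antipodeLin.lTensor D.Alg (t * s)) =
        LinearMap.mul' k D.Alg (D.antipodeLin.lTensor D.Alg t) * algebraMap k D.Alg c := by
      intro s t c hc
      induction t with
      | zero => simp
      | add s s' hs hs' => simp only [add_mul, map_add, hs, hs']
      | tmul x z =>
        have : LinearMap.mul' k D.Alg (D.antipodeLin.lTensor D.Alg (x ⊗ₜ z * s)) =
            x * LinearMap.mul' k D.Alg (D.antipodeLin.lTensor D.Alg s) * D.antipodeLin z := by
          clear hc
          induction s with
          | zero => simp
          | add s s' hs hs' => simp only [add_mul, mul_add, map_add, hs, hs']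
          | tmul u v => simp [antipodeLin_mul, mul_assoc]
        rw [this, hc, mul_assoc, Algebra.commutes]
        simp [mul_assoc]
    rw [key _ _ _ hb, ha]

/-- The Hopf algebra `H_D` associated to the group datum `D`. -/
noncomputable instance : HopfAlgebra k D.Alg where
  antipode := D.antipodeLin
  mul_antipode_rTensor_comul := LinearMap.ext D.antipode_left
  mul_antipode_lTensor_comul := LinearMap.ext D.antipode_right

/-! ### The modules `M(j, i)` -/

/-- The action of `h ∈ G` on `W ⊕ x W ⊕ ⋯ ⊕ x^{j-1} W`: `h (x^l v) = χ(h)^{-l} x^l (h v)`. The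
vector `∑ x^l v_l` is represented by the function `l ↦ v_l`. -/
noncomputable def grpAct (j : ℕ) (W : FDModule k (MonoidAlgebra k G)) :
    G →* Module.End k (Fin j → W) where
  toFun h := LinearMap.pi fun l =>
    (((D.χ h)⁻¹ : kˣ) : k) ^ (l : ℕ) • (W.ρ (MonoidAlgebra.of k G h) ∘ₗ LinearMap.proj l)
  map_one' := by
    refine LinearMap.ext fun v => funext fun l => ?_
    simp only [LinearMap.pi_apply, LinearMap.comp_apply, LinearMap.proj_apply,
      _root_.map_one, inv_one, Units.val_one, one_pow, one_smul, Module.End.one_apply]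
  map_mul' h h' := by
    refine LinearMap.ext fun v => funext fun l => ?_
    simp only [LinearMap.pi_apply, LinearMap.smul_apply, LinearMap.comp_apply, LinearMap.proj_apply,
      _root_.map_mul, mul_inv, Units.val_mul, mul_pow, Module.End.mul_apply, map_smul, smul_smul]

theorem grpAct_apply (j : ℕ) (W : FDModule k (MonoidAlgebra k G)) (h : G) (v : Fin j → W)
    (l : Fin j) : D.grpAct j W h v l =
      (((D.χ h)⁻¹ : kˣ) : k) ^ (l : ℕ) • W.ρ (MonoidAlgebra.of k G h) (v l) := rfl

/-- The action of `y` on `W ⊕ x W ⊕ ⋯ ⊕ x^{j-1} W`: `y (x^l v) = x^{l+1} v` for `l + 1 < j` and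
`y (x^{j-1} v) = 0`. -/
noncomputable def yAct (j : ℕ) (W : FDModule k (MonoidAlgebra k G)) :
    Module.End k (Fin j → W) :=
  LinearMap.pi fun l =>
    if (l : ℕ) = 0 then 0 else LinearMap.proj (⟨(l : ℕ) - 1, by omega⟩ : Fin j)

theorem yAct_apply (j : ℕ) (W : FDModule k (MonoidAlgebra k G)) (v : Fin j → W) (l : Fin j) :
    yAct j W v l = if (l : ℕ) = 0 then 0 else v ⟨(l : ℕ) - 1, by omega⟩ := by
  simp only [yAct, LinearMap.pi_apply]
  split_ifs <;> rfl

theorem yAct_pow_apply (j : ℕ) (W : FDModule k (MonoidAlgebra k G)) (m : ℕ) (v : Fin j → W)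
    (l : Fin j) : (yAct j W ^ m) v l = if (l : ℕ) < m then 0 else v ⟨(l : ℕ) - m, by omega⟩ := by
  induction m generalizing l with
  | zero => simp
  | succ m ih =>
    rw [pow_succ', Module.End.mul_apply, yAct_apply]
    by_cases h0 : (l : ℕ) = 0
    · simp [h0]
    · rw [if_neg h0, ih]
      by_cases h1 : (l : ℕ) < m + 1
      · rw [if_pos h1, if_pos (by simp; omega)]
      · rw [if_neg h1, if_neg (by simp; omega)]
        congr 1
        ext
        simp
        omega

theorem yAct_pow (j : ℕ) (hj : j ≤ D.n) (W : FDModule k (MonoidAlgebra k G))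
    (hW : W.ρ (MonoidAlgebra.of k G (D.g ^ D.n)) = 1) :
    yAct j W ^ D.n = D.μ • (D.grpAct j W (D.g ^ D.n) - 1) := by
  have h1 : D.χ (D.g ^ D.n) = 1 := by rw [map_pow]; exact pow_orderOf_eq_one _
  refine LinearMap.ext fun v => funext fun l => ?_
  rw [yAct_pow_apply, if_pos (by omega), LinearMap.smul_apply, LinearMap.sub_apply, Pi.smul_apply,
    Pi.sub_apply, grpAct_apply, hW, h1]
  simp

theorem yAct_comm (j : ℕ) (W : FDModule k (MonoidAlgebra k G)) (h : G) :
    yAct j W * D.grpAct j W h = (D.χ h : k) • (D.grpAct j W h * yAct j W) := by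
  refine LinearMap.ext fun v => funext fun l => ?_
  rw [LinearMap.smul_apply, Pi.smul_apply, Module.End.mul_apply, Module.End.mul_apply, yAct_apply,
    grpAct_apply, grpAct_apply, yAct_apply]
  split_ifs with h0
  · simp
  · obtain ⟨m, hm⟩ := Nat.exists_eq_succ_of_ne_zero h0
    rw [smul_smul]
    congr 1
    simp [hm, pow_succ']

/-- The `H_D`-module `M = W ⊕ x W ⊕ ⋯ ⊕ x^{j-1} W`, for `j ≤ n` and a `k[G]`-module `W` on which
`gⁿ` acts as the identity. -/
noncomputable def M (j : ℕ) (hj : j ≤ D.n) (W : FDModule k (MonoidAlgebra k G))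
    (hW : W.ρ (MonoidAlgebra.of k G (D.g ^ D.n)) = 1) : FDModule k D.Alg where
  carrier := Fin j → W
  ρ := D.lift (yAct j W) (D.grpAct j W) (D.yAct_pow j hj W hW) (D.yAct_comm j W)

theorem M_ρ_y (j : ℕ) (hj : j ≤ D.n) (W : FDModule k (MonoidAlgebra k G))
    (hW : W.ρ (MonoidAlgebra.of k G (D.g ^ D.n)) = 1) : (D.M j hj W hW).ρ D.y = yAct j W :=
  D.lift_y _ _ (D.yAct_pow j hj W hW) (D.yAct_comm j W)

theorem M_ρ_grp (j : ℕ) (hj : j ≤ D.n) (W : FDModule k (MonoidAlgebra k G))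
    (hW : W.ρ (MonoidAlgebra.of k G (D.g ^ D.n)) = 1) (h : G) :
    (D.M j hj W hW).ρ (D.grp h) = D.grpAct j W h :=
  D.lift_grp _ _ (D.yAct_pow j hj W hW) (D.yAct_comm j W) h

/-- The index set of the modules `M(j, i)` with `1 ≤ j ≤ n - 1` and `i ∈ Ω₀`, where `Ω₀` is the set
of those `i ∈ Ω` for which `gⁿ` acts on `V i` as the identity. -/
def StableIndex {Ω : Type w} (V : Ω → FDModule k (MonoidAlgebra k G)) : Type w :=
  {p : ℕ × Ω // (1 ≤ p.1 ∧ p.1 < D.n) ∧ (V p.2).ρ (MonoidAlgebra.of k G (D.g ^ D.n)) = 1}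

/-- The module `M(j, i)`, for an index `(j, i)` with `1 ≤ j ≤ n - 1` and `i ∈ Ω₀`. -/
noncomputable def stableM {Ω : Type w} (V : Ω → FDModule k (MonoidAlgebra k G))
    (p : D.StableIndex V) : FDModule k D.Alg :=
  D.M p.1.1 p.2.1.2.le (V p.1.2) p.2.2

end Hopf

end GroupDatum

/-! The element `g ^ n` is central in `H`, and `y ^ n = μ (g ^ n - 1)` with `μ ≠ 0`. A module on
which `g ^ n` has no nonzero fixed vector has `y ^ n` invertible, and is then a direct summand of
the module induced from its restriction to `G`, hence projective. On the vectors fixed by `g ^ n`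
one has `y ^ n = 0`. If `y ^ (j-1)` is the last power that does not vanish there, semisimplicity of
`kG` provides a simple `G`-subspace on which `y ^ (j-1)` is injective; it generates a copy of some
`M(j,i)`, and this copy splits off. `M(n,i)` is induced, hence projective, whereas a nonzero module
killed by `y ^ (n-1)` never is. So every module is either projective or has a summand `M(j,i)` with
`j < n` (`isProjective_or_iso_directSum`).

Each `M(j,i)` is a brick (`M_isBrick`): the central element `g` acts on the layers `x^l V_i` by
distinct scalars, so an endomorphism preserves `V_i`, where it is a scalar by Schur. This replaces
the Krull-Schmidt theorem: the multiplicity of a brick `M` in `X` is the rank of the trace pairing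
between `Hom(M, X)` and `Hom(X, M)`. It is additive, and for non-projective `M` it is an invariant
of stable isomorphism, because an endomorphism of `M` that factors through a projective module is a
scalar that must be zero. The multiplicities of the `M(p)` are therefore coordinates on `r_st(H)`.
They also show that stably isomorphic modules agree modulo the ideal of projectives, which gives
part 1.

In the fusion ring the structure constants are multiplicities and the involution is duality; `g`
intertwines `X` and its double dual because `S²` is conjugation by `g`. The functional `ψ` is the
multiplicity of the trivial module. In `X ⊗ Y` the relevant pairing is the trace on `Y` of a
composite `Y → X* → Y` followed by `g⁻¹` (`pairing_trivial`). For bricks it vanishes unless `X* ≅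
Y`, and then it is governed by the trace of `g⁻¹` on `Y`, a quantum dimension proportional to `1 + q
+ ⋯ + q^(j-1)` with `q = χ(g)`, which is nonzero for `0 < j < n`. Transitivity holds in every fusion
ring. -/

/-! ### Generalities on finite dimensional modules -/

namespace FDModule

section Generic

variable {k : Type u} [Field k] {A : Type v} [Ring A] [Algebra k A]

/-- A finite dimensional `A`-module regarded as an object of `FDModule k A`. -/
def of (k : Type u) [Field k] (A : Type v) [Ring A] [Algebra k A] (M : Type u) [AddCommGroup M]
    [Module k M] [Module A M] [IsScalarTower k A M] [Module.Finite k M] : FDModule k A where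
  carrier := M
  ρ := Algebra.lsmul k k M

/-- The identity map, as an isomorphism of `A`-modules. -/
def ofEquiv (M : Type u) [AddCommGroup M] [Module k M] [Module A M] [IsScalarTower k A M]
    [Module.Finite k M] : of k A M ≃ₗ[A] M where
  toFun x := x
  invFun x := x
  map_add' _ _ := rfl
  map_smul' _ _ := rfl
  left_inv _ := rfl
  right_inv _ := rfl

theorem Iso.refl (X : FDModule k A) : Iso X X := ⟨LinearEquiv.refl _ _⟩

theorem Iso.symm {X Y : FDModule k A} (h : Iso X Y) : Iso Y X := h.map LinearEquiv.symm

theorem Iso.trans {X Y Z : FDModule k A} (h : Iso X Y) (h' : Iso Y Z) : Iso X Z :=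
  h.elim fun e => h'.map e.trans

theorem Iso.isProjective {X Y : FDModule k A} (h : Iso X Y) (hX : X.IsProjective) :
    Y.IsProjective := by
  obtain ⟨e⟩ := h
  have : Module.Projective A X := hX
  exact Module.Projective.of_equiv e

theorem Iso.finrank_eq {X Y : FDModule k A} (h : Iso X Y) :
    Module.finrank k X = Module.finrank k Y :=
  h.elim fun e => (e.restrictScalars k).finrank_eq

/-- The inclusion of the first summand. -/
def inl (X Y : FDModule k A) : X →ₗ[A] X.directSum Y where
  toFun x := ((x, 0) : X × Y)
  map_add' _ _ := Prod.ext rfl (add_zero _).symm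
  map_smul' a _ := Prod.ext rfl (map_zero (Y.ρ a)).symm

/-- The inclusion of the second summand. -/
def inr (X Y : FDModule k A) : Y →ₗ[A] X.directSum Y where
  toFun y := ((0, y) : X × Y)
  map_add' _ _ := Prod.ext (add_zero _).symm rfl
  map_smul' a _ := Prod.ext (map_zero (X.ρ a)).symm rfl

/-- The projection onto the first summand. -/
def fst (X Y : FDModule k A) : X.directSum Y →ₗ[A] X where
  toFun x := (x : X × Y).1
  map_add' _ _ := rfl
  map_smul' _ _ := rfl

/-- The projection onto the second summand. -/
def snd (X Y : FDModule k A) : X.directSum Y →ₗ[A] Y where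
  toFun x := (x : X × Y).2
  map_add' _ _ := rfl
  map_smul' _ _ := rfl

theorem fst_inl (X Y : FDModule k A) : fst X Y ∘ₗ inl X Y = LinearMap.id := rfl
theorem snd_inr (X Y : FDModule k A) : snd X Y ∘ₗ inr X Y = LinearMap.id := rfl
theorem fst_inr (X Y : FDModule k A) : fst X Y ∘ₗ inr X Y = 0 := rfl
theorem snd_inl (X Y : FDModule k A) : snd X Y ∘ₗ inl X Y = 0 := rfl

theorem inl_fst_add_inr_snd (X Y : FDModule k A) :
    inl X Y ∘ₗ fst X Y + inr X Y ∘ₗ snd X Y = LinearMap.id :=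
  LinearMap.ext fun x => Prod.ext (add_zero (x : X × Y).1) (zero_add (x : X × Y).2)

theorem iso_directSum {X Y Z : FDModule k A} (i : X →ₗ[A] Z) (j : Y →ₗ[A] Z) (p : Z →ₗ[A] X)
    (q : Z →ₗ[A] Y) (hpi : p ∘ₗ i = LinearMap.id) (hqj : q ∘ₗ j = LinearMap.id)
    (hpj : p ∘ₗ j = 0) (hqi : q ∘ₗ i = 0) (h : i ∘ₗ p + j ∘ₗ q = LinearMap.id) :
    Iso Z (X.directSum Y) := by
  refine ⟨LinearEquiv.ofLinearMap (inl X Y ∘ₗ p + inr X Y ∘ₗ q) (i ∘ₗ fst X Y + j ∘ₗ snd X Y) ?_ ?_⟩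
  · have : (inl X Y ∘ₗ p + inr X Y ∘ₗ q) ∘ₗ (i ∘ₗ fst X Y + j ∘ₗ snd X Y) =
        inl X Y ∘ₗ (p ∘ₗ i) ∘ₗ fst X Y + inl X Y ∘ₗ (p ∘ₗ j) ∘ₗ snd X Y +
        (inr X Y ∘ₗ (q ∘ₗ i) ∘ₗ fst X Y + inr X Y ∘ₗ (q ∘ₗ j) ∘ₗ snd X Y) := by
      simp only [LinearMap.add_comp, LinearMap.comp_add, LinearMap.comp_assoc]
      abel
    rw [this, hpi, hqj, hpj, hqi, ← inl_fst_add_inr_snd]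
    simp
  · have : (i ∘ₗ fst X Y + j ∘ₗ snd X Y) ∘ₗ (inl X Y ∘ₗ p + inr X Y ∘ₗ q) =
        i ∘ₗ (fst X Y ∘ₗ inl X Y) ∘ₗ p + i ∘ₗ (fst X Y ∘ₗ inr X Y) ∘ₗ q +
        (j ∘ₗ (snd X Y ∘ₗ inl X Y) ∘ₗ p + j ∘ₗ (snd X Y ∘ₗ inr X Y) ∘ₗ q) := by
      simp only [LinearMap.add_comp, LinearMap.comp_add, LinearMap.comp_assoc]
      abel
    rw [this, fst_inl, fst_inr, snd_inl, snd_inr, ← h]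
    simp

/-- The complement is the kernel of the retraction, with projector `id - i ∘ p`. -/
theorem exists_iso_directSum_of_retract {M X : FDModule k A} (i : M →ₗ[A] X) (p : X →ₗ[A] M)
    (h : p ∘ₗ i = LinearMap.id) : ∃ Z : FDModule k A, Iso X (M.directSum Z) := by
  have h' : ∀ x, p (i x) = x := LinearMap.congr_fun h
  have : Module.Finite k (LinearMap.ker p) := Module.Finite.of_injective
    ((LinearMap.ker p).subtype.restrictScalars k) (LinearMap.ker p).subtype_injective
  let e := ofEquiv (k := k) (A := A) (LinearMap.ker p)
  let q : X →ₗ[A] LinearMap.ker p := (LinearMap.id - i ∘ₗ p).codRestrict _ fun x => by simp [h']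
  have hq : ∀ x, (q x : X) = x - i (p x) := fun _ => rfl
  refine ⟨of k A (LinearMap.ker p), iso_directSum i ((LinearMap.ker p).subtype ∘ₗ e.toLinearMap) p
    (e.symm.toLinearMap ∘ₗ q) h ?_ ?_ ?_ ?_⟩
  · refine LinearMap.ext fun x => e.injective (Subtype.ext ?_)
    simp [hq]
  · refine LinearMap.ext fun x => ?_
    simp
  · refine LinearMap.ext fun x => e.injective (Subtype.ext ?_)
    simp [hq, h']
  · refine LinearMap.ext fun x => ?_
    simp [hq]

theorem isProjective_of_retract {M X : FDModule k A} (i : M →ₗ[A] X) (p : X →ₗ[A] M)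
    (h : p ∘ₗ i = LinearMap.id) (hX : X.IsProjective) : M.IsProjective :=
  have : Module.Projective A X := hX
  Module.Projective.of_split i p h

theorem IsProjective.directSum {X Y : FDModule k A} (hX : X.IsProjective) (hY : Y.IsProjective) :
    (X.directSum Y).IsProjective := by
  have : Module.Projective A X := hX
  have : Module.Projective A Y := hY
  exact Module.Projective.of_equiv (R := A) (S := A) (σ := RingHom.id A) (σ' := RingHom.id A)
    (M := X × Y) (N := X.directSum Y)
    { toFun := fun x => x, invFun := fun x => x, map_add' := fun _ _ => rfl,
      map_smul' := fun _ _ => rfl, left_inv := fun _ => rfl, right_inv := fun _ => rfl }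

theorem isProjective_of_subsingleton (X : FDModule k A) [Subsingleton X] : X.IsProjective :=
  Module.Projective.of_free

theorem directSum_congr {X X' Y Y' : FDModule k A} (h : Iso X X') (h' : Iso Y Y') :
    Iso (X.directSum Y) (X'.directSum Y') := by
  obtain ⟨e⟩ := h
  obtain ⟨f⟩ := h'
  exact Iso.of_equiv ((e.restrictScalars k).prodCongr (f.restrictScalars k)) fun a x =>
    Prod.ext (e.map_smul a _) (f.map_smul a _)

theorem directSum_left_comm (X Y Z : FDModule k A) :
    Iso (X.directSum (Y.directSum Z)) (Y.directSum (X.directSum Z)) :=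
  Iso.of_equiv (X := X.directSum (Y.directSum Z)) (Y := Y.directSum (X.directSum Z))
    { toFun := fun x : X × Y × Z => ((x.2.1, x.1, x.2.2) : Y × X × Z)
      invFun := fun x : Y × X × Z => ((x.2.1, x.1, x.2.2) : X × Y × Z)
      map_add' := fun _ _ => rfl
      map_smul' := fun _ _ => rfl
      left_inv := fun _ => rfl
      right_inv := fun _ => rfl } fun _ _ => rfl

theorem finrank_directSum (X Y : FDModule k A) :
    Module.finrank k (X.directSum Y) = Module.finrank k X + Module.finrank k Y :=
  Module.finrank_prod (R := k) (M := X) (M' := Y)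

theorem iso_directSum_of_subsingleton (X Z : FDModule k A) [Subsingleton Z] :
    Iso (X.directSum Z) X := by
  refine ⟨LinearEquiv.ofLinearMap (fst X Z) (inl X Z) (fst_inl X Z) ?_⟩
  rw [← inl_fst_add_inr_snd, left_eq_add]
  exact LinearMap.ext fun x => Prod.ext rfl (Subsingleton.elim (α := Z) _ _)

/-- `X` is the internal direct sum of `range i` and `ker p`. The first is nonzero since `M` is, so
indecomposability forces `ker p = ⊥`. -/
theorem IsIndecomposable.iso_of_retract {M X : FDModule k A} [Nontrivial M]
    (hX : X.IsIndecomposable) (i : M →ₗ[A] X) (p : X →ₗ[A] M) (h : p ∘ₗ i = LinearMap.id) :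
    Iso X M := by
  have h' : ∀ x, p (i x) = x := LinearMap.congr_fun h
  have hc : IsCompl (LinearMap.range i) (LinearMap.ker p) := by
    refine IsCompl.of_eq ?_ ?_
    · refine (Submodule.eq_bot_iff _).mpr ?_
      rintro _ ⟨⟨x, rfl⟩, hx⟩
      have : x = 0 := by simpa [h'] using hx
      simp [this]
    · refine (Submodule.eq_top_iff').mpr fun x => ?_
      rw [← add_sub_cancel (i (p x)) x]
      exact Submodule.add_mem_sup ⟨_, rfl⟩ (by simp [h'])
  rcases hX.2 _ _ hc with h0 | h0
  · obtain ⟨x, hx⟩ := exists_ne (0 : M)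
    refine absurd ?_ hx
    have : i x ∈ LinearMap.range i := ⟨x, rfl⟩
    rw [h0, Submodule.mem_bot] at this
    rw [← h' x, this, map_zero]
  · exact ⟨LinearEquiv.ofBijective p ⟨LinearMap.ker_eq_bot.mp h0, fun x => ⟨i x, h' x⟩⟩⟩

theorem IsIndecomposable.iso_of_iso_directSum {M X Z : FDModule k A} [Nontrivial M]
    (hX : X.IsIndecomposable) (h : Iso X (M.directSum Z)) : Iso X M := by
  obtain ⟨e⟩ := h
  refine hX.iso_of_retract (e.symm.toLinearMap ∘ₗ inl M Z) (fst M Z ∘ₗ e.toLinearMap) ?_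
  ext x
  simpa using LinearMap.congr_fun (fst_inl M Z) x

/-! ### Bricks -/

/-- A brick: a nonzero module with only scalar endomorphisms. -/
def IsBrick (M : FDModule k A) : Prop :=
  Nontrivial M ∧ ∀ f : M →ₗ[A] M, ∃ c : k, ∀ x, f x = c • x

/-- The projector onto `p` along `q` is an endomorphism, hence a scalar, and a scalar projector is
`0` or `1`. -/
theorem IsBrick.isIndecomposable {M : FDModule k A} (hM : M.IsBrick) : M.IsIndecomposable := by
  refine ⟨hM.1, fun p q hpq => ?_⟩
  obtain ⟨c, hc⟩ := hM.2 (p.subtype ∘ₗ p.projectionOnto q hpq)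
  by_cases h : p = ⊥
  · exact .inl h
  · right
    obtain ⟨x, hx, hx0⟩ := Submodule.exists_mem_ne_zero_of_ne_bot h
    have h1 := hc x
    rw [LinearMap.comp_apply, Submodule.projectionOnto_apply_left hpq ⟨x, hx⟩] at h1
    refine (Submodule.eq_bot_iff _).mpr fun z hz => ?_
    have h2 := hc z
    rw [LinearMap.comp_apply, Submodule.projectionOnto_apply_right hpq ⟨z, hz⟩] at h2
    rcases smul_eq_zero.mp (h2.symm.trans (map_zero _)) with h3 | h3
    · rw [h3, zero_smul] at h1
      exact absurd h1 hx0
    · exact h3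

theorem IsBrick.of_iso {M M' : FDModule k A} (hM : M.IsBrick) (h : Iso M M') : M'.IsBrick := by
  obtain ⟨e⟩ := h
  have := hM.1
  refine ⟨e.symm.toEquiv.nontrivial, fun f => ?_⟩
  obtain ⟨c, hc⟩ := hM.2 (e.symm.toLinearMap ∘ₗ f ∘ₗ e.toLinearMap)
  refine ⟨c, fun x => e.symm.injective ?_⟩
  rw [← LinearEquiv.coe_coe, LinearMap.map_smul_of_tower]
  simpa using hc (e.symm x)

/-- The composite is a nonzero scalar; dividing by it exhibits `M` as a retract of `X`. This plays
the role of locality of the endomorphism ring. -/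
theorem IsBrick.iso_of_comp_ne_zero {M X : FDModule k A} (hM : M.IsBrick)
    (hX : X.IsIndecomposable) (i : M →ₗ[A] X) (p : X →ₗ[A] M) (h : p ∘ₗ i ≠ 0) : Iso X M := by
  have := hM.1
  obtain ⟨c, hc⟩ := hM.2 (p ∘ₗ i)
  have h0 : c ≠ 0 := fun h0 => h (LinearMap.ext fun x => by rw [hc, h0, zero_smul]; rfl)
  refine hX.iso_of_retract i (c⁻¹ • p) (LinearMap.ext fun x => ?_)
  change c⁻¹ • (p ∘ₗ i) x = x
  rw [hc, smul_smul, inv_mul_cancel₀ h0, one_smul]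

theorem IsBrick.isProjective_of_comp_ne_zero {M X : FDModule k A} (hM : M.IsBrick)
    (hX : X.IsProjective) (i : M →ₗ[A] X) (p : X →ₗ[A] M) (h : p ∘ₗ i ≠ 0) :
    M.IsProjective := by
  obtain ⟨c, hc⟩ := hM.2 (p ∘ₗ i)
  have h0 : c ≠ 0 := fun h0 => h (LinearMap.ext fun x => by rw [hc, h0, zero_smul]; rfl)
  refine isProjective_of_retract i (c⁻¹ • p) (LinearMap.ext fun x => ?_) hX
  change c⁻¹ • (p ∘ₗ i) x = x
  rw [hc, smul_smul, inv_mul_cancel₀ h0, one_smul]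

/-! ### The multiplicity of a brick in a module -/

instance (X Y : FDModule k A) : Module.Finite k (X →ₗ[A] Y) :=
  Module.Finite.of_injective (LinearMap.restrictScalarsₗ k A X Y k)
    (LinearMap.restrictScalars_injective k)

/-- The pairing `(φ, ψ) ↦ tr(ψ ∘ φ)` between `Hom(M, X)` and `Hom(X, M)`. -/
noncomputable def pairing (M X : FDModule k A) : (M →ₗ[A] X) →ₗ[k] Module.Dual k (X →ₗ[A] M) :=
  LinearMap.mk₂ k (fun φ ψ => LinearMap.trace k M ((ψ ∘ₗ φ).restrictScalars k))
    (fun φ φ' ψ => by rw [LinearMap.comp_add, LinearMap.restrictScalars_add, map_add])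
    (fun c φ ψ => by
      rw [← map_smul]
      exact congrArg _ (LinearMap.ext fun x => ψ.map_smul_of_tower c (φ x)))
    (fun φ ψ ψ' => by rw [LinearMap.add_comp, LinearMap.restrictScalars_add, map_add])
    (fun c φ ψ => by rw [← map_smul]; rfl)

theorem pairing_apply (M X : FDModule k A) (φ : M →ₗ[A] X) (ψ : X →ₗ[A] M) :
    pairing M X φ ψ = LinearMap.trace k M ((ψ ∘ₗ φ).restrictScalars k) := rfl

theorem pairing_of_comp_eq_zero {M X : FDModule k A} {φ : M →ₗ[A] X} {ψ : X →ₗ[A] M}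
    (h : ψ ∘ₗ φ = 0) : pairing M X φ ψ = 0 := by
  rw [pairing_apply, h, LinearMap.restrictScalars_zero, map_zero]

/-- The rank of the pairing `(φ, ψ) ↦ tr(ψ ∘ φ)`. For a brick `M` it is the multiplicity of `M`
as a direct summand of `X`. -/
noncomputable def mult (M X : FDModule k A) : ℕ :=
  Module.finrank k (LinearMap.range (pairing M X))

theorem mult_eq_zero_of_pairing {M X : FDModule k A} (h : ∀ φ ψ, pairing M X φ ψ = 0) :
    mult M X = 0 := by
  have : pairing M X = 0 := LinearMap.ext fun φ => LinearMap.ext fun ψ => h φ ψ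
  rw [mult, this, LinearMap.range_zero, finrank_bot]

theorem mult_eq_one {M X : FDModule k A} (h : Module.finrank k (M →ₗ[A] X) ≤ 1)
    {φ : M →ₗ[A] X} {ψ : X →ₗ[A] M} (h' : pairing M X φ ψ ≠ 0) : mult M X = 1 := by
  refine le_antisymm ((LinearMap.finrank_range_le _).trans h) (Nat.one_le_iff_ne_zero.mpr ?_)
  intro h0
  rw [mult, Submodule.finrank_eq_zero, LinearMap.range_eq_bot] at h0
  rw [h0] at h'
  exact h' rfl

/-- The hypothesis says that the pairing for `X` is pulled back from the one for `Y` along linear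
maps, and a pullback cannot increase the rank of a bilinear form. -/
theorem mult_le_of_pairing_eq {M X Y : FDModule k A} (f : X →ₗ[A] Y) (g : Y →ₗ[A] X)
    (h : ∀ φ ψ, pairing M X φ ψ = pairing M Y (f ∘ₗ φ) (ψ ∘ₗ g)) : mult M X ≤ mult M Y := by
  let F : (M →ₗ[A] X) →ₗ[k] (M →ₗ[A] Y) :=
    { toFun := fun φ => f ∘ₗ φ
      map_add' := fun _ _ => LinearMap.comp_add _ _ _
      map_smul' := fun c φ => LinearMap.ext fun x => f.map_smul_of_tower c (φ x) }
  let E : (X →ₗ[A] M) →ₗ[k] (Y →ₗ[A] M) :=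
    { toFun := fun ψ => ψ ∘ₗ g
      map_add' := fun _ _ => rfl
      map_smul' := fun _ _ => rfl }
  have : pairing M X = E.dualMap ∘ₗ pairing M Y ∘ₗ F :=
    LinearMap.ext fun φ => LinearMap.ext fun ψ => h φ ψ
  rw [mult, this, LinearMap.range_comp]
  refine (Submodule.finrank_map_le _ _).trans (Submodule.finrank_mono ?_)
  exact LinearMap.range_comp_le_range _ _

/-- Both Hom spaces split along `X ⊕ Y`, and the pairing is block diagonal for these splittings, so
its rank is the sum of the ranks of the blocks. -/
theorem mult_directSum (M X Y : FDModule k A) :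
    mult M (X.directSum Y) = mult M X + mult M Y := by
  let E : (M →ₗ[A] X.directSum Y) →ₗ[k] (M →ₗ[A] X) × (M →ₗ[A] Y) :=
    { toFun := fun φ => (fst X Y ∘ₗ φ, snd X Y ∘ₗ φ)
      map_add' := fun _ _ => rfl
      map_smul' := fun _ _ => rfl }
  let L : Module.Dual k (X.directSum Y →ₗ[A] M) →ₗ[k]
      Module.Dual k (X →ₗ[A] M) × Module.Dual k (Y →ₗ[A] M) :=
    { toFun := fun θ =>
        (θ ∘ₗ { toFun := fun ψ => ψ ∘ₗ fst X Y, map_add' := fun _ _ => rfl,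
                map_smul' := fun _ _ => rfl },
         θ ∘ₗ { toFun := fun ψ => ψ ∘ₗ snd X Y, map_add' := fun _ _ => rfl,
                map_smul' := fun _ _ => rfl })
      map_add' := fun _ _ => rfl
      map_smul' := fun _ _ => rfl }
  have hE : Function.Surjective E := fun ⟨a, b⟩ =>
    ⟨inl X Y ∘ₗ a + inr X Y ∘ₗ b, Prod.ext
      (LinearMap.ext fun x => add_zero (a x)) (LinearMap.ext fun x => zero_add (b x))⟩
  have hL : Function.Injective L := by
    intro θ θ' h
    refine LinearMap.ext fun ψ => ?_
    have e : ψ = (ψ ∘ₗ inl X Y) ∘ₗ fst X Y + (ψ ∘ₗ inr X Y) ∘ₗ snd X Y := by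
      rw [LinearMap.comp_assoc, LinearMap.comp_assoc, ← LinearMap.comp_add, inl_fst_add_inr_snd,
        LinearMap.comp_id]
    have h1 := LinearMap.congr_fun (congrArg Prod.fst h) (ψ ∘ₗ inl X Y)
    have h2 := LinearMap.congr_fun (congrArg Prod.snd h) (ψ ∘ₗ inr X Y)
    rw [e, map_add, map_add]
    exact congrArg₂ (· + ·) h1 h2
  have key : L ∘ₗ pairing M (X.directSum Y) = (pairing M X).prodMap (pairing M Y) ∘ₗ E := rfl
  have h1 : mult M (X.directSum Y) =
      Module.finrank k (LinearMap.range (L ∘ₗ pairing M (X.directSum Y))) := by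
    rw [LinearMap.range_comp, (Submodule.equivMapOfInjective L hL _).symm.finrank_eq]
    rfl
  -- Composing with the injective `L` on the left and the surjective `E` on the right leaves the
  -- rank unchanged.
  rw [h1, key, LinearMap.range_comp, LinearMap.range_eq_top.mpr hE, Submodule.map_top,
    LinearMap.range_prodMap]
  let e : (LinearMap.range (pairing M X)).prod (LinearMap.range (pairing M Y)) ≃ₗ[k]
      LinearMap.range (pairing M X) × LinearMap.range (pairing M Y) :=
    { toFun := fun x => (⟨x.1.1, x.2.1⟩, ⟨x.1.2, x.2.2⟩)
      invFun := fun x => ⟨(x.1.1, x.2.1), x.1.2, x.2.2⟩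
      map_add' := fun _ _ => rfl
      map_smul' := fun _ _ => rfl
      left_inv := fun _ => rfl
      right_inv := fun _ => rfl }
  have := Module.Free.of_divisionRing k (LinearMap.range (pairing M X))
  have := Module.Free.of_divisionRing k (LinearMap.range (pairing M Y))
  exact e.finrank_eq.trans Module.finrank_prod

/-- The endomorphisms form a line spanned by the identity, whose trace `dim M` is nonzero in
characteristic zero. -/
theorem IsBrick.mult_self [CharZero k] {M : FDModule k A} (hM : M.IsBrick) : mult M M = 1 := by
  have := hM.1
  refine mult_eq_one (φ := LinearMap.id) (ψ := LinearMap.id) ?_ ?_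
  · refine finrank_le_one LinearMap.id fun f => ?_
    obtain ⟨c, hc⟩ := hM.2 f
    exact ⟨c, LinearMap.ext fun x => (hc x).symm⟩
  · rw [pairing_apply]
    have : LinearMap.trace k M LinearMap.id ≠ 0 := by
      rw [LinearMap.trace_id]
      exact Nat.cast_ne_zero.mpr Module.finrank_pos.ne'
    exact this

theorem IsBrick.mult_eq_zero {M X : FDModule k A} (hM : M.IsBrick) (hX : X.IsIndecomposable)
    (h : ¬ Iso X M) : mult M X = 0 :=
  mult_eq_zero_of_pairing fun φ ψ => pairing_of_comp_eq_zero <| by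
    by_contra h'
    exact h (hM.iso_of_comp_ne_zero hX φ ψ h')

theorem IsBrick.mult_eq_zero_of_isProjective {M X : FDModule k A} (hM : M.IsBrick)
    (h : ¬ M.IsProjective) (hX : X.IsProjective) : mult M X = 0 :=
  mult_eq_zero_of_pairing fun φ ψ => pairing_of_comp_eq_zero <| by
    by_contra h'
    exact h (hM.isProjective_of_comp_ne_zero hX φ ψ h')

theorem StableIso.symm {X Y : FDModule k A} (h : StableIso X Y) : StableIso Y X := by
  obtain ⟨f, g, h1, h2⟩ := h
  exact ⟨g, f, h2, h1⟩

theorem Iso.mult_eq {M X Y : FDModule k A} (h : Iso X Y) : mult M X = mult M Y := by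
  obtain ⟨e⟩ := h
  refine le_antisymm (mult_le_of_pairing_eq e.toLinearMap e.symm.toLinearMap fun φ ψ => ?_)
    (mult_le_of_pairing_eq e.symm.toLinearMap e.toLinearMap fun φ ψ => ?_)
  · rw [pairing_apply, pairing_apply]
    congr 2
    ext x
    simp
  · rw [pairing_apply, pairing_apply]
    congr 2
    ext x
    simp

/-- Replacing `φ, ψ` by `f ∘ φ, ψ ∘ g` changes `ψ ∘ φ` by an endomorphism of `M` through a
projective module. A nonzero one would make the brick `M` a retract of that module. -/
theorem IsBrick.mult_le_of_stableIso {M X Y : FDModule k A} (hM : M.IsBrick)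
    (h : ¬ M.IsProjective) (hXY : StableIso X Y) : mult M X ≤ mult M Y := by
  obtain ⟨f, g, ⟨P, hP, s, t, hst⟩, -⟩ := hXY
  refine mult_le_of_pairing_eq f g fun φ ψ => ?_
  have h0 : (ψ ∘ₗ t) ∘ₗ (s ∘ₗ φ) = 0 := by
    by_contra h'
    exact h (hM.isProjective_of_comp_ne_zero hP _ _ h')
  have h1 : (ψ ∘ₗ g) ∘ₗ (f ∘ₗ φ) = ψ ∘ₗ φ := by
    have h2 : ψ ∘ₗ (g ∘ₗ f - LinearMap.id) ∘ₗ φ = 0 := by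
      rw [hst, ← h0, LinearMap.comp_assoc, LinearMap.comp_assoc]
    rw [LinearMap.sub_comp, LinearMap.comp_sub, LinearMap.id_comp, sub_eq_zero] at h2
    rw [← h2]
    rfl
  rw [pairing_apply, pairing_apply, h1]

theorem IsBrick.mult_eq_of_stableIso {M X Y : FDModule k A} (hM : M.IsBrick)
    (h : ¬ M.IsProjective) (hXY : StableIso X Y) : mult M X = mult M Y :=
  le_antisymm (hM.mult_le_of_stableIso h hXY) (hM.mult_le_of_stableIso h hXY.symm)

end Generic

end FDModule

/-! ### Averaging over a finite group -/

section Averaging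

variable {k : Type*} [Field k] {G : Type*} [Group G] [Finite G]
  {E F : Type*} [AddCommGroup E] [Module k E] [AddCommGroup F] [Module k F]

/-- The average of a linear map between two representations of a finite group. -/
noncomputable def repAverage (σ : G →* Module.End k E) (τ : G →* Module.End k F) (f : E →ₗ[k] F) :
    E →ₗ[k] F :=
  letI := Fintype.ofFinite G
  (Nat.card G : k)⁻¹ • ∑ h : G, τ h ∘ₗ f ∘ₗ σ h⁻¹

theorem repAverage_apply [Fintype G] (σ : G →* Module.End k E) (τ : G →* Module.End k F)
    (f : E →ₗ[k] F) (x : E) :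
    repAverage σ τ f x = (Nat.card G : k)⁻¹ • ∑ h : G, τ h (f (σ h⁻¹ x)) := by
  rw [repAverage, Subsingleton.elim (Fintype.ofFinite G) ‹_›]
  simp [LinearMap.sum_apply]

theorem repAverage_equivariant (σ : G →* Module.End k E) (τ : G →* Module.End k F)
    (f : E →ₗ[k] F) (h : G) (x : E) :
    repAverage σ τ f (σ h x) = τ h (repAverage σ τ f x) := by
  have := Fintype.ofFinite G
  rw [repAverage_apply, repAverage_apply, map_smul, map_sum]
  congr 1
  refine Fintype.sum_equiv (Equiv.mulLeft h⁻¹) _ _ fun m => ?_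
  rw [Equiv.coe_mulLeft, ← Module.End.mul_apply (τ h), ← map_mul, ← Module.End.mul_apply (σ m⁻¹),
    ← map_mul, mul_inv_cancel_left, mul_inv_rev, inv_inv]

theorem repAverage_const [CharZero k] [Fintype G] (v : F) :
    (Nat.card G : k)⁻¹ • ∑ _h : G, v = v := by
  rw [Finset.sum_const, Finset.card_univ, ← Nat.card_eq_fintype_card, ← Nat.cast_smul_eq_nsmul k,
    smul_smul, inv_mul_cancel₀ (Nat.cast_ne_zero.mpr Nat.card_pos.ne'), one_smul]

/-- Maschke's argument: averaging a linear section keeps it a section, because `p` is equivariant.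
-/
theorem exists_equivariant_section [CharZero k] (σ : G →* Module.End k E) (τ : G →* Module.End k F)
    (p : E →ₗ[k] F) (hp : ∀ h x, p (σ h x) = τ h (p x)) (hs : Function.Surjective p) :
    ∃ s : F →ₗ[k] E, (∀ h x, s (τ h x) = σ h (s x)) ∧ ∀ x, p (s x) = x := by
  have := Fintype.ofFinite G
  obtain ⟨s, hs⟩ := p.exists_rightInverse_of_surjective (LinearMap.range_eq_top.mpr hs)
  refine ⟨repAverage τ σ s, repAverage_equivariant τ σ s, fun x => ?_⟩
  rw [repAverage_apply, map_smul, map_sum]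
  refine Eq.trans ?_ (repAverage_const (k := k) (G := G) x)
  congr 1
  refine Finset.sum_congr rfl fun h _ => ?_
  rw [hp, ← LinearMap.comp_apply p s, hs, LinearMap.id_apply, ← Module.End.mul_apply, ← map_mul,
    mul_inv_cancel, map_one, Module.End.one_apply]

theorem exists_equivariant_retraction [CharZero k] (σ : G →* Module.End k E)
    (τ : G →* Module.End k F) (i : E →ₗ[k] F) (hi : ∀ h x, i (σ h x) = τ h (i x))
    (hs : Function.Injective i) :
    ∃ f : F →ₗ[k] E, (∀ h x, f (τ h x) = σ h (f x)) ∧ ∀ x, f (i x) = x := by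
  have := Fintype.ofFinite G
  obtain ⟨f, hf⟩ := i.exists_leftInverse_of_injective (LinearMap.ker_eq_bot.mpr hs)
  refine ⟨repAverage τ σ f, repAverage_equivariant τ σ f, fun x => ?_⟩
  rw [repAverage_apply]
  refine Eq.trans ?_ (repAverage_const (k := k) (G := G) x)
  congr 1
  refine Finset.sum_congr rfl fun h _ => ?_
  rw [← hi, ← LinearMap.comp_apply f i, hf, LinearMap.id_apply, ← Module.End.mul_apply, ← map_mul,
    mul_inv_cancel, map_one, Module.End.one_apply]

end Averaging

/-! ### Modules over the Hopf algebra of a group datum -/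

namespace GroupDatum

open FDModule MonoidAlgebra

variable {k : Type u} [Field k] {G : Type v} [Group G] [Finite G] (D : GroupDatum k G)

/-- The group homomorphism from `G` to the units of `H_D`, as a monoid homomorphism. -/
noncomputable def grpHom : G →* D.Alg where
  toFun := D.grp
  map_one' := D.grp_one
  map_mul' := D.grp_mul

section Unbundled

variable {E F : Type*} [AddCommGroup E] [Module k E] [Module D.Alg E] [IsScalarTower k D.Alg E]
  [AddCommGroup F] [Module k F] [Module D.Alg F] [IsScalarTower k D.Alg F]

/-- The action of `G` on an `H_D`-module. -/
noncomputable def grpEnd (E : Type*) [AddCommGroup E] [Module k E] [Module D.Alg E]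
    [IsScalarTower k D.Alg E] : G →* Module.End k E :=
  ((Algebra.lsmul k k E : D.Alg →ₐ[k] Module.End k E) : D.Alg →* Module.End k E).comp D.grpHom

theorem grpEnd_apply (h : G) (x : E) : D.grpEnd E h x = D.grp h • x := rfl

/-- A `k`-linear map which commutes with `y` and with the elements of `G` is `H_D`-linear. -/
def mkHom (f : E →ₗ[k] F) (hy : ∀ x, f (D.y • x) = D.y • f x)
    (hg : ∀ h x, f (D.grp h • x) = D.grp h • f x) : E →ₗ[D.Alg] F where
  toFun := f
  map_add' := f.map_add
  map_smul' a x := by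
    rw [RingHom.id_apply]
    induction a using D.alg_induction generalizing x with
    | hc c => rw [algebraMap_smul, algebraMap_smul, map_smul]
    | hy => exact hy x
    | hg h => exact hg h x
    | hadd a b ha hb => rw [add_smul, add_smul, map_add, ha, hb]
    | hmul a b ha hb => rw [mul_smul, mul_smul, ha, hb]

@[simp] theorem mkHom_apply (f : E →ₗ[k] F) (hy : ∀ x, f (D.y • x) = D.y • f x)
    (hg : ∀ h x, f (D.grp h • x) = D.grp h • f x) (x : E) : D.mkHom f hy hg x = f x := rfl

theorem smul_y_grp (h : G) (x : E) : D.y • D.grp h • x = (D.χ h : k) • D.grp h • D.y • x := by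
  rw [← mul_smul, y_mul_grp, smul_assoc, mul_smul]

theorem pow_smul_y_grp (h : G) (l : ℕ) (x : E) :
    D.y ^ l • D.grp h • x = (D.χ h : k) ^ l • D.grp h • D.y ^ l • x := by
  induction l generalizing x with
  | zero => simp
  | succ l ih =>
    rw [pow_succ, mul_smul, smul_y_grp, ← algebraMap_smul D.Alg (D.χ h : k), ← mul_smul,
      ← Algebra.commutes, mul_smul, ih, algebraMap_smul, smul_smul, ← pow_succ', mul_smul]

theorem grp_smul_pow_y (h : G) (l : ℕ) (x : E) :
    D.grp h • D.y ^ l • x = (((D.χ h)⁻¹ : kˣ) : k) ^ l • D.y ^ l • D.grp h • x := by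
  rw [pow_smul_y_grp, smul_smul (M := k), ← mul_pow, ← Units.val_mul, inv_mul_cancel, Units.val_one,
    one_pow, one_smul]

theorem pow_n_smul (x : E) : D.y ^ D.n • x = D.μ • (D.grp (D.g ^ D.n) • x - x) := by
  rw [y_pow, smul_assoc, sub_smul, one_smul]

theorem smul_smul_comm' (a : D.Alg) (c : k) (x : E) : a • c • x = c • a • x := smul_comm a c x

end Unbundled

/-- The restriction of an `H_D`-module to `G`. -/
noncomputable def res (X : FDModule k D.Alg) : FDModule k (MonoidAlgebra k G) where
  carrier := X
  ρ := MonoidAlgebra.lift k _ G (D.grpEnd X)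

/-- The identity map from the restriction of a module to the module. -/
noncomputable def resEquiv (X : FDModule k D.Alg) : D.res X ≃ₗ[k] X :=
  LinearEquiv.refl k X

theorem resEquiv_ρ (X : FDModule k D.Alg) (h : G) (x : D.res X) :
    D.resEquiv X ((D.res X).ρ (of k G h) x) = D.grp h • D.resEquiv X x :=
  LinearMap.congr_fun (MonoidAlgebra.lift_of (R := k) (D.grpEnd X) h) x

theorem resEquiv_symm_grp (X : FDModule k D.Alg) (h : G) (x : X) :
    (D.resEquiv X).symm (D.grp h • x) = (D.res X).ρ (of k G h) ((D.resEquiv X).symm x) := by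
  rw [LinearEquiv.symm_apply_eq, resEquiv_ρ, LinearEquiv.apply_symm_apply]

/-- The module of a representation of `G`. -/
noncomputable def ofRep {W : Type u} [AddCommGroup W] [Module k W] [Module.Finite k W]
    (σ : G →* Module.End k W) : FDModule k (MonoidAlgebra k G) where
  carrier := W
  ρ := MonoidAlgebra.lift k _ G σ

theorem ofRep_ρ {W : Type u} [AddCommGroup W] [Module k W] [Module.Finite k W]
    (σ : G →* Module.End k W) (h : G) : (ofRep σ).ρ (of k G h) = σ h :=
  MonoidAlgebra.lift_of σ h

/-! ### Induced modules -/

/-- The action of `y` on the induced module `W ⊕ x W ⊕ ⋯ ⊕ x^{n-1} W`. -/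
noncomputable def yInd (W : FDModule k (MonoidAlgebra k G)) : Module.End k (Fin D.n → W) :=
  LinearMap.pi fun l =>
    if (l : ℕ) = 0 then (D.μ • (W.ρ (of k G (D.g ^ D.n)) - 1)) ∘ₗ
      LinearMap.proj (⟨D.n - 1, by have := D.n_pos; omega⟩ : Fin D.n)
    else LinearMap.proj (⟨(l : ℕ) - 1, by omega⟩ : Fin D.n)

theorem yInd_apply (W : FDModule k (MonoidAlgebra k G)) (v : Fin D.n → W) (l : Fin D.n) :
    D.yInd W v l = if (l : ℕ) = 0 then D.μ • (W.ρ (of k G (D.g ^ D.n))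
      (v ⟨D.n - 1, by have := D.n_pos; omega⟩) - v ⟨D.n - 1, by have := D.n_pos; omega⟩)
      else v ⟨(l : ℕ) - 1, by omega⟩ := by
  simp only [yInd, LinearMap.pi_apply]
  split_ifs <;> rfl

/-- Multiplication by `y ^ m` shifts `x^l W` to `x^(l+m) W`; passing `x^n` costs the factor `μ (g ^
n - 1)`. The bound `m ≤ n` ensures at most one such passage, the source index then being `l + n -
m`. -/
theorem yInd_pow_apply (W : FDModule k (MonoidAlgebra k G)) (m : ℕ) (hm : m ≤ D.n)
    (v : Fin D.n → W) (l : Fin D.n) :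
    (D.yInd W ^ m) v l = if h : (l : ℕ) < m then
      D.μ • (W.ρ (of k G (D.g ^ D.n)) (v ⟨l + D.n - m, by omega⟩) - v ⟨l + D.n - m, by omega⟩)
      else v ⟨(l : ℕ) - m, by omega⟩ := by
  induction m generalizing l with
  | zero => simp
  | succ m ih =>
    have hn := D.n_pos
    rw [pow_succ', Module.End.mul_apply, yInd_apply]
    by_cases h0 : (l : ℕ) = 0
    · have e : (⟨(l : ℕ) + D.n - (m + 1), by omega⟩ : Fin D.n) =
          ⟨(D.n - 1) - m, by omega⟩ := Fin.ext (by simp only; omega)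
      rw [if_pos h0, ih (by omega), dif_neg (by simp only; omega), dif_pos (by omega), e]
    · rw [if_neg h0, ih (by omega)]
      by_cases h1 : (l : ℕ) < m + 1
      · have e : (⟨(l : ℕ) + D.n - (m + 1), by omega⟩ : Fin D.n) =
          ⟨((l : ℕ) - 1) + D.n - m, by omega⟩ := Fin.ext (by simp only; omega)
        rw [dif_pos h1, dif_pos (by simp only; omega), e]
      · rw [dif_neg h1, dif_neg (by simp only; omega)]
        congr 1
        exact Fin.ext (by simp only; omega)

theorem yInd_pow_n (W : FDModule k (MonoidAlgebra k G)) :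
    D.yInd W ^ D.n = D.μ • (D.grpAct D.n W (D.g ^ D.n) - 1) := by
  have h1 : D.χ (D.g ^ D.n) = 1 := by rw [map_pow]; exact pow_orderOf_eq_one _
  refine LinearMap.ext fun v => funext fun l => ?_
  rw [D.yInd_pow_apply W D.n le_rfl, dif_pos l.2, LinearMap.smul_apply, LinearMap.sub_apply,
    Pi.smul_apply, Pi.sub_apply, grpAct_apply, h1]
  simp

theorem chi_pow_n (hχ : D.χ ^ D.n = 1) (h : G) : (D.χ h : k) ^ D.n = 1 := by
  rw [← Units.val_pow_eq_pow_val, ← MonoidHom.pow_apply, hχ, MonoidHom.one_apply, Units.val_one]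

/-- Only the wrap-around from `x^(n-1) W` to `W` needs care: there `χ(h)⁻¹` to the power `n - 1`
must equal `χ(h)`, which is where `χ ^ n = 1` enters. -/
theorem yInd_comm (hχ : D.χ ^ D.n = 1) (W : FDModule k (MonoidAlgebra k G)) (h : G) :
    D.yInd W * D.grpAct D.n W h = (D.χ h : k) • (D.grpAct D.n W h * D.yInd W) := by
  have hn := D.n_pos
  have hz : W.ρ (of k G (D.g ^ D.n)) * W.ρ (of k G h) =
      W.ρ (of k G h) * W.ρ (of k G (D.g ^ D.n)) := by
    rw [← _root_.map_mul, ← _root_.map_mul, ← _root_.map_mul, ← _root_.map_mul,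
      Subgroup.mem_center_iff.mp (pow_mem D.g_mem_center D.n) h]
  have hc : (((D.χ h)⁻¹ : kˣ) : k) ^ (D.n - 1) = D.χ h := by
    have h2 := D.chi_pow_n hχ h
    have h3 : ((D.χ h : k)) ^ D.n = (D.χ h : k) ^ (D.n - 1) * D.χ h := by
      rw [← pow_succ, Nat.sub_add_cancel hn]
    rw [Units.val_inv_eq_inv_val, inv_pow]
    exact inv_eq_of_mul_eq_one_right (h3.symm.trans h2)
  refine LinearMap.ext fun v => funext fun l => ?_
  rw [LinearMap.smul_apply, Pi.smul_apply, Module.End.mul_apply, Module.End.mul_apply, yInd_apply,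
    grpAct_apply, grpAct_apply, grpAct_apply, yInd_apply]
  split_ifs with h0
  · simp only [hc, h0, pow_zero, one_smul, map_smul, map_sub]
    rw [← Module.End.mul_apply, hz, Module.End.mul_apply]
    simp only [← smul_sub, smul_smul]
    rw [mul_comm]
  · obtain ⟨m, hm⟩ := Nat.exists_eq_succ_of_ne_zero h0
    rw [smul_smul]
    congr 1
    simp [hm, pow_succ']

/-- The `H_D`-module `W ⊕ x W ⊕ ⋯ ⊕ x^{n-1} W` induced by the `k[G]`-module `W`. -/
noncomputable def ind (hχ : D.χ ^ D.n = 1) (W : FDModule k (MonoidAlgebra k G)) :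
    FDModule k D.Alg where
  carrier := Fin D.n → W
  ρ := D.lift (D.yInd W) (D.grpAct D.n W) (D.yInd_pow_n W) (D.yInd_comm hχ W)

variable (hχ : D.χ ^ D.n = 1) (W : FDModule k (MonoidAlgebra k G))

/-- The identity map, with the underlying space of the induced module as its source. -/
noncomputable def indEquiv : D.ind hχ W ≃ₗ[k] (Fin D.n → W) :=
  LinearEquiv.refl k (Fin D.n → W)

theorem indEquiv_y (v : D.ind hχ W) :
    D.indEquiv hχ W (D.y • v) = D.yInd W (D.indEquiv hχ W v) :=
  LinearMap.congr_fun (D.lift_y _ _ (D.yInd_pow_n W) (D.yInd_comm hχ W)) v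

theorem indEquiv_y_pow (m : ℕ) (v : D.ind hχ W) :
    D.indEquiv hχ W (D.y ^ m • v) = (D.yInd W ^ m) (D.indEquiv hχ W v) := by
  induction m with
  | zero => simp
  | succ m ih => rw [pow_succ', mul_smul, indEquiv_y, ih, pow_succ', Module.End.mul_apply]

theorem indEquiv_grp (h : G) (v : D.ind hχ W) :
    D.indEquiv hχ W (D.grp h • v) = D.grpAct D.n W h (D.indEquiv hχ W v) :=
  LinearMap.congr_fun (D.lift_grp _ _ (D.yInd_pow_n W) (D.yInd_comm hχ W) h) v

section IndHom

variable {E : Type*} [AddCommGroup E] [Module k E] [Module D.Alg E] [IsScalarTower k D.Alg E]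

/-- The `k`-linear map `∑ x^l v_l ↦ ∑ y^l f(v_l)`. -/
noncomputable def sumPow (j : ℕ) {W : Type*} [AddCommGroup W] [Module k W] (f : W →ₗ[k] E) :
    (Fin j → W) →ₗ[k] E :=
  ∑ l : Fin j, Algebra.lsmul k k E (D.y ^ (l : ℕ)) ∘ₗ f ∘ₗ LinearMap.proj l

theorem sumPow_apply (j : ℕ) {W : Type*} [AddCommGroup W] [Module k W] (f : W →ₗ[k] E)
    (v : Fin j → W) : D.sumPow j f v = ∑ l : Fin j, D.y ^ (l : ℕ) • f (v l) := by
  rw [sumPow, LinearMap.sum_apply]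
  rfl

theorem sumPow_grp (j : ℕ) (f : W →ₗ[k] E)
    (hf : ∀ h w, f (W.ρ (of k G h) w) = D.grp h • f w) (h : G) (v : Fin j → W) :
    D.sumPow j f (D.grpAct j W h v) = D.grp h • D.sumPow j f v := by
  rw [sumPow_apply, sumPow_apply, Finset.smul_sum]
  refine Finset.sum_congr rfl fun l _ => ?_
  rw [grpAct_apply, map_smul, hf, grp_smul_pow_y, smul_smul_comm']

theorem sumPow_yInd (f : W →ₗ[k] E)
    (hf : ∀ h w, f (W.ρ (of k G h) w) = D.grp h • f w) (v : Fin D.n → W) :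
    D.sumPow D.n f (D.yInd W v) = D.y • D.sumPow D.n f v := by
  rw [sumPow_apply, sumPow_apply, Finset.smul_sum]
  have hn := D.n_pos
  -- Extending the summands by zero to all of `ℕ` turns the claim into a cyclic shift of a sum over
  -- `Finset.range n`; the term `l = 0` receives `y • F (n - 1)`, since `y ^ n` acts as `μ (g ^ n -
  -- 1)`.
  let F : ℕ → E := fun l => if h : l < D.n then D.y ^ l • f (v ⟨l, h⟩) else 0
  have h1 : ∀ l : Fin D.n, D.y • D.y ^ (l : ℕ) • f (v l) = D.y • F l := by
    intro l
    simp [F]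
  have h2 : ∀ l : Fin D.n, D.y ^ (l : ℕ) • f (D.yInd W v l) =
      if (l : ℕ) = 0 then D.y • F (D.n - 1) else D.y • F (l - 1) := by
    intro l
    rw [yInd_apply]
    split_ifs with h0
    · rw [h0, pow_zero, one_smul, map_smul, map_sub, hf, ← pow_n_smul]
      simp only [F, dif_pos (Nat.sub_lt hn one_pos)]
      rw [← mul_smul, ← pow_succ', Nat.sub_add_cancel hn]
    · have h3 : (l : ℕ) - 1 < D.n := by omega
      simp only [F, dif_pos h3]
      rw [← mul_smul, ← pow_succ', Nat.sub_add_cancel (by omega)]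
  rw [Finset.sum_congr rfl fun l _ => h1 l, Finset.sum_congr rfl fun l _ => h2 l,
    Fin.sum_univ_eq_sum_range (fun l => if l = 0 then D.y • F (D.n - 1) else D.y • F (l - 1)),
    Fin.sum_univ_eq_sum_range (fun l => D.y • F l)]
  obtain ⟨m, hm⟩ := Nat.exists_eq_succ_of_ne_zero hn.ne'
  rw [hm, Finset.sum_range_succ', Finset.sum_range_succ]
  simp

/-- The homomorphism from the induced module given by a `G`-equivariant map. -/
noncomputable def indHom (f : W →ₗ[k] E) (hf : ∀ h w, f (W.ρ (of k G h) w) = D.grp h • f w) :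
    D.ind hχ W →ₗ[D.Alg] E :=
  D.mkHom (D.sumPow D.n f ∘ₗ (D.indEquiv hχ W).toLinearMap)
    (fun v => by simp only [LinearMap.comp_apply, LinearEquiv.coe_coe, indEquiv_y,
      D.sumPow_yInd W f hf])
    (fun h v => by simp only [LinearMap.comp_apply, LinearEquiv.coe_coe, indEquiv_grp,
      D.sumPow_grp W D.n f hf])

theorem indHom_apply (f : W →ₗ[k] E) (hf : ∀ h w, f (W.ρ (of k G h) w) = D.grp h • f w)
    (v : D.ind hχ W) :
    D.indHom hχ W f hf v = ∑ l : Fin D.n, D.y ^ (l : ℕ) • f (D.indEquiv hχ W v l) :=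
  D.sumPow_apply D.n f _

end IndHom

/-- The inclusion of the summand `x^l W` into the induced module. -/
noncomputable def indSingle (l : Fin D.n) : W →ₗ[k] D.ind hχ W :=
  (D.indEquiv hχ W).symm.toLinearMap ∘ₗ LinearMap.single k (fun _ : Fin D.n => W) l

theorem indEquiv_indSingle (l m : Fin D.n) (w : W) :
    D.indEquiv hχ W (D.indSingle hχ W l w) m = if m = l then w else 0 := by
  rw [indSingle, LinearMap.comp_apply, LinearEquiv.coe_coe, LinearEquiv.apply_symm_apply,
    LinearMap.single_apply, Pi.single_apply]

theorem grp_indSingle (l : Fin D.n) (h : G) (w : W) : D.grp h • D.indSingle hχ W l w =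
    D.indSingle hχ W l ((((D.χ h)⁻¹ : kˣ) : k) ^ (l : ℕ) • W.ρ (of k G h) w) := by
  refine (D.indEquiv hχ W).injective (funext fun m => ?_)
  rw [indEquiv_grp, grpAct_apply, indEquiv_indSingle, indEquiv_indSingle]
  split_ifs with h
  · rw [h]
  · simp

theorem y_indSingle (l m : Fin D.n) (h : (m : ℕ) = l + 1) (w : W) :
    D.y • D.indSingle hχ W l w = D.indSingle hχ W m w := by
  refine (D.indEquiv hχ W).injective (funext fun i => ?_)
  simp only [indEquiv_y, yInd_apply, indEquiv_indSingle, Fin.ext_iff]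
  split_ifs <;> first | omega | simp

theorem pow_y_indSingle (l : Fin D.n) (w : W) :
    D.y ^ (l : ℕ) • D.indSingle hχ W ⟨0, D.n_pos⟩ w = D.indSingle hχ W l w := by
  obtain ⟨l, hl⟩ := l
  induction l with
  | zero => simp
  | succ l ih =>
    rw [pow_succ', mul_smul]
    rw [show D.y ^ l • D.indSingle hχ W ⟨0, D.n_pos⟩ w = _ from ih (by omega)]
    exact D.y_indSingle hχ W _ _ rfl w

theorem sum_indSingle (v : D.ind hχ W) :
    ∑ l, D.indSingle hχ W l (D.indEquiv hχ W v l) = v := by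
  refine (D.indEquiv hχ W).injective (funext fun m => ?_)
  rw [map_sum, Finset.sum_apply]
  simp only [indEquiv_indSingle]
  simp

/-! ### Projectivity of induced modules and two criteria for projectivity. -/

variable [CharZero k]

/-- Homomorphisms out of the induced module are equivariant maps out of `W`, and equivariant maps
lift along epimorphisms by averaging over `G`. -/
theorem ind_isProjective : (D.ind hχ W).IsProjective := by
  refine Module.Projective.of_lifting_property'' fun p hp => ?_
  -- It suffices to split epimorphisms from this free module.
  let E := (D.ind hχ W).carrier →₀ D.Alg
  obtain ⟨s, hs, hps⟩ := exists_equivariant_section (D.grpEnd E) (D.grpEnd (D.ind hχ W))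
    (p.restrictScalars k) (fun h x => p.map_smul (D.grp h) x) hp
  let ι := D.indSingle hχ W ⟨0, D.n_pos⟩
  have hι : ∀ h w, ι (W.ρ (of k G h) w) = D.grp h • ι w := fun h w => by
    rw [grp_indSingle]
    simp [ι]
  refine ⟨D.indHom hχ W (s ∘ₗ ι) (fun h w => ?_), LinearMap.ext fun v => ?_⟩
  · rw [LinearMap.comp_apply, hι]
    exact hs h (ι w)
  · rw [LinearMap.comp_apply, indHom_apply, map_sum, LinearMap.id_apply]
    refine Eq.trans (Finset.sum_congr rfl fun l _ => ?_) (D.sum_indSingle hχ W v)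
    rw [map_smul, ← pow_y_indSingle]
    exact congrArg _ (hps _)

/-- The canonical epimorphism from the module induced by `X` to `X`. -/
noncomputable def indCounit (X : FDModule k D.Alg) : D.ind hχ (D.res X) →ₗ[D.Alg] X :=
  D.indHom hχ (D.res X) (D.resEquiv X).toLinearMap fun h x => D.resEquiv_ρ X h x

theorem indCounit_apply (X : FDModule k D.Alg) (v : D.ind hχ (D.res X)) :
    D.indCounit hχ X v =
      ∑ l : Fin D.n, D.y ^ (l : ℕ) • D.resEquiv X (D.indEquiv hχ (D.res X) v l) :=
  D.indHom_apply hχ _ _ _ v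

theorem indCounit_surjective (X : FDModule k D.Alg) : Function.Surjective (D.indCounit hχ X) := by
  intro x
  refine ⟨D.indSingle hχ (D.res X) ⟨0, D.n_pos⟩ ((D.resEquiv X).symm x), ?_⟩
  rw [indCounit_apply, Finset.sum_eq_single ⟨0, D.n_pos⟩]
  · rw [indEquiv_indSingle, if_pos rfl, pow_zero, one_smul, LinearEquiv.apply_symm_apply]
  · intro l _ hl
    rw [indEquiv_indSingle, if_neg hl, map_zero, smul_zero]
  · simp

/-- A projective module is thus a summand of the module induced from its own restriction; statements
about projectives reduce to induced modules in this way. -/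
theorem exists_section_indCounit {X : FDModule k D.Alg} (hX : X.IsProjective) :
    ∃ s : X →ₗ[D.Alg] D.ind hχ (D.res X), D.indCounit hχ X ∘ₗ s = LinearMap.id :=
  have : Module.Projective D.Alg X := hX
  Module.projective_lifting_property _ _ (D.indCounit_surjective hχ X)

/-- A section `s` of the canonical epimorphism would satisfy `y ^ (n-1) • s x = 0`, so the `x^0`
coordinate of `s x` vanishes and `x` lies in `y X`. Then `X = y X = ⋯ = y ^ (n-1) X = 0`. -/
theorem not_isProjective_of_pow_smul_eq_zero (hχ : D.χ ^ D.n = 1) (X : FDModule k D.Alg) [Nontrivial X]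
    (hX : ∀ x : X, D.y ^ (D.n - 1) • x = 0) : ¬ X.IsProjective := by
  intro hP
  obtain ⟨s, hs⟩ := D.exists_section_indCounit hχ hP
  have hn := D.n_pos
  have h0 : ∀ x : X, D.indEquiv hχ _ (s x) ⟨0, hn⟩ = 0 := by
    intro x
    have h1 : D.y ^ (D.n - 1) • s x = 0 := by rw [← map_smul, hX, map_zero]
    -- The coordinate of `y ^ (n-1) • s x` at `x^(n-1)` is the coordinate of `s x` at `x^0`.
    have h2 := congrFun (congrArg (D.indEquiv hχ _) h1) ⟨D.n - 1, by omega⟩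
    rw [indEquiv_y_pow, yInd_pow_apply _ _ _ (by omega), dif_neg (by simp), map_zero,
      Pi.zero_apply] at h2
    exact (congrArg (D.indEquiv hχ _ (s x)) (Fin.ext (Nat.sub_self _).symm)).trans h2
  have h1 : ∀ x : X, ∃ x' : X, x = D.y • x' := by
    intro x
    have h2 : D.indCounit hχ X (s x) = x := LinearMap.congr_fun hs x
    rw [indCounit_apply] at h2
    -- The truncated exponent `l - 1` is harmless at `l = 0`, where the coordinate has just been
    -- shown to vanish.
    refine ⟨∑ l : Fin D.n, D.y ^ ((l : ℕ) - 1) • D.resEquiv X (D.indEquiv hχ _ (s x) l), ?_⟩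
    rw [Finset.smul_sum]
    refine h2.symm.trans (Finset.sum_congr rfl fun l _ => ?_)
    by_cases hl : (l : ℕ) = 0
    · have : l = ⟨0, hn⟩ := Fin.ext hl
      rw [this, h0, map_zero, smul_zero, smul_zero, smul_zero]
    · rw [← mul_smul, ← pow_succ', Nat.sub_add_cancel (by omega)]
  have h2 : ∀ (m : ℕ) (x : X), ∃ x' : X, x = D.y ^ m • x' := by
    intro m
    induction m with
    | zero => exact fun x => ⟨x, by simp⟩
    | succ m ih =>
      intro x
      obtain ⟨x', rfl⟩ := ih x
      obtain ⟨x'', rfl⟩ := h1 x'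
      exact ⟨x'', by rw [pow_succ, mul_smul]⟩
  obtain ⟨x, hx⟩ := exists_ne (0 : X)
  obtain ⟨x', rfl⟩ := h2 (D.n - 1) x
  exact hx (hX x')

/-- With `y ^ n` invertible, `x ↦ n⁻¹ ∑ x^l (y ^ (n-l) y ^ (-n) x)` is an `H`-linear section of the
canonical epimorphism: each of the `n` terms maps to `n⁻¹ x`. -/
theorem isProjective_of_bijective (hχ : D.χ ^ D.n = 1) (X : FDModule k D.Alg)
    (hX : Function.Bijective fun x : X => D.y ^ D.n • x) : X.IsProjective := by
  let e : X ≃ₗ[k] X := LinearEquiv.ofBijective (Algebra.lsmul k k X (D.y ^ D.n)) hX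
  have he : ∀ x : X, e x = D.y ^ D.n • x := fun _ => rfl
  have hey : ∀ x : X, e.symm (D.y • x) = D.y • e.symm x := fun x => by
    rw [LinearEquiv.symm_apply_eq, he, ← mul_smul, ← pow_succ, pow_succ', mul_smul, ← he,
      e.apply_symm_apply]
  have heg : ∀ (h : G) (x : X), e.symm (D.grp h • x) = D.grp h • e.symm x := fun h x => by
    rw [LinearEquiv.symm_apply_eq, he, pow_smul_y_grp, D.chi_pow_n hχ, one_smul, ← he,
      e.apply_symm_apply]
  have hn := D.n_pos
  -- Here `e.symm` is the action of `y ^ (-n)`, and the factor `n⁻¹` needs characteristic zero.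
  let s' : X →ₗ[k] (Fin D.n → D.res X) := LinearMap.pi fun l : Fin D.n =>
    (D.n : k)⁻¹ • ((D.resEquiv X).symm.toLinearMap ∘ₗ
      Algebra.lsmul k k X (D.y ^ (D.n - l)) ∘ₗ e.symm.toLinearMap)
  let s : X →ₗ[k] D.ind hχ (D.res X) := (D.indEquiv hχ _).symm.toLinearMap ∘ₗ s'
  have hs : ∀ (x : X) (l : Fin D.n), D.indEquiv hχ _ (s x) l =
      (D.resEquiv X).symm ((D.n : k)⁻¹ • D.y ^ (D.n - l) • e.symm x) := fun x l => by
    rw [map_smul]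
    exact congrFun ((D.indEquiv hχ _).apply_symm_apply (s' x)) l
  refine isProjective_of_retract (D.mkHom s (fun x => ?_) fun h x => ?_) (D.indCounit hχ X) ?_
    (D.ind_isProjective hχ (D.res X))
  · refine (D.indEquiv hχ _).injective (funext fun l => ?_)
    rw [indEquiv_y, yInd_apply]
    split_ifs with h0
    · rw [hs, hs, hey, ← resEquiv_symm_grp, ← map_sub, ← (D.resEquiv X).symm.map_smul, ← pow_n_smul, h0,
        Nat.sub_sub_self hn, pow_one, Nat.sub_zero, smul_smul_comm']
    · rw [hs, hs, hey, ← mul_smul, ← pow_succ]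
      congr 4
      simp only
      omega
  · refine (D.indEquiv hχ _).injective (funext fun l => ?_)
    rw [indEquiv_grp, grpAct_apply, hs, hs, ← resEquiv_symm_grp, ← (D.resEquiv X).symm.map_smul, heg, pow_smul_y_grp,
      smul_smul_comm', smul_smul (M := k), smul_smul (M := k)]
    congr 2
    -- The `l`-th layer carries the character `χ ^ (-l)` while `y ^ (n-l)` produces `χ ^ (n-l)`;
    -- these agree because `χ ^ n = 1`.
    have h2 := D.chi_pow_n hχ h
    have h3 : (D.χ h : k) ^ D.n = (D.χ h : k) ^ (D.n - (l : ℕ)) * (D.χ h : k) ^ (l : ℕ) := by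
      rw [← pow_add, Nat.sub_add_cancel l.2.le]
    rw [Units.val_inv_eq_inv_val, inv_pow, mul_comm]
    congr 1
    exact eq_inv_of_mul_eq_one_left (h3.symm.trans h2)
  · refine LinearMap.ext fun x => ?_
    rw [LinearMap.comp_apply, indCounit_apply, LinearMap.id_apply]
    refine Eq.trans (Finset.sum_congr rfl fun l _ => ?_)
      (b := ∑ _l : Fin D.n, (D.n : k)⁻¹ • x) ?_
    · rw [mkHom_apply, hs, LinearEquiv.apply_symm_apply, smul_smul_comm', ← mul_smul, ← pow_add,
        Nat.add_sub_cancel' l.2.le, ← he, e.apply_symm_apply]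
    · rw [Finset.sum_const, Finset.card_univ, Fintype.card_fin, ← Nat.cast_smul_eq_nsmul k,
        smul_smul, mul_inv_cancel₀ (Nat.cast_ne_zero.mpr hn.ne'), one_smul]

end GroupDatum

/-! ### Tensor products -/

namespace FDModule

variable {k : Type u} [Field k] {A : Type v} [Ring A] [Bialgebra k A]

/-- The identity map, with the underlying space of the tensor product as its source. -/
noncomputable def tensorEquiv (X Z : FDModule k A) : tensor X Z ≃ₗ[k] X ⊗[k] Z :=
  LinearEquiv.refl k (X ⊗[k] Z)

/-- The element `x ⊗ z` of the tensor product of modules. -/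
noncomputable def tmul (X Z : FDModule k A) : X →ₗ[k] Z →ₗ[k] tensor X Z :=
  (TensorProduct.mk k X Z).compr₂ (tensorEquiv X Z).symm.toLinearMap

theorem tensorEquiv_tmul (X Z : FDModule k A) (x : X) (z : Z) :
    tensorEquiv X Z (tmul X Z x z) = x ⊗ₜ z := rfl

/-- The linear map on the tensor product given by a bilinear map. -/
noncomputable def tensorLift {X Z : FDModule k A} {E : Type*} [AddCommGroup E] [Module k E]
    (f : X →ₗ[k] Z →ₗ[k] E) : tensor X Z →ₗ[k] E :=
  TensorProduct.lift f ∘ₗ (tensorEquiv X Z).toLinearMap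

@[simp] theorem tensorLift_tmul {X Z : FDModule k A} {E : Type*} [AddCommGroup E] [Module k E]
    (f : X →ₗ[k] Z →ₗ[k] E) (x : X) (z : Z) : tensorLift f (tmul X Z x z) = f x z :=
  TensorProduct.lift.tmul x z

theorem tensor_induction {X Z : FDModule k A} {P : tensor X Z → Prop}
    (htmul : ∀ x z, P (tmul X Z x z)) (hadd : ∀ s t, P s → P t → P (s + t)) (t : tensor X Z) :
    P t := by
  induction t using TensorProduct.induction_on with
  | zero => exact (congrArg P (map_zero (tmul X Z 0))).mp (htmul 0 0)
  | tmul x z => exact htmul x z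
  | add s t hs ht => exact hadd s t hs ht

theorem finrank_tensor (X Z : FDModule k A) :
    Module.finrank k (tensor X Z) = Module.finrank k X * Module.finrank k Z :=
  (tensorEquiv X Z).finrank_eq.trans (Module.finrank_tensorProduct)

end FDModule

namespace GroupDatum

open FDModule MonoidAlgebra

variable {k : Type u} [Field k] {G : Type v} [Group G] [Finite G] (D : GroupDatum k G)

theorem y_tmul (X Z : FDModule k D.Alg) (x : X) (z : Z) : D.y • tmul X Z x z =
    tmul X Z (D.y • x) (D.grp D.g • z) + tmul X Z x (D.y • z) := by
  refine (tensorEquiv X Z).injective ?_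
  rw [map_add, tensorEquiv_tmul, tensorEquiv_tmul]
  have h : Bialgebra.comulAlgHom k D.Alg D.y = D.y ⊗ₜ D.grp D.g + 1 ⊗ₜ D.y := D.comulHom_y
  change tensorAct X.ρ Z.ρ (Bialgebra.comulAlgHom k D.Alg D.y) (x ⊗ₜ[k] z) = _
  rw [h, map_add, LinearMap.add_apply, tensorAct_tmul, tensorAct_tmul, map_one,
    Module.End.one_apply]
  rfl

theorem grp_tmul (X Z : FDModule k D.Alg) (h : G) (x : X) (z : Z) : D.grp h • tmul X Z x z =
    tmul X Z (D.grp h • x) (D.grp h • z) := by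
  refine (tensorEquiv X Z).injective ?_
  rw [tensorEquiv_tmul]
  have h' : Bialgebra.comulAlgHom k D.Alg (D.grp h) = D.grp h ⊗ₜ D.grp h := D.comulHom_grp h
  change tensorAct X.ρ Z.ρ (Bialgebra.comulAlgHom k D.Alg (D.grp h)) (x ⊗ₜ[k] z) = _
  rw [h', tensorAct_tmul]
  rfl

/-- A linear map out of a tensor product which commutes with `y` and `G` on pure tensors. -/
noncomputable def tensorHomOf {X Z : FDModule k D.Alg} {E : Type*} [AddCommGroup E] [Module k E]
    [Module D.Alg E] [IsScalarTower k D.Alg E] (f : X →ₗ[k] Z →ₗ[k] E)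
    (hy : ∀ x z, f (D.y • x) (D.grp D.g • z) + f x (D.y • z) = D.y • f x z)
    (hg : ∀ h x z, f (D.grp h • x) (D.grp h • z) = D.grp h • f x z) : tensor X Z →ₗ[D.Alg] E :=
  D.mkHom (tensorLift f)
    (tensor_induction (fun x z => by simp [y_tmul, hy])
      (fun s t hs ht => by rw [smul_add, map_add, map_add, smul_add, hs, ht]))
    (fun h => tensor_induction (fun x z => by simp [grp_tmul, hg])
      (fun s t hs ht => by rw [smul_add, map_add, map_add, smul_add, hs, ht]))

theorem tensorHomOf_tmul {X Z : FDModule k D.Alg} {E : Type*} [AddCommGroup E] [Module k E]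
    [Module D.Alg E] [IsScalarTower k D.Alg E] (f : X →ₗ[k] Z →ₗ[k] E)
    (hy : ∀ x z, f (D.y • x) (D.grp D.g • z) + f x (D.y • z) = D.y • f x z)
    (hg : ∀ h x z, f (D.grp h • x) (D.grp h • z) = D.grp h • f x z) (x : X) (z : Z) :
    D.tensorHomOf f hy hg (tmul X Z x z) = f x z :=
  tensorLift_tmul f x z

theorem tensor_hom_ext {X Z : FDModule k D.Alg} {E : Type*} [AddCommGroup E]
    [Module D.Alg E] {f f' : tensor X Z →ₗ[D.Alg] E}
    (h : ∀ x z, f (tmul X Z x z) = f' (tmul X Z x z)) : f = f' :=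
  LinearMap.ext (tensor_induction h fun s t hs ht => by rw [map_add, map_add, hs, ht])

variable {D} {X X' X'' Y Z Z' Z'' : FDModule k D.Alg}

/-- The tensor product of two homomorphisms. -/
noncomputable def tensorMap (f : X →ₗ[D.Alg] X') (f' : Z →ₗ[D.Alg] Z') :
    tensor X Z →ₗ[D.Alg] tensor X' Z' :=
  D.tensorHomOf ((tmul X' Z').compl₁₂ (f.restrictScalars k) (f'.restrictScalars k))
    (fun x z => by simp [y_tmul]) (fun h x z => by simp [grp_tmul])

@[simp] theorem tensorMap_tmul (f : X →ₗ[D.Alg] X') (f' : Z →ₗ[D.Alg] Z') (x : X) (z : Z) :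
    tensorMap f f' (tmul X Z x z) = tmul X' Z' (f x) (f' z) :=
  D.tensorHomOf_tmul _ _ _ x z

theorem tensorMap_comp (f : X →ₗ[D.Alg] X') (f' : Z →ₗ[D.Alg] Z') (e : X' →ₗ[D.Alg] X'')
    (e' : Z' →ₗ[D.Alg] Z'') :
    tensorMap e e' ∘ₗ tensorMap f f' = tensorMap (e ∘ₗ f) (e' ∘ₗ f') :=
  tensor_hom_ext D fun x z => by simp

theorem tensorMap_id :
    tensorMap (LinearMap.id : X →ₗ[D.Alg] X) (LinearMap.id : Z →ₗ[D.Alg] Z) = LinearMap.id :=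
  tensor_hom_ext D fun x z => by simp

theorem tensorMap_add_left (f e : X →ₗ[D.Alg] X') (f' : Z →ₗ[D.Alg] Z') :
    tensorMap (f + e) f' = tensorMap f f' + tensorMap e f' :=
  tensor_hom_ext D fun x z => by simp

theorem tensorMap_add_right (f : X →ₗ[D.Alg] X') (f' e' : Z →ₗ[D.Alg] Z') :
    tensorMap f (f' + e') = tensorMap f f' + tensorMap f e' :=
  tensor_hom_ext D fun x z => by simp

theorem tensorMap_sub_left (f e : X →ₗ[D.Alg] X') (f' : Z →ₗ[D.Alg] Z') :
    tensorMap (f - e) f' = tensorMap f f' - tensorMap e f' :=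
  tensor_hom_ext D fun x z => by simp

theorem tensorMap_sub_right (f : X →ₗ[D.Alg] X') (f' e' : Z →ₗ[D.Alg] Z') :
    tensorMap f (f' - e') = tensorMap f f' - tensorMap f e' :=
  tensor_hom_ext D fun x z => by simp

theorem tensorMap_zero_left (f' : Z →ₗ[D.Alg] Z') : tensorMap (0 : X →ₗ[D.Alg] X') f' = 0 :=
  tensor_hom_ext D fun x z => by simp

theorem tensorMap_zero_right (f : X →ₗ[D.Alg] X') : tensorMap f (0 : Z →ₗ[D.Alg] Z') = 0 :=
  tensor_hom_ext D fun x z => by simp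

theorem directSum_tensor (X Y Z : FDModule k D.Alg) :
    Iso (tensor (X.directSum Y) Z) ((tensor X Z).directSum (tensor Y Z)) := by
  refine iso_directSum (tensorMap (inl X Y) LinearMap.id) (tensorMap (inr X Y) LinearMap.id)
    (tensorMap (fst X Y) LinearMap.id) (tensorMap (snd X Y) LinearMap.id) ?_ ?_ ?_ ?_ ?_ <;>
  simp only [tensorMap_comp, LinearMap.id_comp]
  · rw [fst_inl, tensorMap_id]
  · rw [snd_inr, tensorMap_id]
  · rw [fst_inr, tensorMap_zero_left]
  · rw [snd_inl, tensorMap_zero_left]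
  · rw [← tensorMap_add_left, inl_fst_add_inr_snd, tensorMap_id]

theorem tensor_directSum (X Y Z : FDModule k D.Alg) :
    Iso (tensor Z (X.directSum Y)) ((tensor Z X).directSum (tensor Z Y)) := by
  refine iso_directSum (tensorMap LinearMap.id (inl X Y)) (tensorMap LinearMap.id (inr X Y))
    (tensorMap LinearMap.id (fst X Y)) (tensorMap LinearMap.id (snd X Y)) ?_ ?_ ?_ ?_ ?_ <;>
  simp only [tensorMap_comp, LinearMap.id_comp]
  · rw [fst_inl, tensorMap_id]
  · rw [snd_inr, tensorMap_id]
  · rw [fst_inr, tensorMap_zero_right]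
  · rw [snd_inl, tensorMap_zero_right]
  · rw [← tensorMap_add_right, inl_fst_add_inr_snd, tensorMap_id]

/-! ### Projective modules form a tensor ideal, and stable isomorphism respects tensor products. -/

variable [CharZero k]

/-- The map from the induced module to `N` is onto, since `f(W)` generates, and the dimensions
agree; so `N` is itself induced. -/
theorem isProjective_of_indHom_surjective (hχ : D.χ ^ D.n = 1)
    (W : FDModule k (MonoidAlgebra k G)) (N : FDModule k D.Alg) (f : W →ₗ[k] N)
    (hf : ∀ h w, f (W.ρ (of k G h) w) = D.grp h • f w)
    (hr : Module.finrank k N = D.n * Module.finrank k W)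
    (hs : ∀ R : Submodule D.Alg N, (∀ w, f w ∈ R) → R = ⊤) : N.IsProjective := by
  let φ := D.indHom hχ W (E := N) f hf
  have hsurj : Function.Surjective φ := by
    refine LinearMap.range_eq_top.mp (hs _ fun w => ⟨D.indSingle hχ W ⟨0, D.n_pos⟩ w, ?_⟩)
    refine (D.indHom_apply hχ _ _ _ _).trans ?_
    rw [Finset.sum_eq_single ⟨0, D.n_pos⟩]
    · rw [indEquiv_indSingle, if_pos rfl, pow_zero, one_smul]
    · intro l _ hl
      rw [indEquiv_indSingle, if_neg hl, map_zero, smul_zero]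
    · simp
  have hr' : Module.finrank k (D.ind hχ W) = Module.finrank k N := by
    rw [(D.indEquiv hχ W).finrank_eq, Module.finrank_pi_fintype, hr]
    simp
  have hinj : Function.Injective (φ.restrictScalars k) :=
    (LinearMap.injective_iff_surjective_of_finrank_eq_finrank hr').mpr hsurj
  exact Iso.isProjective ⟨LinearEquiv.ofBijective φ ⟨hinj, hsurj⟩⟩ (D.ind_isProjective hχ _)

theorem isProjective_of_rep_surjective (hχ : D.χ ^ D.n = 1) {W : Type u} [AddCommGroup W]
    [Module k W] [Module.Finite k W] (N : FDModule k D.Alg) (σ : G →* Module.End k W)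
    (f : W →ₗ[k] N) (hf : ∀ h w, f (σ h w) = D.grp h • f w)
    (hr : Module.finrank k N = D.n * Module.finrank k W)
    (hs : ∀ R : Submodule D.Alg N, (∀ w, f w ∈ R) → R = ⊤) : N.IsProjective :=
  isProjective_of_indHom_surjective hχ (ofRep σ) N f
    (fun h w => (congrArg f (LinearMap.congr_fun (ofRep_ρ σ h) w)).trans (hf h w)) hr hs

/-- The tensor identity: the module is induced from the representation `W ⊗ Z` sitting in the layer
`x^0`, which generates it. -/
theorem ind_tensor_isProjective (hχ : D.χ ^ D.n = 1) (W : FDModule k (MonoidAlgebra k G))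
    (Z : FDModule k D.Alg) : (tensor (D.ind hχ W) Z).IsProjective := by
  let σ : G →* Module.End k (W ⊗[k] Z) :=
    { toFun := fun h => TensorProduct.map (W.ρ (of k G h)) (D.grpEnd Z h)
      map_one' := by rw [map_one, map_one, map_one]; exact TensorProduct.map_one
      map_mul' := fun h h' => by rw [map_mul, map_mul, map_mul]; exact TensorProduct.map_mul _ _ _ _ }
  let S := D.indSingle hχ W
  let f : W ⊗[k] Z →ₗ[k] tensor (D.ind hχ W) Z :=
    TensorProduct.lift ((tmul (D.ind hχ W) Z) ∘ₗ S ⟨0, D.n_pos⟩)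
  have hf : ∀ w z, f (w ⊗ₜ z) = tmul _ Z (S ⟨0, D.n_pos⟩ w) z := fun w z => rfl
  refine isProjective_of_rep_surjective hχ _ σ f (fun h t => ?_) ?_ fun R hR => ?_
  · induction t with
    | zero => simp
    | add s t hs ht => simp only [map_add, smul_add, hs, ht]
    | tmul w z =>
      have : σ h (w ⊗ₜ z) = (W.ρ (of k G h) w) ⊗ₜ (D.grp h • z) := rfl
      rw [this, hf, hf, grp_tmul, grp_indSingle]
      simp [S]
  · rw [finrank_tensor, (D.indEquiv hχ W).finrank_eq, Module.finrank_tensorProduct,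
      Module.finrank_pi_fintype]
    simp [mul_assoc]
  · have h1 : ∀ (l : ℕ) (hl : l < D.n) (w : W) (z : Z), tmul _ Z (S ⟨l, hl⟩ w) z ∈ R := by
      intro l hl
      induction l with
      | zero => exact fun w z => hR (w ⊗ₜ z)
      | succ l ih =>
        intro w z
        -- Since `Δ(y) = y ⊗ g + 1 ⊗ y`, replacing `z` by `g⁻¹ z` makes `x^(l+1) w ⊗ z` appear, up
        -- to a term from the layer `x^l`, which lies in `R` by induction.
        have h2 := R.smul_mem D.y (ih (by omega) w (D.grp D.g⁻¹ • z))
        rw [y_tmul, D.y_indSingle hχ W _ ⟨l + 1, hl⟩ rfl, ← mul_smul, grp_mul_inv, one_smul] at h2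
        exact (R.add_mem_iff_left (ih (by omega) w _)).mp h2
    refine Submodule.eq_top_iff'.mpr (tensor_induction (fun v z => ?_) fun s t => R.add_mem)
    rw [← D.sum_indSingle hχ W v, map_sum, LinearMap.sum_apply]
    exact R.sum_mem fun l _ => h1 l l.2 _ z

theorem tensor_ind_isProjective (hχ : D.χ ^ D.n = 1) (W : FDModule k (MonoidAlgebra k G))
    (Z : FDModule k D.Alg) : (tensor Z (D.ind hχ W)).IsProjective := by
  let σ : G →* Module.End k (Z ⊗[k] W) :=
    { toFun := fun h => TensorProduct.map (D.grpEnd Z h) (W.ρ (of k G h))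
      map_one' := by rw [map_one, map_one, map_one]; exact TensorProduct.map_one
      map_mul' := fun h h' => by rw [map_mul, map_mul, map_mul]; exact TensorProduct.map_mul _ _ _ _ }
  let S := D.indSingle hχ W
  let f : Z ⊗[k] W →ₗ[k] tensor Z (D.ind hχ W) :=
    TensorProduct.lift ((tmul Z (D.ind hχ W)).compl₂ (S ⟨0, D.n_pos⟩))
  have hf : ∀ z w, f (z ⊗ₜ w) = tmul Z _ z (S ⟨0, D.n_pos⟩ w) := fun z w => rfl
  refine isProjective_of_rep_surjective hχ _ σ f (fun h t => ?_) ?_ fun R hR => ?_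
  · induction t with
    | zero => simp
    | add s t hs ht => simp only [map_add, smul_add, hs, ht]
    | tmul z w =>
      have : σ h (z ⊗ₜ w) = (D.grp h • z) ⊗ₜ (W.ρ (of k G h) w) := rfl
      rw [this, hf, hf, grp_tmul, grp_indSingle]
      simp [S]
  · rw [finrank_tensor, (D.indEquiv hχ W).finrank_eq, Module.finrank_tensorProduct,
      Module.finrank_pi_fintype]
    simp [mul_left_comm]
  · have h1 : ∀ (l : ℕ) (hl : l < D.n) (z : Z) (w : W), tmul Z _ z (S ⟨l, hl⟩ w) ∈ R := by
      intro l hl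
      induction l with
      | zero => exact fun z w => hR (z ⊗ₜ w)
      | succ l ih =>
        intro z w
        have h2 := R.smul_mem D.y (ih (by omega) z w)
        -- With the induced module as the second factor, the new layer comes from `1 ⊗ y`, so no
        -- correction by `g⁻¹` is needed.
        rw [y_tmul, D.y_indSingle hχ W _ ⟨l + 1, hl⟩ rfl, grp_indSingle] at h2
        exact (R.add_mem_iff_right (ih (by omega) _ _)).mp h2
    refine Submodule.eq_top_iff'.mpr (tensor_induction (fun z v => ?_) fun s t => R.add_mem)
    rw [← D.sum_indSingle hχ W v, map_sum]
    exact R.sum_mem fun l _ => h1 l l.2 z _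

theorem isProjective_tensor_left (hχ : D.χ ^ D.n = 1) {P : FDModule k D.Alg} (hP : P.IsProjective)
    (Z : FDModule k D.Alg) : (tensor P Z).IsProjective := by
  obtain ⟨s, hs⟩ := D.exists_section_indCounit hχ hP
  refine isProjective_of_retract (tensorMap s LinearMap.id)
    (tensorMap (D.indCounit hχ P) LinearMap.id) ?_ (ind_tensor_isProjective hχ (D.res P) Z)
  rw [tensorMap_comp, hs, LinearMap.id_comp, tensorMap_id]

theorem isProjective_tensor_right (hχ : D.χ ^ D.n = 1) {P : FDModule k D.Alg}
    (hP : P.IsProjective) (Z : FDModule k D.Alg) : (tensor Z P).IsProjective := by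
  obtain ⟨s, hs⟩ := D.exists_section_indCounit hχ hP
  refine isProjective_of_retract (tensorMap LinearMap.id s)
    (tensorMap LinearMap.id (D.indCounit hχ P)) ?_ (tensor_ind_isProjective hχ (D.res P) Z)
  rw [tensorMap_comp, hs, LinearMap.id_comp, tensorMap_id]

/-- Tensoring with `Z` is additive and sends a factorization through `P` to one through `P ⊗ Z`,
which is again projective. -/
theorem stableIso_tensor_left (hχ : D.χ ^ D.n = 1) (h : StableIso X Y) (Z : FDModule k D.Alg) :
    StableIso (tensor X Z) (tensor Y Z) := by
  have key : ∀ {X : FDModule k D.Alg} (e : X →ₗ[D.Alg] X),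
      FactorsThroughProjective (e - LinearMap.id) →
      FactorsThroughProjective (tensorMap e (LinearMap.id : Z →ₗ[D.Alg] Z) - LinearMap.id) := by
    rintro X e ⟨P, hP, s, t, hst⟩
    refine ⟨tensor P Z, isProjective_tensor_left hχ hP Z, tensorMap s LinearMap.id,
      tensorMap t LinearMap.id, ?_⟩
    rw [tensorMap_comp, ← hst, LinearMap.id_comp, tensorMap_sub_left, tensorMap_id]
  obtain ⟨f, g, h1, h2⟩ := h
  refine ⟨tensorMap f LinearMap.id, tensorMap g LinearMap.id, ?_, ?_⟩
  · rw [tensorMap_comp]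
    exact key _ h1
  · rw [tensorMap_comp]
    exact key _ h2

theorem stableIso_tensor_right (hχ : D.χ ^ D.n = 1) (h : StableIso X Y) (Z : FDModule k D.Alg) :
    StableIso (tensor Z X) (tensor Z Y) := by
  have key : ∀ {X : FDModule k D.Alg} (e : X →ₗ[D.Alg] X),
      FactorsThroughProjective (e - LinearMap.id) →
      FactorsThroughProjective (tensorMap (LinearMap.id : Z →ₗ[D.Alg] Z) e - LinearMap.id) := by
    rintro X e ⟨P, hP, s, t, hst⟩
    refine ⟨tensor Z P, isProjective_tensor_right hχ hP Z, tensorMap LinearMap.id s,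
      tensorMap LinearMap.id t, ?_⟩
    rw [tensorMap_comp, ← hst, LinearMap.id_comp, tensorMap_sub_right, tensorMap_id]
  obtain ⟨f, g, h1, h2⟩ := h
  refine ⟨tensorMap LinearMap.id f, tensorMap LinearMap.id g, ?_, ?_⟩
  · rw [tensorMap_comp]
    exact key _ h1
  · rw [tensorMap_comp]
    exact key _ h2

end GroupDatum

namespace GroupDatum

open FDModule MonoidAlgebra

/-! ### Modules over the group algebra -/

section GroupAlgebra

variable {k : Type u} [Field k] {G : Type v} [Group G] {W W' : FDModule k (MonoidAlgebra k G)}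

/-- An equivariant linear map is linear over the group algebra. -/
def repHom (f : W →ₗ[k] W') (hf : ∀ h w, f (W.ρ (of k G h) w) = W'.ρ (of k G h) (f w)) :
    W →ₗ[MonoidAlgebra k G] W' where
  toFun := f
  map_add' := f.map_add
  map_smul' a x := by
    simp only [smul_def, RingHom.id_apply]
    induction a using MonoidAlgebra.induction_on with
    | of h => exact hf h x
    | add a b ha hb => simp only [map_add, LinearMap.add_apply, ha, hb]
    | smul c a ha => simp only [map_smul, LinearMap.smul_apply, ha]

/-- A `G`-stable subspace as a submodule over the group algebra. -/
def repSubmodule (S : Submodule k W) (hS : ∀ h, ∀ x ∈ S, W.ρ (of k G h) x ∈ S) :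
    Submodule (MonoidAlgebra k G) W where
  carrier := S
  add_mem' := S.add_mem
  zero_mem' := S.zero_mem
  smul_mem' a x hx := by
    rw [smul_def]
    induction a using MonoidAlgebra.induction_on with
    | of h => exact hS h x hx
    | add a b ha hb =>
      rw [map_add, LinearMap.add_apply]
      exact S.add_mem ha hb
    | smul c a ha =>
      rw [map_smul, LinearMap.smul_apply]
      exact S.smul_mem c ha

theorem exists_scalar_of_equivariant [IsAlgClosed k] [IsSimpleModule (MonoidAlgebra k G) W]
    (f : W →ₗ[k] W) (hf : ∀ h w, f (W.ρ (of k G h) w) = W.ρ (of k G h) (f w)) :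
    ∃ c : k, ∀ w, f w = c • w := by
  obtain ⟨c, hc⟩ := (IsSimpleModule.algebraMap_end_bijective_of_isAlgClosed
    (A := MonoidAlgebra k G) (V := W) k).2 (repHom f hf)
  exact ⟨c, fun w => (LinearMap.congr_fun hc w).symm⟩

end GroupAlgebra

/-! ### The modules `M(j, W)` -/

variable {k : Type u} [Field k] {G : Type v} [Group G] [Finite G] (D : GroupDatum k G)

section Uniserial

variable {j : ℕ} (hj : j ≤ D.n) (W : FDModule k (MonoidAlgebra k G))
  (hW : W.ρ (of k G (D.g ^ D.n)) = 1)

/-- The identity map, with the underlying space of `M(j, W)` as its source. -/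
noncomputable def MEquiv : D.M j hj W hW ≃ₗ[k] (Fin j → W) :=
  LinearEquiv.refl k (Fin j → W)

theorem MEquiv_y (v : D.M j hj W hW) :
    D.MEquiv hj W hW (D.y • v) = yAct j W (D.MEquiv hj W hW v) :=
  LinearMap.congr_fun (D.M_ρ_y j hj W hW) v

theorem MEquiv_y_pow (m : ℕ) (v : D.M j hj W hW) :
    D.MEquiv hj W hW (D.y ^ m • v) = (yAct j W ^ m) (D.MEquiv hj W hW v) := by
  induction m with
  | zero => simp
  | succ m ih => rw [pow_succ', mul_smul, MEquiv_y, ih, pow_succ', Module.End.mul_apply]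

theorem MEquiv_grp (h : G) (v : D.M j hj W hW) :
    D.MEquiv hj W hW (D.grp h • v) = D.grpAct j W h (D.MEquiv hj W hW v) :=
  LinearMap.congr_fun (D.M_ρ_grp j hj W hW h) v

theorem M_pow_smul_eq_zero {m : ℕ} (hm : j ≤ m) (v : D.M j hj W hW) : D.y ^ m • v = 0 := by
  refine (D.MEquiv hj W hW).injective (funext fun l => ?_)
  rw [MEquiv_y_pow, yAct_pow_apply, if_pos (l.2.trans_le hm), map_zero, Pi.zero_apply]

/-- The inclusion of the summand `x^l W` into `M(j, W)`. -/
noncomputable def MSingle (l : Fin j) : W →ₗ[k] D.M j hj W hW :=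
  (D.MEquiv hj W hW).symm.toLinearMap ∘ₗ LinearMap.single k (fun _ : Fin j => W) l

theorem MEquiv_MSingle (l m : Fin j) (w : W) :
    D.MEquiv hj W hW (D.MSingle hj W hW l w) m = if m = l then w else 0 := by
  rw [MSingle, LinearMap.comp_apply, LinearEquiv.coe_coe, LinearEquiv.apply_symm_apply,
    LinearMap.single_apply, Pi.single_apply]

theorem grp_MSingle (l : Fin j) (h : G) (w : W) : D.grp h • D.MSingle hj W hW l w =
    D.MSingle hj W hW l ((((D.χ h)⁻¹ : kˣ) : k) ^ (l : ℕ) • W.ρ (of k G h) w) := by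
  refine (D.MEquiv hj W hW).injective (funext fun m => ?_)
  rw [MEquiv_grp, grpAct_apply, MEquiv_MSingle, MEquiv_MSingle]
  split_ifs with h
  · rw [h]
  · simp

theorem pow_y_MSingle (h0 : 0 < j) (l : Fin j) (w : W) :
    D.y ^ (l : ℕ) • D.MSingle hj W hW ⟨0, h0⟩ w = D.MSingle hj W hW l w := by
  refine (D.MEquiv hj W hW).injective (funext fun i => ?_)
  simp only [MEquiv_y_pow, yAct_pow_apply, MEquiv_MSingle, Fin.ext_iff]
  split_ifs <;> first | omega | rfl

theorem sum_MSingle (v : D.M j hj W hW) :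
    ∑ l, D.MSingle hj W hW l (D.MEquiv hj W hW v l) = v := by
  refine (D.MEquiv hj W hW).injective (funext fun m => ?_)
  rw [map_sum, Finset.sum_apply]
  simp only [MEquiv_MSingle]
  simp

theorem finrank_M : Module.finrank k (D.M j hj W hW) = j * Module.finrank k W := by
  rw [(D.MEquiv hj W hW).finrank_eq, Module.finrank_pi_fintype]
  simp

theorem M_nontrivial (h0 : 0 < j) [Nontrivial W] : Nontrivial (D.M j hj W hW) := by
  have : Nonempty (Fin j) := ⟨⟨0, h0⟩⟩
  exact (D.MEquiv hj W hW).toEquiv.nontrivial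

section Homs

variable {E : Type*} [AddCommGroup E] [Module k E] [Module D.Alg E] [IsScalarTower k D.Alg E]

theorem sumPow_yAct (f : W →ₗ[k] E) (hf : ∀ w, D.y ^ j • f w = 0) (v : Fin j → W) :
    D.sumPow j f (yAct j W v) = D.y • D.sumPow j f v := by
  rw [sumPow_apply, sumPow_apply, Finset.smul_sum]
  let F : ℕ → E := fun l => if h : l < j then D.y ^ l • f (v ⟨l, h⟩) else 0
  have h1 : ∀ l : Fin j, D.y • D.y ^ (l : ℕ) • f (v l) = D.y • F l := by
    intro l
    simp [F]
  have h2 : ∀ l : Fin j, D.y ^ (l : ℕ) • f (yAct j W v l) =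
      if (l : ℕ) = 0 then 0 else D.y • F (l - 1) := by
    intro l
    rw [yAct_apply]
    split_ifs with h0
    · rw [map_zero, smul_zero]
    · have h3 : (l : ℕ) - 1 < j := by omega
      simp only [F, dif_pos h3]
      rw [← mul_smul, ← pow_succ', Nat.sub_add_cancel (by omega)]
  rw [Finset.sum_congr rfl fun l _ => h1 l, Finset.sum_congr rfl fun l _ => h2 l,
    Fin.sum_univ_eq_sum_range (fun l => if l = 0 then 0 else D.y • F (l - 1)),
    Fin.sum_univ_eq_sum_range (fun l => D.y • F l)]
  cases j with
  | zero => simp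
  | succ m =>
    -- Unlike in the induced module, the last layer does not wrap around: its image is `y ^ j • f`,
    -- which vanishes by hypothesis.
    have h3 : D.y • F m = 0 := by
      simp only [F, dif_pos (Nat.lt_succ_self m)]
      rw [← mul_smul, ← pow_succ', hf]
    rw [Finset.sum_range_succ', Finset.sum_range_succ, h3]
    simp

/-- The homomorphism from `M(j, W)` given by an equivariant map `f` with `y^j f = 0`. -/
noncomputable def homOfM (f : W →ₗ[k] E) (hf : ∀ h w, f (W.ρ (of k G h) w) = D.grp h • f w)
    (hy : ∀ w, D.y ^ j • f w = 0) : D.M j hj W hW →ₗ[D.Alg] E :=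
  D.mkHom (D.sumPow j f ∘ₗ (D.MEquiv hj W hW).toLinearMap)
    (fun v => by simp only [LinearMap.comp_apply, LinearEquiv.coe_coe, MEquiv_y,
      D.sumPow_yAct W f hy])
    (fun h v => by simp only [LinearMap.comp_apply, LinearEquiv.coe_coe, MEquiv_grp,
      D.sumPow_grp W j f hf])

theorem homOfM_apply (f : W →ₗ[k] E) (hf : ∀ h w, f (W.ρ (of k G h) w) = D.grp h • f w)
    (hy : ∀ w, D.y ^ j • f w = 0) (v : D.M j hj W hW) :
    D.homOfM hj W hW f hf hy v = ∑ l : Fin j, D.y ^ (l : ℕ) • f (D.MEquiv hj W hW v l) :=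
  D.sumPow_apply j f _

theorem homOfM_MSingle (f : W →ₗ[k] E) (hf : ∀ h w, f (W.ρ (of k G h) w) = D.grp h • f w)
    (hy : ∀ w, D.y ^ j • f w = 0) (l : Fin j) (w : W) :
    D.homOfM hj W hW f hf hy (D.MSingle hj W hW l w) = D.y ^ (l : ℕ) • f w := by
  rw [homOfM_apply, Finset.sum_eq_single l]
  · rw [MEquiv_MSingle, if_pos rfl]
  · intro m _ hm
    rw [MEquiv_MSingle, if_neg hm, map_zero, smul_zero]
  · simp

/-- The homomorphism `x ↦ ∑ x^l f(y^{j-1-l} x)` to `M(j, W)`. -/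
noncomputable def homToM (f : E →ₗ[k] W)
    (hf : ∀ h x, f (D.grp h • x) = (((D.χ h)⁻¹ : kˣ) : k) ^ (j - 1) • W.ρ (of k G h) (f x))
    (hy : ∀ x, f (D.y ^ j • x) = 0) : E →ₗ[D.Alg] D.M j hj W hW :=
  D.mkHom ((D.MEquiv hj W hW).symm.toLinearMap ∘ₗ LinearMap.pi fun l : Fin j =>
      f ∘ₗ Algebra.lsmul k k E (D.y ^ (j - 1 - (l : ℕ))))
    (fun x => by
      refine (D.MEquiv hj W hW).injective (funext fun l => ?_)
      simp only [LinearMap.comp_apply, LinearEquiv.coe_coe, MEquiv_y, LinearEquiv.apply_symm_apply,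
        LinearMap.pi_apply, yAct_apply, Algebra.lsmul_coe]
      rw [← mul_smul, ← pow_succ]
      split_ifs with h0
      · rw [h0, Nat.sub_zero, Nat.sub_add_cancel (by omega), hy]
      · congr 3
        omega)
    (fun h x => by
      refine (D.MEquiv hj W hW).injective (funext fun l => ?_)
      simp only [LinearMap.comp_apply, LinearEquiv.coe_coe, MEquiv_grp, LinearEquiv.apply_symm_apply,
        LinearMap.pi_apply, grpAct_apply, Algebra.lsmul_coe]
      rw [pow_smul_y_grp, map_smul, hf, smul_smul]
      congr 1
      have e : (((D.χ h)⁻¹ : kˣ) : k) ^ (j - 1) = (((D.χ h)⁻¹ : kˣ) : k) ^ (j - 1 - (l : ℕ)) *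
          (((D.χ h)⁻¹ : kˣ) : k) ^ (l : ℕ) := by
        rw [← pow_add]
        congr 1
        omega
      rw [e, ← mul_assoc, ← mul_pow, ← Units.val_mul, mul_inv_cancel, Units.val_one, one_pow,
        one_mul])

theorem MEquiv_homToM (f : E →ₗ[k] W)
    (hf : ∀ h x, f (D.grp h • x) = (((D.χ h)⁻¹ : kˣ) : k) ^ (j - 1) • W.ρ (of k G h) (f x))
    (hy : ∀ x, f (D.y ^ j • x) = 0) (x : E) (l : Fin j) :
    D.MEquiv hj W hW (D.homToM hj W hW f hf hy x) l = f (D.y ^ (j - 1 - (l : ℕ)) • x) :=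
  congrFun ((D.MEquiv hj W hW).apply_symm_apply _) l

end Homs

theorem hom_MSingle {E : Type*} [AddCommGroup E] [Module D.Alg E] (h0 : 0 < j)
    (f : D.M j hj W hW →ₗ[D.Alg] E) (l : Fin j) (w : W) :
    f (D.MSingle hj W hW l w) = D.y ^ (l : ℕ) • f (D.MSingle hj W hW ⟨0, h0⟩ w) := by
  rw [← map_smul, pow_y_MSingle]

/-- Schur's lemma for the central element `g`; the scalar is nonzero because `g` is invertible. -/
theorem exists_scalar_g [IsAlgClosed k] [IsSimpleModule (MonoidAlgebra k G) W] :
    ∃ c : k, c ≠ 0 ∧ ∀ w, W.ρ (of k G D.g) w = c • w := by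
  obtain ⟨c, hc⟩ := exists_scalar_of_equivariant (W.ρ (of k G D.g)) fun h w => by
    rw [← Module.End.mul_apply, ← Module.End.mul_apply, ← map_mul, ← map_mul, ← map_mul, ← map_mul,
      Subgroup.mem_center_iff.mp D.g_mem_center h]
  refine ⟨c, fun h => ?_, hc⟩
  have := IsSimpleModule.nontrivial (MonoidAlgebra k G) W
  obtain ⟨w, hw⟩ := exists_ne (0 : W)
  refine hw ?_
  have h1 : W.ρ (of k G D.g⁻¹) (W.ρ (of k G D.g) w) = w := by
    rw [← Module.End.mul_apply, ← map_mul, ← map_mul, inv_mul_cancel, map_one, map_one,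
      Module.End.one_apply]
  rw [← h1, hc, h, zero_smul, map_zero]

/-- The module is generated by the layer `x^0 W`, so an endomorphism is determined there. Its
component into `x^l W` vanishes for `l ≠ 0` since `g` acts on the two layers by different scalars,
and for `l = 0` it is a scalar by Schur. -/
theorem M_isBrick [IsAlgClosed k] [IsSimpleModule (MonoidAlgebra k G) W] (h0 : 0 < j) :
    (D.M j hj W hW).IsBrick := by
  have := IsSimpleModule.nontrivial (MonoidAlgebra k G) W
  refine ⟨D.M_nontrivial hj W hW h0, fun f => ?_⟩
  let a : Fin j → W →ₗ[k] W := fun l => LinearMap.proj l ∘ₗ (D.MEquiv hj W hW).toLinearMap ∘ₗ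
    f.restrictScalars k ∘ₗ D.MSingle hj W hW ⟨0, h0⟩
  have ha : ∀ l w, a l w = D.MEquiv hj W hW (f (D.MSingle hj W hW ⟨0, h0⟩ w)) l := fun _ _ => rfl
  have hag : ∀ l h w, a l (W.ρ (of k G h) w) =
      (((D.χ h)⁻¹ : kˣ) : k) ^ (l : ℕ) • W.ρ (of k G h) (a l w) := by
    intro l h w
    have h1 := D.grp_MSingle hj W hW ⟨0, h0⟩ h w
    rw [pow_zero, one_smul] at h1
    rw [ha, ← h1, map_smul, MEquiv_grp, grpAct_apply, ha]
  obtain ⟨γ, hγ0, hγ⟩ := D.exists_scalar_g W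
  -- Equivariance at `h = g` gives `γ = q^(-l) γ` if the component is nonzero, with `q = χ(g)`; this
  -- is impossible for `0 < l < n`, as `q` is a primitive `n`-th root of unity.
  have hal : ∀ l : Fin j, (l : ℕ) ≠ 0 → ∀ w, a l w = 0 := by
    intro l hl w
    have h1 := hag l D.g w
    rw [hγ, hγ, map_smul, smul_smul, ← sub_eq_zero, ← sub_smul] at h1
    refine (smul_eq_zero.mp h1).resolve_left fun h2 => ?_
    have h3 : (((D.χ D.g)⁻¹ : kˣ) : k) ^ (l : ℕ) = 1 := by
      have h4 : γ * 1 = γ * (((D.χ D.g)⁻¹ : kˣ) : k) ^ (l : ℕ) := by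
        rw [mul_one, mul_comm γ]
        exact sub_eq_zero.mp h2
      exact (mul_left_cancel₀ hγ0 h4).symm
    rw [Units.val_inv_eq_inv_val, inv_pow, inv_eq_one] at h3
    exact D.isPrimitiveRoot_q.pow_ne_one_of_pos_of_lt hl (l.2.trans_le hj) h3
  obtain ⟨c, hc⟩ := exists_scalar_of_equivariant (a ⟨0, h0⟩) fun h w => by
    rw [hag, pow_zero, one_smul]
  have h1 : ∀ w, f (D.MSingle hj W hW ⟨0, h0⟩ w) = c • D.MSingle hj W hW ⟨0, h0⟩ w := by
    intro w
    refine (D.MEquiv hj W hW).injective (funext fun l => ?_)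
    rw [← ha, map_smul, Pi.smul_apply, MEquiv_MSingle]
    by_cases hl : l = ⟨0, h0⟩
    · rw [if_pos hl, hl, hc]
    · rw [if_neg hl, smul_zero, hal l fun h => hl (Fin.ext h)]
  refine ⟨c, fun v => ?_⟩
  rw [← D.sum_MSingle hj W hW v, map_sum, Finset.smul_sum]
  refine Finset.sum_congr rfl fun l _ => ?_
  rw [D.hom_MSingle hj W hW h0, h1, smul_smul_comm', pow_y_MSingle]

/-- For `j = n` the layer `x^0 W` generates a module of dimension `n · dim W`, so the module is
induced from `W`. -/
theorem M_n_isProjective [CharZero k] (hχ : D.χ ^ D.n = 1) :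
    (D.M D.n le_rfl W hW).IsProjective := by
  refine isProjective_of_indHom_surjective hχ W _ (D.MSingle le_rfl W hW ⟨0, D.n_pos⟩)
    (fun h w => ?_) (D.finrank_M le_rfl W hW) fun R hR => ?_
  · rw [grp_MSingle, pow_zero, one_smul]
  · refine Submodule.eq_top_iff'.mpr fun v => ?_
    rw [← D.sum_MSingle le_rfl W hW v]
    refine R.sum_mem fun l _ => ?_
    rw [← D.pow_y_MSingle le_rfl W hW D.n_pos]
    exact R.smul_mem _ (hR _)

variable {W}

/-- The length `j` is recovered as the nilpotency index of `y`. -/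
theorem le_of_M_iso {j' : ℕ} (hj' : j' ≤ D.n) {W' : FDModule k (MonoidAlgebra k G)}
    (hW' : W'.ρ (of k G (D.g ^ D.n)) = 1) [Nontrivial W]
    (h : Iso (D.M j hj W hW) (D.M j' hj' W' hW')) : j ≤ j' := by
  by_contra! hlt
  obtain ⟨e⟩ := h
  obtain ⟨w, hw⟩ := exists_ne (0 : W)
  have h1 := D.pow_y_MSingle hj W hW (by omega) ⟨j', hlt⟩ w
  have h2 : D.y ^ j' • D.MSingle hj W hW ⟨0, by omega⟩ w = 0 := e.injective <| by
    rw [map_smul, D.M_pow_smul_eq_zero hj' W' hW' le_rfl, map_zero]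
  have h3 := D.MEquiv_MSingle hj W hW ⟨j', hlt⟩ ⟨j', hlt⟩ w
  rw [← h1, h2, if_pos rfl, map_zero] at h3
  exact hw h3.symm

/-- The representation `W` is recovered as the layer `x^0 W`, that is, as the quotient by the image
of `y`. -/
theorem iso_of_M_iso (h0 : 0 < j) {W' : FDModule k (MonoidAlgebra k G)}
    (hW' : W'.ρ (of k G (D.g ^ D.n)) = 1) [IsSimpleModule (MonoidAlgebra k G) W]
    [IsSimpleModule (MonoidAlgebra k G) W']
    (h : Iso (D.M j hj W hW) (D.M j hj W' hW')) : Iso W W' := by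
  obtain ⟨e⟩ := h
  let a : W →ₗ[k] W' := LinearMap.proj ⟨0, h0⟩ ∘ₗ (D.MEquiv hj W' hW').toLinearMap ∘ₗ
    e.toLinearMap.restrictScalars k ∘ₗ D.MSingle hj W hW ⟨0, h0⟩
  have ha : ∀ w, a w = D.MEquiv hj W' hW' (e (D.MSingle hj W hW ⟨0, h0⟩ w)) ⟨0, h0⟩ :=
    fun _ => rfl
  let b := repHom a fun h w => by
    have h1 := D.grp_MSingle hj W hW ⟨0, h0⟩ h w
    rw [pow_zero, one_smul] at h1
    rw [ha, ← h1, map_smul, MEquiv_grp, grpAct_apply, ha, pow_zero, one_smul]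
  -- All other layers are multiples of `y`, so if the component `W → W'` vanished, the image of `e`
  -- would have no `x^0` coordinate, against surjectivity.
  have hb : b ≠ 0 := by
    intro hb
    have h1 : ∀ w, a w = 0 := fun w => LinearMap.congr_fun hb w
    have h2 : ∀ v, D.MEquiv hj W' hW' (e v) ⟨0, h0⟩ = 0 := by
      intro v
      rw [← D.sum_MSingle hj W hW v, map_sum, map_sum, Finset.sum_apply]
      refine Finset.sum_eq_zero fun l _ => ?_
      have h3 := D.hom_MSingle hj W hW h0 e.toLinearMap l (D.MEquiv hj W hW v l)
      rw [LinearEquiv.coe_coe] at h3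
      rw [h3, MEquiv_y_pow, yAct_pow_apply]
      split_ifs with h4
      · rfl
      · rw [← h1 (D.MEquiv hj W hW v l), ha]
        exact congrArg (D.MEquiv hj W' hW' (e (D.MSingle hj W hW ⟨0, h0⟩ _)))
          (Fin.ext (Nat.zero_sub _))
    have := IsSimpleModule.nontrivial (MonoidAlgebra k G) W'
    obtain ⟨w, hw⟩ := exists_ne (0 : W')
    have h3 := h2 (e.symm (D.MSingle hj W' hW' ⟨0, h0⟩ w))
    rw [LinearEquiv.apply_symm_apply, MEquiv_MSingle, if_pos rfl] at h3
    exact hw h3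
  exact ⟨LinearEquiv.ofBijective b (LinearMap.bijective_of_ne_zero hb)⟩

end Uniserial

end GroupDatum

/-! ### Decomposition of modules -/

namespace GroupDatum

open FDModule MonoidAlgebra

variable {k : Type u} [Field k] {G : Type v} [Group G] [Finite G] (D : GroupDatum k G)
  {Ω : Type w} {V : Ω → FDModule k (MonoidAlgebra k G)}

theorem chi_g_pow_n : D.χ (D.g ^ D.n) = 1 := by
  rw [map_pow]
  exact pow_orderOf_eq_one _

/-- The average over the cyclic group generated by `gⁿ` projects onto the fixed points. -/
theorem exists_fixed_average [CharZero k] (X : FDModule k D.Alg) (m : ℕ) (x : X) :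
    ∃ x₀ : X, D.grp (D.g ^ D.n) • x₀ = x₀ ∧ ∀ {E : Type u} [AddCommGroup E] [Module k E]
      (f : X →ₗ[k] E), (∀ u, f (D.grp (D.g ^ D.n) • u) = f u) →
      f (D.y ^ m • x₀) = f (D.y ^ m • x) := by
  let C := Subgroup.zpowers (D.g ^ D.n)
  have := Fintype.ofFinite C
  refine ⟨(Nat.card C : k)⁻¹ • ∑ c : C, D.grp c • x, ?_, fun {E} _ _ f hf => ?_⟩
  · rw [smul_smul_comm', Finset.smul_sum]
    congr 1
    refine Fintype.sum_equiv (Equiv.mulLeft ⟨D.g ^ D.n, Subgroup.mem_zpowers _⟩) _ _ fun c => ?_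
    rw [← mul_smul, ← grp_mul]
    rfl
  -- The invariance of `f` is known for `g ^ n` only and passes to its powers; finiteness of the
  -- order reduces integer powers to natural ones. Moreover `χ` is trivial on these powers, so they
  -- commute with `y`.
  · have h1 : ∀ c ∈ C, (∀ u : X, f (D.grp c • u) = f u) ∧ D.χ c = 1 := by
      intro c hc
      obtain ⟨i, rfl⟩ := (Subgroup.mem_zpowers_iff.mp hc)
      refine ⟨?_, by rw [map_zpow, chi_g_pow_n, one_zpow]⟩
      obtain ⟨l, hl⟩ : ∃ l : ℕ, (D.g ^ D.n) ^ i = (D.g ^ D.n) ^ l := by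
        have h2 := (isOfFinOrder_of_finite (D.g ^ D.n)).mem_powers_iff_mem_zpowers.mpr
          (⟨i, rfl⟩ : (D.g ^ D.n) ^ i ∈ Subgroup.zpowers (D.g ^ D.n))
        obtain ⟨l, hl⟩ := h2
        exact ⟨l, hl.symm⟩
      rw [hl]
      clear hl
      induction l with
      | zero => simp [grp_one]
      | succ l ih =>
        intro u
        rw [pow_succ, grp_mul, mul_smul, ih, hf]
    rw [smul_smul_comm', map_smul, Finset.smul_sum, map_sum]
    have h2 : ∀ c : C, f (D.y ^ m • D.grp c • x) = f (D.y ^ m • x) := by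
      intro c
      rw [pow_smul_y_grp, (h1 c c.2).2, Units.val_one, one_pow, one_smul, (h1 c c.2).1]
    rw [Finset.sum_congr rfl fun c _ => h2 c, Finset.sum_const, Finset.card_univ,
      ← Nat.card_eq_fintype_card, ← Nat.cast_smul_eq_nsmul k, smul_smul,
      inv_mul_cancel₀ (Nat.cast_ne_zero.mpr Nat.card_pos.ne'), one_smul]

/-- The map `ι` extends to `i : M(j,W) → X`, and an equivariant retraction of `y ^ (j-1) ∘ ι` yields
`p : X → M(j,W)`. As `M(j,W)` is a brick, `p ∘ i` is a scalar, and evaluation in the last layer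
shows that it is `1`. -/
theorem exists_iso_M_directSum_of_embedding [IsAlgClosed k] [CharZero k] {j : ℕ} (h0 : 0 < j)
    (hj : j ≤ D.n)
    (W : FDModule k (MonoidAlgebra k G)) (hW : W.ρ (of k G (D.g ^ D.n)) = 1)
    [IsSimpleModule (MonoidAlgebra k G) W] (X : FDModule k D.Alg)
    (hX : ∀ x : X, D.grp (D.g ^ D.n) • x = x → D.y ^ j • x = 0) (ι : W →ₗ[k] X)
    (hι : ∀ h w, ι (W.ρ (of k G h) w) = D.grp h • ι w)
    (hinj : Function.Injective fun w => D.y ^ (j - 1) • ι w) :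
    ∃ Z : FDModule k D.Alg, Iso X ((D.M j hj W hW).directSum Z) := by
  -- The map `y ^ (j-1) ∘ ι` is equivariant only after twisting `W` by `χ ^ (-(j-1))`.
  let σ : G →* Module.End k W :=
    { toFun := fun h => (((D.χ h)⁻¹ : kˣ) : k) ^ (j - 1) • W.ρ (of k G h)
      map_one' := by rw [map_one, inv_one, Units.val_one, one_pow, one_smul, map_one, map_one]
      map_mul' := fun h h' => by
        simp only [map_mul, mul_inv, Units.val_mul, mul_pow, smul_mul_smul_comm] }
  have hσ : ∀ h w, σ h w = (((D.χ h)⁻¹ : kˣ) : k) ^ (j - 1) • W.ρ (of k G h) w := fun _ _ => rfl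
  have hfix : ∀ w, W.ρ (of k G (D.g ^ D.n)) w = w := fun w => LinearMap.congr_fun hW w
  obtain ⟨f, hf, hfι⟩ := exists_equivariant_retraction σ (D.grpEnd X)
    (Algebra.lsmul k k X (D.y ^ (j - 1)) ∘ₗ ι) (fun h w => by
      simp only [LinearMap.comp_apply, Algebra.lsmul_coe, grpEnd_apply]
      rw [hσ, map_smul, hι, grp_smul_pow_y, smul_smul_comm']) hinj
  have hfι' : ∀ w, f (D.y ^ (j - 1) • ι w) = w := hfι
  have hf' : ∀ h x, f (D.grp h • x) =
    (((D.χ h)⁻¹ : kˣ) : k) ^ (j - 1) • W.ρ (of k G h) (f x) := hf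
  -- By hypothesis `y ^ j` kills just the vectors fixed by `g ^ n`; since `f` is invariant under `g
  -- ^ n`, a general `x` may be replaced by its average.
  have hfy : ∀ x, f (D.y ^ j • x) = 0 := by
    intro x
    obtain ⟨x₀, h1, h2⟩ := D.exists_fixed_average X j x
    rw [← h2 f fun u => by rw [hf', chi_g_pow_n, inv_one, Units.val_one, one_pow, one_smul, hfix],
      hX x₀ h1, map_zero]
  let i := D.homOfM hj W hW ι hι fun w => hX _ (by rw [← hι, hfix])
  let p := D.homToM hj W hW f hf' hfy
  obtain ⟨c, hc⟩ := (D.M_isBrick hj W hW h0).2 (p ∘ₗ i)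
  have := IsSimpleModule.nontrivial (MonoidAlgebra k G) W
  obtain ⟨w, hw⟩ := exists_ne (0 : W)
  have hl : j - 1 < j := by omega
  have h1 : D.MEquiv hj W hW (p (i (D.MSingle hj W hW ⟨j - 1, hl⟩ w))) ⟨j - 1, hl⟩ = w := by
    rw [D.homOfM_MSingle, D.MEquiv_homToM]
    simp only [Nat.sub_self, pow_zero, one_smul]
    exact hfι' w
  have h2 := hc (D.MSingle hj W hW ⟨j - 1, hl⟩ w)
  rw [LinearMap.comp_apply] at h2
  rw [h2, map_smul, Pi.smul_apply, MEquiv_MSingle, if_pos rfl] at h1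
  have hc1 : c = 1 := by
    by_contra hc1
    have h3 : (c - 1) • w = 0 := by rw [sub_smul, h1, one_smul, sub_self]
    exact (smul_eq_zero.mp h3).elim (fun h => hc1 (sub_eq_zero.mp h)) hw
  refine exists_iso_directSum_of_retract i p (LinearMap.ext fun v => ?_)
  rw [hc, hc1, one_smul, LinearMap.id_apply]

/-- The length `j` is the least exponent for which `y ^ j` kills all vectors fixed by `g ^ n`.
Minimality and semisimplicity of `kG` give a simple subrepresentation of the fixed vectors on which
`y ^ (j-1)` is not zero, hence injective. -/
theorem exists_iso_M_directSum [IsAlgClosed k] [CharZero k] (hV : IsCompleteSetOfSimples V)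
    (X : FDModule k D.Alg) {x : X} (hx0 : x ≠ 0) (hx : D.grp (D.g ^ D.n) • x = x) :
    ∃ (j : ℕ) (hj : j ≤ D.n) (_ : 0 < j) (i : Ω) (hi : (V i).ρ (of k G (D.g ^ D.n)) = 1)
      (Z : FDModule k D.Alg), Iso X ((D.M j hj (V i) hi).directSum Z) := by
  classical
  let e := D.resEquiv X
  let N := repSubmodule (W := D.res X)
    (LinearMap.ker (D.grpEnd X (D.g ^ D.n) - 1) |>.comap e.toLinearMap) (by
      intro h x hx
      rw [Submodule.mem_comap, LinearMap.mem_ker, LinearMap.sub_apply, sub_eq_zero] at hx ⊢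
      simp only [LinearEquiv.coe_coe, grpEnd_apply, Module.End.one_apply] at hx ⊢
      rw [D.resEquiv_ρ, ← mul_smul, ← grp_mul,
        ← Subgroup.mem_center_iff.mp (pow_mem D.g_mem_center D.n) h, grp_mul, mul_smul, hx])
  have hN : ∀ x, x ∈ N ↔ D.grp (D.g ^ D.n) • e x = e x := fun x => by
    change D.grp (D.g ^ D.n) • e x - e x = 0 ↔ _
    rw [sub_eq_zero]
  have hex : ∃ j : ℕ, ∀ x : X, D.grp (D.g ^ D.n) • x = x → D.y ^ j • x = 0 :=
    ⟨D.n, fun x hx => by rw [pow_n_smul, hx, sub_self, smul_zero]⟩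
  have hjn : Nat.find hex ≤ D.n := Nat.find_le fun x hx => by
    rw [pow_n_smul, hx, sub_self, smul_zero]
  have hjs := Nat.find_spec hex
  have hj0 : 0 < Nat.find hex := Nat.pos_of_ne_zero fun h => by
    rw [h] at hjs
    have := hjs x hx
    rw [pow_zero, one_smul] at this
    exact hx0 this
  have hjm := Nat.find_min hex (Nat.sub_lt hj0 one_pos)
  generalize Nat.find hex = j at hjn hjs hj0 hjm
  let K := repSubmodule (W := D.res X)
    (LinearMap.ker (Algebra.lsmul k k X (D.y ^ (j - 1))) |>.comap e.toLinearMap) (by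
      intro h x hx
      rw [Submodule.mem_comap, LinearMap.mem_ker] at hx ⊢
      simp only [LinearEquiv.coe_coe, Algebra.lsmul_coe] at hx ⊢
      rw [D.resEquiv_ρ, pow_smul_y_grp, hx, smul_zero, smul_zero])
  have hK : ∀ x, x ∈ K ↔ D.y ^ (j - 1) • e x = 0 := fun x => Iff.rfl
  -- Maschke's theorem needs this: the fixed vectors `N` are then the sum of their simple
  -- submodules, so not all of these can lie in the kernel `K` of `y ^ (j-1)`.
  have hcard : NeZero (Nat.card G : k) := ⟨Nat.cast_ne_zero.mpr Nat.card_pos.ne'⟩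
  obtain ⟨S, ⟨hS, hSN⟩, hSK⟩ : ∃ S ∈ {m : Submodule (MonoidAlgebra k G) (D.res X) |
      IsSimpleModule (MonoidAlgebra k G) m ∧ m ≤ N}, ¬ S ≤ K := by
    by_contra! hall
    have h1 : N ≤ K := by
      rw [← IsSemisimpleModule.sSup_simples_le N]
      exact sSup_le hall
    refine hjm fun x hx => ?_
    have h2 := (hK (e.symm x)).mp (h1 ((hN _).mpr (by rw [e.apply_symm_apply, hx])))
    rwa [e.apply_symm_apply] at h2
  have : Module.Finite k S := Module.Finite.of_injective (S.subtype.restrictScalars k)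
    S.subtype_injective
  have hS' : IsSimpleModule (MonoidAlgebra k G) (FDModule.of k (MonoidAlgebra k G) S) :=
    IsSimpleModule.congr (ofEquiv S)
  obtain ⟨i, ⟨φ⟩⟩ := hV.2.2 _ hS'
  have := hV.1 i
  let ψ : V i ≃ₗ[MonoidAlgebra k G] S := φ.symm.trans (ofEquiv S)
  let ι : V i →ₗ[k] X := e.toLinearMap ∘ₗ (S.subtype ∘ₗ ψ.toLinearMap).restrictScalars k
  have hιe : ∀ w, ι w = e (ψ w) := fun _ => rfl
  have hι : ∀ h w, ι ((V i).ρ (of k G h) w) = D.grp h • ι w := by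
    intro h w
    rw [hιe, hιe, ← D.resEquiv_ρ, ← smul_def, map_smul, ← smul_def]
    rfl
  have hιinj : Function.Injective ι :=
    e.injective.comp (S.subtype_injective.comp ψ.injective)
  have hfix : ∀ w, D.grp (D.g ^ D.n) • ι w = ι w := fun w => (hN _).mp (hSN (ψ w).2)
  have hi : (V i).ρ (of k G (D.g ^ D.n)) = 1 := LinearMap.ext fun w => hιinj <| by
    rw [hι, hfix, Module.End.one_apply]
  -- The kernel is `G`-stable because `y` commutes with `G` up to scalars, so it is zero or
  -- everything; the latter would put `S` inside `K`.
  have hκ : Function.Injective fun w => D.y ^ (j - 1) • ι w := by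
    let L := repSubmodule (W := V i) (LinearMap.ker (Algebra.lsmul k k X (D.y ^ (j - 1)) ∘ₗ ι)) (by
      intro h w hw
      rw [LinearMap.mem_ker, LinearMap.comp_apply] at hw ⊢
      simp only [Algebra.lsmul_coe] at hw ⊢
      rw [hι, pow_smul_y_grp, hw, smul_zero, smul_zero])
    have hL : ∀ w, w ∈ L ↔ D.y ^ (j - 1) • ι w = 0 := fun w => Iff.rfl
    rcases eq_bot_or_eq_top L with h | h
    · refine (injective_iff_map_eq_zero (Algebra.lsmul k k X (D.y ^ (j - 1)) ∘ₗ ι)).mpr fun w hw => ?_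
      have h1 : w ∈ L := (hL w).mpr hw
      rwa [h, Submodule.mem_bot] at h1
    · refine absurd (fun s hs => ?_) hSK
      have h1 : ψ.symm ⟨s, hs⟩ ∈ L := h ▸ Submodule.mem_top
      rw [hL, hιe, ψ.apply_symm_apply] at h1
      exact (hK s).mpr h1
  obtain ⟨Z, hZ⟩ := D.exists_iso_M_directSum_of_embedding hj0 hjn (V i) hi X hjs ι hι hκ
  exact ⟨j, hjn, hj0, i, hi, Z, hZ⟩

/-! ### Classification of the non-projective indecomposable modules. -/

theorem mu_ne_zero (hD : D.IsNonNilpotent) : D.μ ≠ 0 := fun h => hD.1 (by rw [h, zero_smul])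

theorem stableM_isBrick [IsAlgClosed k] (hV : IsCompleteSetOfSimples V) (p : D.StableIndex V) :
    (D.stableM V p).IsBrick :=
  have := hV.1 p.1.2
  D.M_isBrick p.2.1.2.le (V p.1.2) p.2.2 p.2.1.1

theorem pow_smul_stableM (p : D.StableIndex V) (x : D.stableM V p) : D.y ^ (D.n - 1) • x = 0 :=
  D.M_pow_smul_eq_zero p.2.1.2.le (V p.1.2) p.2.2 (Nat.le_sub_one_of_lt p.2.1.2) x

variable {D}

theorem stableM_not_isProjective [IsAlgClosed k] [CharZero k] (hD : D.IsNonNilpotent)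
    (hV : IsCompleteSetOfSimples V) (p : D.StableIndex V) : ¬ (D.stableM V p).IsProjective :=
  have := (D.stableM_isBrick hV p).1
  D.not_isProjective_of_pow_smul_eq_zero hD.2 _ (D.pow_smul_stableM p)

/-- As long as `g ^ n` has a nonzero fixed vector, some `M(j,i)` splits off: either `j < n`, or a
projective summand is removed and the dimension drops. Without fixed vectors `y ^ n = μ (g ^ n - 1)`
is injective, hence bijective, and the module is projective. -/
theorem isProjective_or_iso_directSum [IsAlgClosed k] [CharZero k] (hD : D.IsNonNilpotent)
    (hV : IsCompleteSetOfSimples V) (X : FDModule k D.Alg) :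
    X.IsProjective ∨ ∃ (p : D.StableIndex V) (Z : FDModule k D.Alg),
      Iso X ((D.stableM V p).directSum Z) := by
  induction hr : Module.finrank k X using Nat.strong_induction_on generalizing X with
  | _ r ih =>
    by_cases hx : ∃ x : X, x ≠ 0 ∧ D.grp (D.g ^ D.n) • x = x
    · obtain ⟨x, hx0, hx⟩ := hx
      obtain ⟨j, hj, hj0, i, hi, Z, hZ⟩ := D.exists_iso_M_directSum hV X hx0 hx
      rcases hj.lt_or_eq with hlt | rfl
      · exact .inr ⟨⟨(j, i), ⟨hj0, hlt⟩, hi⟩, Z, hZ⟩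
      · have := hV.1 i
        have := IsSimpleModule.nontrivial (MonoidAlgebra k G) (V i)
        have := D.M_nontrivial hj (V i) hi hj0
        have hP := D.M_n_isProjective (V i) hi hD.2
        have hlt : Module.finrank k Z < r := by
          rw [← hr, hZ.finrank_eq, finrank_directSum]
          exact Nat.lt_add_of_pos_left Module.finrank_pos
        rcases ih _ hlt Z rfl with h | ⟨p, Z', hZ'⟩
        · exact .inl (hZ.symm.isProjective (hP.directSum h))
        · exact .inr ⟨p, _, hZ.trans ((directSum_congr (Iso.refl _) hZ').trans
            (directSum_left_comm _ _ _))⟩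
    · left
      push Not at hx
      have hinj : Function.Injective (Algebra.lsmul k k X (D.y ^ D.n)) := by
        refine (injective_iff_map_eq_zero _).mpr fun x h => ?_
        simp only [Algebra.lsmul_coe] at h
        rw [pow_n_smul] at h
        by_contra hx0
        exact hx x hx0 (sub_eq_zero.mp ((smul_eq_zero.mp h).resolve_left (D.mu_ne_zero hD)))
      exact D.isProjective_of_bijective hD.2 X
        ⟨hinj, (LinearMap.injective_iff_surjective (f := Algebra.lsmul k k X (D.y ^ D.n))).mp hinj⟩

theorem exists_iso_stableM [IsAlgClosed k] [CharZero k] (hD : D.IsNonNilpotent)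
    (hV : IsCompleteSetOfSimples V) {X : FDModule k D.Alg} (hX : X.IsIndecomposable)
    (hP : ¬ X.IsProjective) : ∃ p, Iso X (D.stableM V p) := by
  obtain ⟨p, Z, hZ⟩ := (isProjective_or_iso_directSum hD hV X).resolve_left hP
  have := (D.stableM_isBrick hV p).1
  exact ⟨p, hX.iso_of_iso_directSum hZ⟩

theorem stableM_injective (hV : IsCompleteSetOfSimples V) {p q : D.StableIndex V}
    (h : Iso (D.stableM V p) (D.stableM V q)) : p = q := by
  obtain ⟨⟨j, i⟩, ⟨hj0, hj⟩, hi⟩ := p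
  obtain ⟨⟨j', i'⟩, ⟨hj0', hj'⟩, hi'⟩ := q
  have h1 := hV.1 i
  have h2 := hV.1 i'
  have := IsSimpleModule.nontrivial (MonoidAlgebra k G) (V i)
  have := IsSimpleModule.nontrivial (MonoidAlgebra k G) (V i')
  have hjj : j = j' := le_antisymm (D.le_of_M_iso hj.le hi hj'.le hi' h)
    (D.le_of_M_iso hj'.le hi' hj.le hi h.symm)
  subst hjj
  have := hV.2.1 i i' (D.iso_of_M_iso hj.le hi hj0 hi' h)
  subst this
  rfl

end GroupDatum

/-! ### Duals -/

namespace FDModule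

section Iso

variable {k : Type u} [Field k] {A : Type v} [Ring A] [Algebra k A]

theorem iso_of_injective {X Y : FDModule k A} (f : X →ₗ[A] Y) (hf : Function.Injective f)
    (h : Module.finrank k X = Module.finrank k Y) : Iso X Y :=
  ⟨LinearEquiv.ofBijective f ⟨hf, (LinearMap.injective_iff_surjective_of_finrank_eq_finrank h
    (f := f.restrictScalars k)).mp hf⟩⟩

end Iso

variable {k : Type u} [Field k] {A : Type v} [Ring A] [HopfAlgebra k A]

/-- The identity map, with the underlying space of the dual module as its source. -/
noncomputable def dualEquiv (X : FDModule k A) : dual X ≃ₗ[k] Module.Dual k X :=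
  LinearEquiv.refl k (Module.Dual k X)

theorem dualEquiv_smul (X : FDModule k A) (a : A) (f : dual X) (x : X) :
    dualEquiv X (a • f) x = dualEquiv X f (HopfAlgebra.antipode k a • x) := rfl

theorem dual_ext {X : FDModule k A} {f f' : dual X}
    (h : ∀ x, dualEquiv X f x = dualEquiv X f' x) : f = f' :=
  (dualEquiv X).injective (LinearMap.ext h)

theorem finrank_dual (X : FDModule k A) : Module.finrank k (dual X) = Module.finrank k X :=
  (dualEquiv X).finrank_eq.trans Subspace.dual_finrank_eq

theorem dual_nontrivial (X : FDModule k A) [Nontrivial X] : Nontrivial (dual X) :=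
  Module.nontrivial_of_finrank_pos (R := k) (by rw [finrank_dual]; exact Module.finrank_pos)

variable {X Y Z : FDModule k A}

/-- The transpose of a homomorphism. -/
noncomputable def dualMap (f : X →ₗ[A] Y) : dual Y →ₗ[A] dual X where
  toFun φ := (dualEquiv X).symm (dualEquiv Y φ ∘ₗ f.restrictScalars k)
  map_add' φ φ' := dual_ext fun x => by simp
  map_smul' a φ := dual_ext fun x => by simp [dualEquiv_smul]

@[simp] theorem dualMap_apply (f : X →ₗ[A] Y) (φ : dual Y) (x : X) :
    dualEquiv X (dualMap f φ) x = dualEquiv Y φ (f x) := rfl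

theorem dualMap_comp (f : X →ₗ[A] Y) (f' : Y →ₗ[A] Z) :
    dualMap f ∘ₗ dualMap f' = dualMap (f' ∘ₗ f) := rfl

theorem dualMap_id : dualMap (LinearMap.id : X →ₗ[A] X) = LinearMap.id := rfl

theorem dualMap_zero : dualMap (0 : X →ₗ[A] Y) = 0 :=
  LinearMap.ext fun φ => dual_ext fun x => by simp

theorem dualMap_add (f f' : X →ₗ[A] Y) : dualMap (f + f') = dualMap f + dualMap f' :=
  LinearMap.ext fun φ => dual_ext fun x => by simp

theorem Iso.dual (h : Iso X Y) : Iso (dual X) (dual Y) := by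
  obtain ⟨e⟩ := h
  refine ⟨LinearEquiv.ofLinearMap (dualMap e.symm.toLinearMap) (dualMap e.toLinearMap) ?_ ?_⟩
  · rw [dualMap_comp, LinearEquiv.comp_symm, dualMap_id]
  · rw [dualMap_comp, LinearEquiv.symm_comp, dualMap_id]

theorem dual_directSum (X Y : FDModule k A) :
    Iso (FDModule.dual (X.directSum Y)) ((FDModule.dual X).directSum (FDModule.dual Y)) := by
  refine iso_directSum (dualMap (fst X Y)) (dualMap (snd X Y)) (dualMap (inl X Y))
    (dualMap (inr X Y)) ?_ ?_ ?_ ?_ ?_ <;>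
  simp only [dualMap_comp]
  · rw [fst_inl, dualMap_id]
  · rw [snd_inr, dualMap_id]
  · rw [snd_inl, dualMap_zero]
  · rw [fst_inr, dualMap_zero]
  · rw [← dualMap_add, inl_fst_add_inr_snd, dualMap_id]

end FDModule

/-! ### Duality for modules over the Hopf algebra of a group datum. -/

namespace GroupDatum

open FDModule MonoidAlgebra

variable {k : Type u} [Field k] {G : Type v} [Group G] [Finite G] (D : GroupDatum k G)

theorem dualEquiv_y (X : FDModule k D.Alg) (f : dual X) (x : X) :
    dualEquiv X (D.y • f) x = -dualEquiv X f (D.y • D.grp D.g⁻¹ • x) := by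
  have h : HopfAlgebra.antipode k D.y = -(D.y * D.grp D.g⁻¹) := D.antipodeLin_y
  rw [dualEquiv_smul, h, neg_smul, map_neg, mul_smul]

theorem dualEquiv_grp (X : FDModule k D.Alg) (h : G) (f : dual X) (x : X) :
    dualEquiv X (D.grp h • f) x = dualEquiv X f (D.grp h⁻¹ • x) := by
  have h : HopfAlgebra.antipode k (D.grp h) = D.grp h⁻¹ := D.antipodeLin_grp h
  rw [dualEquiv_smul, h]

theorem dual_pow_smul_eq_zero (X : FDModule k D.Alg) {m : ℕ} (hX : ∀ x : X, D.y ^ m • x = 0)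
    (f : dual X) : D.y ^ m • f = 0 := by
  -- The antipode sends `y ^ m` to a scalar multiple of `y ^ m g^(-m)`; the value of the scalar is
  -- irrelevant here.
  have key : ∀ m : ℕ, ∃ c : k, ∀ (f : dual X) (x : X), dualEquiv X (D.y ^ m • f) x =
      c * dualEquiv X f (D.y ^ m • D.grp (D.g⁻¹ ^ m) • x) := by
    intro m
    induction m with
    | zero => exact ⟨1, fun f x => by simp [grp_one]⟩
    | succ m ih =>
      obtain ⟨c, hc⟩ := ih
      refine ⟨-(c * (((D.χ (D.g⁻¹ ^ m))⁻¹ : kˣ) : k)), fun f x => ?_⟩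
      have h1 := D.grp_smul_pow_y (D.g⁻¹ ^ m) 1 (D.grp D.g⁻¹ • x)
      rw [pow_one, pow_one] at h1
      rw [pow_succ', mul_smul, dualEquiv_y, hc, h1, ← mul_smul (D.grp (D.g⁻¹ ^ m)), ← grp_mul,
        ← pow_succ, smul_smul_comm', map_smul, smul_eq_mul, ← mul_smul, ← pow_succ, pow_succ' D.y]
      ring
  obtain ⟨c, hc⟩ := key m
  refine dual_ext fun x => ?_
  rw [hc, hX, map_zero, map_zero, mul_zero, LinearMap.zero_apply]

/-- Since `S²` is conjugation by `g`, evaluation at `g x`, rather than at `x`, is `H`-linear in `x`.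
-/
theorem iso_dual_dual (X : FDModule k D.Alg) : Iso X (dual (dual X)) := by
  let θ : X →ₗ[k] dual (dual X) := (dualEquiv (dual X)).symm.toLinearMap ∘ₗ
    (dualEquiv X).dualMap.toLinearMap ∘ₗ Module.Dual.eval k X ∘ₗ D.grpEnd X D.g
  have hθ : ∀ x f, dualEquiv (dual X) (θ x) f = dualEquiv X f (D.grp D.g • x) := fun x f => rfl
  refine iso_of_injective (D.mkHom θ (fun x => dual_ext fun f => ?_)
    fun h x => dual_ext fun f => ?_) ?_ (by rw [finrank_dual, finrank_dual])
  · rw [dualEquiv_y, hθ, hθ, dualEquiv_y, neg_neg, dualEquiv_grp, ← mul_smul (D.grp D.g⁻¹),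
      grp_inv_mul, one_smul, inv_inv]
  · rw [dualEquiv_grp, hθ, hθ, dualEquiv_grp, inv_inv, ← mul_smul, ← grp_mul, ← mul_smul,
      ← grp_mul, Subgroup.mem_center_iff.mp D.g_mem_center h]
  · refine (injective_iff_map_eq_zero θ).mpr fun x hx => ?_
    have h1 : D.grp D.g • x = 0 := by
      refine (Module.forall_dual_apply_eq_zero_iff k _).mp fun f => ?_
      have h2 := hθ x ((dualEquiv X).symm f)
      rw [LinearEquiv.apply_symm_apply, hx, map_zero, LinearMap.zero_apply] at h2
      exact h2.symm
    rw [← one_smul D.Alg x, ← D.grp_inv_mul D.g, mul_smul, h1, smul_zero]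

/-- The factors are exchanged because the antipode reverses the comultiplication. -/
theorem dual_tensor (X Y : FDModule k D.Alg) :
    Iso (dual (tensor X Y)) (tensor (dual Y) (dual X)) := by
  let E : tensor (dual Y) (dual X) ≃ₗ[k] dual (tensor X Y) :=
    tensorEquiv (dual Y) (dual X) ≪≫ₗ TensorProduct.congr (dualEquiv Y) (dualEquiv X) ≪≫ₗ
      TensorProduct.comm k _ _ ≪≫ₗ TensorProduct.dualDistribEquiv k X Y ≪≫ₗ
      (tensorEquiv X Y).dualMap ≪≫ₗ (dualEquiv (tensor X Y)).symm
  have hE : ∀ f f' x y, dualEquiv (tensor X Y) (E (tmul (dual Y) (dual X) f f')) (tmul X Y x y) =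
      dualEquiv X f' x * dualEquiv Y f y := fun f f' x y => rfl
  have hext : ∀ {φ ψ : dual (tensor X Y)}, (∀ x y, dualEquiv (tensor X Y) φ (tmul X Y x y) =
      dualEquiv (tensor X Y) ψ (tmul X Y x y)) → φ = ψ := fun h =>
    dual_ext (tensor_induction h fun s t hs ht => by rw [map_add, map_add, hs, ht])
  refine Iso.symm (Iso.of_equiv E fun a t => ?_)
  refine (D.mkHom (E := tensor (dual Y) (dual X)) (F := dual (tensor X Y)) E.toLinearMap
    ?_ ?_).map_smul a t
  · refine tensor_induction (fun f f' => hext fun x y => ?_) fun s t hs ht => ?_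
    · rw [LinearEquiv.coe_coe, y_tmul, map_add, map_add, LinearMap.add_apply, hE, hE, dualEquiv_y,
        dualEquiv_y, dualEquiv_y, dualEquiv_grp, grp_tmul, y_tmul, map_add, hE, hE,
        ← mul_smul (D.grp D.g), grp_mul_inv, one_smul]
      ring
    · simp only [smul_add, map_add, hs, ht]
  · intro h
    refine tensor_induction (fun f f' => hext fun x y => ?_) fun s t hs ht => ?_
    · rw [LinearEquiv.coe_coe, grp_tmul, hE, dualEquiv_grp, dualEquiv_grp, dualEquiv_grp, grp_tmul,
        hE]
    · simp only [smul_add, map_add, hs, ht]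

variable {D}

/-- The transpose of an endomorphism of the dual acts on the double dual, which is isomorphic to
`M`, so it is a scalar; functionals separate points. -/
theorem dual_isBrick {M : FDModule k D.Alg} (hM : M.IsBrick) : (dual M).IsBrick := by
  have := hM.1
  refine ⟨dual_nontrivial M, fun f => ?_⟩
  obtain ⟨c, hc⟩ := (hM.of_iso (D.iso_dual_dual M)).2 (dualMap f)
  refine ⟨c, fun φ => ?_⟩
  rw [← sub_eq_zero]
  refine (Module.forall_dual_apply_eq_zero_iff k _).mp fun ξ => ?_
  have h1 := dualMap_apply f ((dualEquiv (dual M)).symm ξ) φ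
  rw [hc, map_smul, LinearMap.smul_apply, LinearEquiv.apply_symm_apply] at h1
  rw [map_sub, map_smul, h1, sub_self]

variable {Ω : Type w} {V : Ω → FDModule k (MonoidAlgebra k G)}

theorem dual_stableM_not_isProjective [IsAlgClosed k] [CharZero k] (hD : D.IsNonNilpotent)
    (hV : IsCompleteSetOfSimples V) (p : D.StableIndex V) :
    ¬ (dual (D.stableM V p)).IsProjective :=
  have := (dual_isBrick (D.stableM_isBrick hV p)).1
  D.not_isProjective_of_pow_smul_eq_zero hD.2 _
    (D.dual_pow_smul_eq_zero _ (D.pow_smul_stableM p))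

theorem exists_dual_iso_stableM [IsAlgClosed k] [CharZero k] (hD : D.IsNonNilpotent)
    (hV : IsCompleteSetOfSimples V) (p : D.StableIndex V) :
    ∃ q, Iso (dual (D.stableM V p)) (D.stableM V q) :=
  exists_iso_stableM hD hV (dual_isBrick (D.stableM_isBrick hV p)).isIndecomposable
    (dual_stableM_not_isProjective hD hV p)

/-- Otherwise some `M(q)` is a summand of the dual of `P`. Dualizing again, the dual of `M(q)` is a
summand of `P`, yet it is not projective, being killed by `y ^ (n-1)`. -/
theorem dual_isProjective [IsAlgClosed k] [CharZero k] (hD : D.IsNonNilpotent)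
    (hV : IsCompleteSetOfSimples V) {P : FDModule k D.Alg} (hP : P.IsProjective) :
    (dual P).IsProjective := by
  refine (isProjective_or_iso_directSum hD hV (dual P)).resolve_right ?_
  rintro ⟨q, Z, hZ⟩
  obtain ⟨e⟩ := (D.iso_dual_dual P).trans (hZ.dual.trans (dual_directSum _ _))
  refine dual_stableM_not_isProjective hD hV q
    (isProjective_of_retract (e.symm.toLinearMap ∘ₗ inl _ _) (fst _ _ ∘ₗ e.toLinearMap) ?_ hP)
  ext x
  simpa using LinearMap.congr_fun (fst_inl (dual (D.stableM V q)) (dual Z)) x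

/-! ### The trivial module -/

variable (D)

/-- The identity map, with the trivial module as its source. -/
noncomputable def trivialEquiv : trivial k D.Alg ≃ₗ[k] k := LinearEquiv.refl k k

theorem y_smul_trivial (u : trivial k D.Alg) : D.y • u = 0 := by
  have h : Bialgebra.counitAlgHom k D.Alg D.y = 0 := D.counitHom_y
  change Algebra.lsmul k k k (Bialgebra.counitAlgHom k D.Alg D.y) u = _
  rw [h, map_zero]
  rfl

theorem grp_smul_trivial (h : G) (u : trivial k D.Alg) : D.grp h • u = u := by
  have h1 : Bialgebra.counitAlgHom k D.Alg (D.grp h) = 1 := D.counitHom_grp h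
  change Algebra.lsmul k k k (Bialgebra.counitAlgHom k D.Alg (D.grp h)) u = _
  rw [h1, map_one]
  rfl

theorem trivial_eq_smul (u : trivial k D.Alg) :
    u = D.trivialEquiv u • D.trivialEquiv.symm 1 := by
  rw [← map_smul, smul_eq_mul, mul_one, LinearEquiv.symm_apply_apply]

theorem trivial_isBrick : (trivial k D.Alg).IsBrick := by
  refine ⟨D.trivialEquiv.toEquiv.nontrivial, fun f =>
    ⟨D.trivialEquiv (f (D.trivialEquiv.symm 1)), fun u => ?_⟩⟩
  conv_lhs => rw [D.trivial_eq_smul u, LinearMap.map_smul_of_tower,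
    D.trivial_eq_smul (f (D.trivialEquiv.symm 1)), smul_comm, ← D.trivial_eq_smul u]

/-- Here `2 ≤ n` is essential: it makes `y ^ (n-1)` act as zero on the trivial module, which is
therefore not projective. -/
theorem exists_trivial_iso_stableM [IsAlgClosed k] [CharZero k] (hD : D.IsNonNilpotent)
    (hn : 2 ≤ D.n) (hV : IsCompleteSetOfSimples V) :
    ∃ p, Iso (trivial k D.Alg) (D.stableM V p) := by
  have := D.trivial_isBrick.1
  refine exists_iso_stableM hD hV D.trivial_isBrick.isIndecomposable
    (D.not_isProjective_of_pow_smul_eq_zero hD.2 _ fun u => ?_)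
  rw [show D.n - 1 = D.n - 2 + 1 by omega, pow_succ, mul_smul, y_smul_trivial, smul_zero]

end GroupDatum

namespace GroupDatum

open FDModule MonoidAlgebra

variable {k : Type u} [Field k] {G : Type v} [Group G] [Finite G] (D : GroupDatum k G)

/-! ### Invariants of tensor products -/

section Invariants

variable (X Y : FDModule k D.Alg)

/-- The contraction `(f, x ⊗ z) ↦ f(x) z`. -/
noncomputable def contr : dual X →ₗ[k] tensor X Y →ₗ[k] Y where
  toFun f := tensorLift (LinearMap.lsmul k Y ∘ₗ dualEquiv X f)
  map_add' f f' := LinearMap.ext (tensor_induction (fun x z => by simp [LinearMap.add_apply])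
    fun s t hs ht => ((LinearMap.map_add _ s t).trans (congrArg₂ (· + ·) hs ht)).trans
      (LinearMap.map_add _ s t).symm)
  map_smul' c f := LinearMap.ext (tensor_induction (fun x z => by simp [mul_smul])
    fun s t hs ht => ((LinearMap.map_add _ s t).trans (congrArg₂ (· + ·) hs ht)).trans
      (LinearMap.map_add _ s t).symm)

theorem contr_tmul (f : dual X) (x : X) (z : Y) :
    D.contr X Y f (tmul X Y x z) = dualEquiv X f x • z :=
  tensorLift_tmul _ x z

theorem contr_grp (h : G) (f : dual X) (t : tensor X Y) :
    D.contr X Y (D.grp h • f) t = D.grp h • D.contr X Y f (D.grp h⁻¹ • t) := by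
  induction t using tensor_induction with
  | htmul x z =>
    rw [contr_tmul, grp_tmul, contr_tmul, dualEquiv_grp, smul_smul_comm', ← mul_smul, grp_mul_inv,
      one_smul]
  | hadd s t hs ht => rw [map_add, hs, ht, smul_add, map_add, smul_add]

theorem contr_y (f : dual X) (t : tensor X Y) : D.contr X Y (D.y • f) t =
    D.y • D.contr X Y f (D.grp D.g⁻¹ • t) - D.contr X Y f (D.y • D.grp D.g⁻¹ • t) := by
  induction t using tensor_induction with
  | htmul x z =>
    rw [contr_tmul, grp_tmul, y_tmul, map_add, contr_tmul, contr_tmul, contr_tmul, dualEquiv_y,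
      smul_smul_comm', ← mul_smul (D.grp D.g), grp_mul_inv, one_smul, neg_smul]
    abel
  | hadd s t hs ht =>
    simp only [map_add, hs, ht, smul_add]
    abel

theorem sum_tmul_contr {ι : Type*} [Fintype ι] [DecidableEq ι] (b : Module.Basis ι k X)
    (t : tensor X Y) :
    ∑ i, tmul X Y (b i) (D.contr X Y ((dualEquiv X).symm (b.coord i)) t) = t := by
  induction t using tensor_induction with
  | htmul x z =>
    simp only [contr_tmul, LinearEquiv.apply_symm_apply, map_smul]
    conv_rhs => rw [← b.sum_repr x, map_sum, LinearMap.sum_apply]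
    simp only [map_smul, LinearMap.smul_apply, Module.Basis.coord_apply]
  | hadd s t hs ht => simp only [map_add, Finset.sum_add_distrib, hs, ht]

theorem contr_injective {t t' : tensor X Y} (h : ∀ f, D.contr X Y f t = D.contr X Y f t') :
    t = t' := by
  classical
  rw [← D.sum_tmul_contr X Y (Module.finBasis k X) t,
    ← D.sum_tmul_contr X Y (Module.finBasis k X) t']
  simp only [h]

variable {X Y}

/-- An invariant of `X ⊗ Y` as a homomorphism from the dual of `X` to `Y`. -/
noncomputable def homOfInvariant (φ : trivial k D.Alg →ₗ[D.Alg] tensor X Y) :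
    dual X →ₗ[D.Alg] Y :=
  have hg : ∀ h, D.grp h • φ (D.trivialEquiv.symm 1) = φ (D.trivialEquiv.symm 1) := fun h => by
    rw [← map_smul, grp_smul_trivial]
  have hy : D.y • φ (D.trivialEquiv.symm 1) = 0 := by
    rw [← map_smul, y_smul_trivial, map_zero]
  D.mkHom ((D.contr X Y).flip (φ (D.trivialEquiv.symm 1)))
    (fun f => by
      rw [LinearMap.flip_apply, contr_y, hg, hy, map_zero, sub_zero, LinearMap.flip_apply])
    (fun h f => by rw [LinearMap.flip_apply, contr_grp, hg, LinearMap.flip_apply])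

theorem homOfInvariant_apply (φ : trivial k D.Alg →ₗ[D.Alg] tensor X Y) (f : dual X) :
    D.homOfInvariant φ f = D.contr X Y f (φ (D.trivialEquiv.symm 1)) := rfl

/-- A homomorphism from `X ⊗ Y` to the trivial module as a homomorphism from `Y` to the dual
of `X`. -/
noncomputable def homOfForm (ψ : tensor X Y →ₗ[D.Alg] trivial k D.Alg) : Y →ₗ[D.Alg] dual X :=
  -- The form is evaluated at `x ⊗ g z`: the factor `g` matches the `g` in `Δ(y) = y ⊗ g + 1 ⊗ y`
  -- with the `g⁻¹` in `S(y) = -y g⁻¹`.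
  let B : Y →ₗ[k] dual X := (dualEquiv X).symm.toLinearMap ∘ₗ
    ((tmul X Y).compr₂ (D.trivialEquiv.toLinearMap ∘ₗ ψ.restrictScalars k)).flip ∘ₗ
    D.grpEnd Y D.g
  have hB : ∀ z x, dualEquiv X (B z) x = D.trivialEquiv (ψ (tmul X Y x (D.grp D.g • z))) :=
    fun _ _ => rfl
  D.mkHom B
    (fun z => dual_ext fun x => by
      have h1 : ψ (D.y • tmul X Y (D.grp D.g⁻¹ • x) z) = 0 := by rw [map_smul, y_smul_trivial]
      have h2 : ψ (tmul X Y (D.grp D.g⁻¹ • x) (D.y • z)) =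
          ψ (tmul X Y x (D.grp D.g • D.y • z)) := by
        rw [← D.grp_smul_trivial D.g (ψ _), ← map_smul, grp_tmul, ← mul_smul, grp_mul_inv, one_smul]
      rw [y_tmul, map_add, h2] at h1
      rw [hB, dualEquiv_y, hB, ← sub_eq_zero, sub_neg_eq_add, ← map_add, add_comm, h1, map_zero])
    (fun h z => dual_ext fun x => by
      rw [hB, dualEquiv_grp, hB, ← D.grp_smul_trivial h (ψ (tmul X Y (D.grp h⁻¹ • x) _)),
        ← map_smul, grp_tmul, ← mul_smul, ← mul_smul, ← mul_smul, grp_mul_inv, one_smul, ← grp_mul,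
        ← grp_mul, Subgroup.mem_center_iff.mp D.g_mem_center h])

theorem homOfForm_apply (ψ : tensor X Y →ₗ[D.Alg] trivial k D.Alg) (z : Y) (x : X) :
    dualEquiv X (D.homOfForm ψ z) x = D.trivialEquiv (ψ (tmul X Y x (D.grp D.g • z))) := rfl

/-- On a pure tensor `x ⊗ z` the endomorphism has rank one, `z' ↦ ψ(x ⊗ z') z`, and its trace is
`ψ(x ⊗ z)`. The factor `g⁻¹` undoes the twist in `homOfForm`. -/
theorem form_eq_trace (ψ : tensor X Y →ₗ[D.Alg] trivial k D.Alg) (t : tensor X Y) :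
    D.trivialEquiv (ψ t) = LinearMap.trace k Y ((D.contr X Y).flip t ∘ₗ
      (D.homOfForm ψ).restrictScalars k ∘ₗ D.grpEnd Y D.g⁻¹) := by
  induction t using tensor_induction with
  | htmul x z =>
    have h : (D.contr X Y).flip (tmul X Y x z) ∘ₗ (D.homOfForm ψ).restrictScalars k ∘ₗ
        D.grpEnd Y D.g⁻¹ =
        ((tmul X Y).compr₂ (D.trivialEquiv.toLinearMap ∘ₗ ψ.restrictScalars k) x).smulRight z := by
      refine LinearMap.ext fun z' => ?_
      simp only [LinearMap.comp_apply, LinearMap.flip_apply, LinearMap.smulRight_apply,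
        LinearMap.compr₂_apply, LinearMap.coe_restrictScalars, LinearEquiv.coe_coe, grpEnd_apply]
      rw [contr_tmul, homOfForm_apply, ← mul_smul, grp_mul_inv, one_smul]
    rw [h, LinearMap.trace_smulRight]
    rfl
  | hadd s t hs ht => rw [map_add, map_add, hs, ht, map_add, LinearMap.add_comp, map_add]

/-- This turns the multiplicity of the trivial module in a tensor product into a question about
composites `Y → X* → Y`, measured by the trace twisted by `g⁻¹`. -/
theorem pairing_trivial (φ : trivial k D.Alg →ₗ[D.Alg] tensor X Y)
    (ψ : tensor X Y →ₗ[D.Alg] trivial k D.Alg) :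
    pairing (trivial k D.Alg) (tensor X Y) φ ψ = LinearMap.trace k Y
      ((D.homOfInvariant φ ∘ₗ D.homOfForm ψ).restrictScalars k ∘ₗ D.grpEnd Y D.g⁻¹) := by
  have h1 := D.form_eq_trace ψ (φ (D.trivialEquiv.symm 1))
  refine Eq.trans ?_ h1
  have h2 : (ψ ∘ₗ φ).restrictScalars k = D.trivialEquiv.symm.toLinearMap ∘ₗ
      ((D.trivialEquiv (ψ (φ (D.trivialEquiv.symm 1)))) • LinearMap.id) ∘ₗ
        D.trivialEquiv.toLinearMap := by
    refine LinearMap.ext fun u => D.trivialEquiv.injective ?_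
    conv_lhs => rw [D.trivial_eq_smul u]
    simp [mul_comm]
  rw [pairing_apply, h2, LinearMap.trace_comp_comm', LinearMap.comp_assoc]
  simp

theorem mult_trivial_eq_zero (hX : (dual X).IsIndecomposable) (hY : Y.IsBrick)
    (h : ¬ Iso (dual X) Y) : mult (trivial k D.Alg) (tensor X Y) = 0 :=
  mult_eq_zero_of_pairing fun φ ψ => by
    have h0 : D.homOfInvariant φ ∘ₗ D.homOfForm ψ = 0 := by
      by_contra h'
      exact h (hY.iso_of_comp_ne_zero hX _ _ h')
    rw [pairing_trivial, h0, LinearMap.restrictScalars_zero, LinearMap.zero_comp, map_zero]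

/-- Invariants of `X ⊗ Y` embed into `Hom(X*, Y)`, which is a line because `Y` is a brick isomorphic
to `X*`. -/
theorem finrank_invariants_le (hY : Y.IsBrick) (e : dual X ≃ₗ[D.Alg] Y) :
    Module.finrank k (trivial k D.Alg →ₗ[D.Alg] tensor X Y) ≤ 1 := by
  let T : (trivial k D.Alg →ₗ[D.Alg] tensor X Y) →ₗ[k] (dual X →ₗ[D.Alg] Y) :=
    { toFun := D.homOfInvariant
      map_add' := fun φ φ' => LinearMap.ext fun f => by
        simp only [homOfInvariant_apply, LinearMap.add_apply, map_add]
      map_smul' := fun c φ => LinearMap.ext fun f => by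
        simp only [homOfInvariant_apply, LinearMap.smul_apply, map_smul, RingHom.id_apply] }
  have hT : Function.Injective T := by
    intro φ φ' h
    have h1 : φ (D.trivialEquiv.symm 1) = φ' (D.trivialEquiv.symm 1) :=
      D.contr_injective X Y fun f => LinearMap.congr_fun h f
    refine LinearMap.ext fun u => ?_
    rw [D.trivial_eq_smul u, LinearMap.map_smul_of_tower, LinearMap.map_smul_of_tower, h1]
  refine (LinearMap.finrank_le_finrank_of_injective hT).trans ?_
  refine finrank_le_one e.toLinearMap fun f => ?_
  obtain ⟨c, hc⟩ := hY.2 (f ∘ₗ e.symm.toLinearMap)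
  refine ⟨c, LinearMap.ext fun x => ?_⟩
  have := hc (e x)
  simpa using this.symm

/-- Coevaluation and evaluation, transported along `e : X* ≅ Y`, correspond to `e` and its inverse.
Their pairing is thus the trace of `g⁻¹` on `Y`. -/
theorem mult_trivial_eq_one (hY : Y.IsBrick) (h : Iso (dual X) Y)
    (ht : LinearMap.trace k Y (D.grpEnd Y D.g⁻¹) ≠ 0) :
    mult (trivial k D.Alg) (tensor X Y) = 1 := by
  classical
  obtain ⟨e⟩ := h
  let b := Module.finBasis k X
  -- The coevaluation element; it is characterized by `contr f t = e f`, from which its invariance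
  -- follows.
  let t : tensor X Y := ∑ i, tmul X Y (b i) (e ((dualEquiv X).symm (b.coord i)))
  have hct : ∀ f, D.contr X Y f t = e f := by
    intro f
    simp only [t, map_sum, contr_tmul]
    have h1 : f = ∑ i, dualEquiv X f (b i) • (dualEquiv X).symm (b.coord i) := by
      refine dual_ext fun x => ?_
      conv_lhs => rw [← b.sum_repr x]
      simp
    conv_rhs => rw [h1, map_sum]
    refine Finset.sum_congr rfl fun i _ => ?_
    exact ((e.toLinearMap).map_smul_of_tower _ _).symm
  have hg : ∀ h, D.grp h • t = t := by
    intro h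
    refine D.contr_injective X Y fun f => ?_
    have h1 := D.contr_grp X Y h⁻¹ f t
    rw [inv_inv, hct, map_smul] at h1
    rw [hct, ← one_smul D.Alg (D.contr X Y f (D.grp h • t)), ← D.grp_mul_inv h, mul_smul, ← h1,
      ← mul_smul, grp_mul_inv, one_smul]
  have hy : D.y • t = 0 := by
    refine D.contr_injective X Y fun f => ?_
    have h1 := D.contr_y X Y f t
    rw [hg, hct, hct, map_smul, eq_comm, sub_eq_self] at h1
    rw [h1, map_zero]
  let φ : trivial k D.Alg →ₗ[D.Alg] tensor X Y :=
    D.mkHom (LinearMap.toSpanSingleton k _ t ∘ₗ D.trivialEquiv.toLinearMap)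
      (fun u => by
        rw [y_smul_trivial, map_zero]
        simp [smul_smul_comm', hy])
      (fun h u => by
        rw [grp_smul_trivial]
        simp [smul_smul_comm', hg])
  -- The evaluation form; the `g⁻¹` cancels the `g` in `homOfForm`, so that the associated map is
  -- exactly `e.symm`.
  let c : X →ₗ[k] Y →ₗ[k] trivial k D.Alg :=
    ((dualEquiv X).toLinearMap ∘ₗ e.symm.toLinearMap.restrictScalars k ∘ₗ
      D.grpEnd Y D.g⁻¹).flip.compr₂ D.trivialEquiv.symm.toLinearMap
  have hes : ∀ (a : D.Alg) z, e.symm (a • z) = a • e.symm z := fun a z => e.symm.map_smul a z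
  have hc : ∀ x z, D.trivialEquiv (c x z) = dualEquiv X (e.symm z) (D.grp D.g • x) := by
    intro x z
    have h1 : D.trivialEquiv (c x z) = dualEquiv X (e.symm (D.grp D.g⁻¹ • z)) x := rfl
    rw [h1, hes, dualEquiv_grp, inv_inv]
  let ψ : tensor X Y →ₗ[D.Alg] trivial k D.Alg := D.tensorHomOf c
    (fun x z => D.trivialEquiv.injective <| by
      rw [y_smul_trivial, map_zero, map_add, hc, hc, hes, hes, dualEquiv_grp, dualEquiv_y,
        ← mul_smul (D.grp D.g⁻¹), ← mul_smul (D.grp D.g⁻¹), grp_inv_mul, one_smul, one_smul,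
        add_neg_cancel])
    (fun h x z => D.trivialEquiv.injective <| by
      rw [grp_smul_trivial, hc, hc, hes, dualEquiv_grp, ← mul_smul, ← mul_smul, ← grp_mul,
        ← grp_mul, mul_assoc, ← Subgroup.mem_center_iff.mp D.g_mem_center h, inv_mul_cancel_left])
  have hψ : ∀ x z, ψ (tmul X Y x z) = c x z := fun x z => D.tensorHomOf_tmul _ _ _ x z
  refine mult_eq_one (D.finrank_invariants_le hY e) (φ := φ) (ψ := ψ) ?_
  have h1 : D.homOfInvariant φ ∘ₗ D.homOfForm ψ = LinearMap.id := by
    have h2 : ∀ f, D.homOfInvariant φ f = e f := by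
      intro f
      rw [homOfInvariant_apply, ← hct]
      congr 1
      simp [φ]
    have h3 : ∀ z, D.homOfForm ψ z = e.symm z := by
      intro z
      refine dual_ext fun x => ?_
      rw [homOfForm_apply, hψ, hc, hes, dualEquiv_grp, ← mul_smul, grp_inv_mul, one_smul]
    refine LinearMap.ext fun z => ?_
    rw [LinearMap.comp_apply, h2, h3, e.apply_symm_apply, LinearMap.id_apply]
  rw [pairing_trivial, h1]
  exact ht

end Invariants

/-! ### The quantum dimension of `M(j, W)` -/

/-- On the layer `x^l W` the element `g⁻¹` acts by `q^l γ⁻¹`, so the trace is `(1 + q + ⋯ + q^(j-1))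
γ⁻¹ dim W`. The geometric sum is nonzero since `q ^ j ≠ 1` for `0 < j < n`. -/
theorem trace_g_inv_M_ne_zero [IsAlgClosed k] [CharZero k] {j : ℕ} (h0 : 0 < j) (hj : j < D.n)
    (W : FDModule k (MonoidAlgebra k G)) (hW : W.ρ (of k G (D.g ^ D.n)) = 1)
    [IsSimpleModule (MonoidAlgebra k G) W] :
    LinearMap.trace k (D.M j hj.le W hW) (D.grpEnd (D.M j hj.le W hW) D.g⁻¹) ≠ 0 := by
  obtain ⟨γ, hγ0, hγ⟩ := D.exists_scalar_g W
  have hγ' : ∀ w, W.ρ (of k G D.g⁻¹) w = γ⁻¹ • w := by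
    intro w
    have h1 : W.ρ (of k G D.g⁻¹) (W.ρ (of k G D.g) w) = w := by
      rw [← Module.End.mul_apply, ← map_mul, ← map_mul, inv_mul_cancel, map_one, map_one,
        Module.End.one_apply]
    rw [hγ, map_smul] at h1
    conv_rhs => rw [← h1]
    rw [smul_smul, inv_mul_cancel₀ hγ0, one_smul]
  let q : k := D.χ D.g
  let pr : Fin j → D.M j hj.le W hW →ₗ[k] W := fun l =>
    LinearMap.proj l ∘ₗ (D.MEquiv hj.le W hW).toLinearMap
  have hpr : ∀ l v, pr l v = D.MEquiv hj.le W hW v l := fun _ _ => rfl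
  have h1 : D.grpEnd (D.M j hj.le W hW) D.g⁻¹ =
      ∑ l : Fin j, (q ^ (l : ℕ) * γ⁻¹) • (D.MSingle hj.le W hW l ∘ₗ pr l) := by
    refine LinearMap.ext fun v => ?_
    rw [grpEnd_apply, LinearMap.sum_apply]
    conv_lhs => rw [← D.sum_MSingle hj.le W hW v, Finset.smul_sum]
    refine Finset.sum_congr rfl fun l _ => ?_
    rw [grp_MSingle, hγ', smul_smul, map_smul, map_inv, inv_inv]
    rfl
  have h2 : ∀ l, LinearMap.trace k _ (D.MSingle hj.le W hW l ∘ₗ pr l) = Module.finrank k W := by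
    intro l
    rw [LinearMap.trace_comp_comm']
    have : pr l ∘ₗ D.MSingle hj.le W hW l = LinearMap.id := LinearMap.ext fun w => by
      rw [LinearMap.comp_apply, hpr, MEquiv_MSingle, if_pos rfl, LinearMap.id_apply]
    rw [this, LinearMap.trace_id]
  have := IsSimpleModule.nontrivial (MonoidAlgebra k G) W
  have hW0 : (Module.finrank k W : k) ≠ 0 := Nat.cast_ne_zero.mpr Module.finrank_pos.ne'
  rw [h1, map_sum]
  simp only [map_smul, h2, smul_eq_mul]
  rw [← Finset.sum_mul, ← Finset.sum_mul, Fin.sum_univ_eq_sum_range (fun l => q ^ l)]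
  refine mul_ne_zero (mul_ne_zero (fun h => ?_) (inv_ne_zero hγ0)) hW0
  have h3 := geom_sum_mul q j
  rw [h, zero_mul] at h3
  exact D.isPrimitiveRoot_q.pow_ne_one_of_pos_of_lt h0.ne' hj (sub_eq_zero.mp h3.symm)

variable {D} {Ω : Type w} {V : Ω → FDModule k (MonoidAlgebra k G)}

theorem trace_g_inv_stableM_ne_zero [IsAlgClosed k] [CharZero k] (hV : IsCompleteSetOfSimples V)
    (p : D.StableIndex V) :
    LinearMap.trace k (D.stableM V p) (D.grpEnd (D.stableM V p) D.g⁻¹) ≠ 0 :=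
  have := hV.1 p.1.2
  D.trace_g_inv_M_ne_zero p.2.1.1 p.2.1.2 (V p.1.2) p.2.2

open Classical in
theorem mult_trivial_stableM [IsAlgClosed k] [CharZero k] (hV : IsCompleteSetOfSimples V)
    (p q : D.StableIndex V) : mult (trivial k D.Alg) (tensor (D.stableM V p) (D.stableM V q)) =
      if Iso (dual (D.stableM V p)) (D.stableM V q) then 1 else 0 := by
  split_ifs with h
  · exact D.mult_trivial_eq_one (D.stableM_isBrick hV q) h (trace_g_inv_stableM_ne_zero hV q)
  · exact D.mult_trivial_eq_zero (dual_isBrick (D.stableM_isBrick hV p)).isIndecomposable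
      (D.stableM_isBrick hV q) h

end GroupDatum

/-! ### Generalities on rings -/

/-- An additive map on a ring, such that `F(c a d) = F(c b d)` for all relations `a ∼ b` of a
quotient, descends to the quotient. -/
theorem RingQuot.exists_addMonoidHom {R B : Type*} [Ring R] [AddCommGroup B] (r : R → R → Prop)
    (F : R →+ B) (h : ∀ a b, r a b → ∀ c d, F (c * a * d) = F (c * b * d)) :
    ∃ E : RingQuot r →+ B, ∀ x, E (RingQuot.mkRingHom r x) = F x := by
  -- The largest ring congruence whose classes lie in fibres of `F`. It contains `r` by hypothesis,
  -- so equality in the quotient by `r` implies congruence, and `c = d = 1` recovers `F x = F y`.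
  let C : RingCon R :=
    { r := fun x y => ∀ c d, F (c * x * d) = F (c * y * d)
      iseqv := ⟨fun _ _ _ => rfl, fun h c d => (h c d).symm, fun h h' c d => (h c d).trans (h' c d)⟩
      add' := fun {w x y z} h h' c d => by
        simp only [mul_add, add_mul, map_add, h c d, h' c d]
      mul' := fun {w x y z} h h' c d => by
        have h1 := h c (y * d)
        have h2 := h' (c * x) d
        simp only [← mul_assoc] at h1 h2 ⊢
        exact h1.trans h2 }
  have hC : ∀ ⦃a b⦄, r a b → C.mk' a = C.mk' b := fun a b hab => Quotient.sound (h a b hab)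
  have hq : ∀ x y, RingQuot.mkRingHom r x = RingQuot.mkRingHom r y → F x = F y := by
    intro x y hxy
    have h1 : C.mk' x = C.mk' y := by
      rw [← RingQuot.lift_mkRingHom_apply C.mk' hC x, hxy, RingQuot.lift_mkRingHom_apply]
    have h2 : ∀ c d, F (c * x * d) = F (c * y * d) := Quotient.exact h1
    simpa using h2 1 1
  choose s hs using RingQuot.mkRingHom_surjective r
  refine ⟨AddMonoidHom.mk' (fun x => F (s x)) fun x y => ?_, fun x => hq _ _ (hs _)⟩
  rw [← map_add]
  exact hq _ _ (by rw [map_add, hs, hs, hs])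

/-! ### Transitivity of fusion rings. -/

section Fusion

variable {R : Type*} [Ring R] {I : Type*} {b : Module.Basis I ℤ R} {star : I → I}

/-- As `1 = b p` is itself a basis element, `I₀` contains nothing but `p`. Thus `ψ(b i * b j) ≠ 0`
forces a nonzero, hence positive, coefficient at `p`. -/
theorem IsFusionRing.exists_repr_eq_one (h : IsFusionRing b star) :
    ∃ p, b p = 1 ∧ ∀ i, 0 < b.repr (b i * b (star i)) p ∧ 0 < b.repr (b (star i) * b i) p := by
  classical
  have := h.finite
  have := Fintype.ofFinite I
  obtain ⟨p, hp⟩ := h.one_mem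
  obtain ⟨I₀, h1, h2⟩ := h.exists_subset
  have hI : ∀ l ∈ I₀, l = p := by
    intro l hl
    have h3 := congrArg (fun x => b.repr x l) (h1.trans hp.symm)
    simp only [map_sum, Module.Basis.repr_self, Finsupp.coe_finsetSum, Finset.sum_apply,
      Finsupp.single_apply, Finset.sum_ite_eq', if_pos hl] at h3
    by_contra hne
    rw [if_neg (Ne.symm hne)] at h3
    exact one_ne_zero h3
  have key : ∀ i j, i = star j → 0 < b.repr (b i * b j) p := by
    intro i j hij
    have h3 := h2 i j
    rw [if_pos hij, Module.Basis.constr_apply_fintype] at h3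
    refine lt_of_le_of_ne (h.mul_nonneg i j p) fun h0 => ?_
    rw [Finset.sum_eq_zero] at h3
    · exact zero_ne_one h3
    · intro l _
      by_cases hl : l ∈ I₀
      · rw [hI l hl, Module.Basis.equivFun_apply, ← h0, zero_smul]
      · rw [if_neg hl, smul_zero]
  exact ⟨p, hp, fun i => ⟨key _ _ (h.involutive i).symm, key _ _ rfl⟩⟩

theorem Module.Basis.repr_mul_left [Fintype I] (x : R) (j l : I) :
    b.repr (x * b j) l = ∑ i, b.repr x i * b.repr (b i * b j) l := by
  conv_lhs => rw [← b.sum_repr x]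
  simp only [Finset.sum_mul, smul_mul_assoc, map_sum, map_smul, Finsupp.coe_finsetSum,
    Finset.sum_apply, Finsupp.smul_apply, smul_eq_mul]

theorem Module.Basis.repr_mul_right [Fintype I] (x : R) (j l : I) :
    b.repr (b j * x) l = ∑ i, b.repr x i * b.repr (b j * b i) l := by
  conv_lhs => rw [← b.sum_repr x]
  simp only [Finset.mul_sum, mul_smul_comm, map_sum, map_smul, Finsupp.coe_finsetSum,
    Finset.sum_apply, Finsupp.smul_apply, smul_eq_mul]

/-- The unit occurs in `b i * b (star i)`, so by nonnegativity `b j` occurs in `b i * (b (star i) *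
b j)`, hence in `b i * b l` for some `b l` occurring in the second factor. The other side is
symmetric. -/
theorem IsFusionRing.isTransitiveBasis (h : IsFusionRing b star) : IsTransitiveBasis b := by
  have := h.finite
  have := Fintype.ofFinite I
  obtain ⟨p, hp, hp'⟩ := h.exists_repr_eq_one
  intro i j
  have hl : 0 < b.repr (b i * (b (star i) * b j)) j := by
    rw [← mul_assoc, Module.Basis.repr_mul_left]
    refine Finset.sum_pos' (fun l _ => _root_.mul_nonneg (h.mul_nonneg _ _ _) (h.mul_nonneg _ _ _))
      ⟨p, Finset.mem_univ p, mul_pos (hp' i).1 ?_⟩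
    simp [hp]
  have hr : 0 < b.repr (b j * b (star i) * b i) j := by
    rw [mul_assoc, Module.Basis.repr_mul_right]
    refine Finset.sum_pos' (fun l _ => _root_.mul_nonneg (h.mul_nonneg _ _ _) (h.mul_nonneg _ _ _))
      ⟨p, Finset.mem_univ p, mul_pos (hp' i).2 ?_⟩
    simp [hp]
  rw [Module.Basis.repr_mul_right] at hl
  rw [Module.Basis.repr_mul_left] at hr
  obtain ⟨l, -, hl⟩ := Finset.exists_ne_zero_of_sum_ne_zero hl.ne'
  obtain ⟨m, -, hm⟩ := Finset.exists_ne_zero_of_sum_ne_zero hr.ne'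
  exact ⟨l, m, right_ne_zero_of_mul hl, right_ne_zero_of_mul hm⟩

end Fusion

/-! ### Finiteness of the set of simples, stable isomorphisms, and splitting of modules. -/

namespace FDModule

section Algebra

variable {k : Type u} [Field k] {A : Type v} [Ring A] [Algebra k A]

/-- A semisimple ring has only finitely many simple modules. -/
theorem IsCompleteSetOfSimples.finite [IsSemisimpleRing A] {Ω : Type w} {V : Ω → FDModule k A}
    (hV : IsCompleteSetOfSimples V) : Finite Ω := by
  have hs : ∀ i, ∃ J : Ideal A, Nonempty (V i ≃ₗ[A] J) := fun i =>
    have := hV.1 i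
    IsSemisimpleRing.exists_linearEquiv_ideal_of_isSimpleModule A (V i)
  choose J hJ using hs
  have hJs : ∀ i, IsSimpleModule A (J i) := fun i =>
    have := hV.1 i
    IsSimpleModule.congr (hJ i).some.symm
  -- Every simple module embeds in the semisimple ring `A`, and its isotypic component in `A`
  -- determines it.
  refine Finite.of_injective (β := isotypicComponents A A)
    (fun i => ⟨isotypicComponent A A (J i), J i, hJs i, rfl⟩) fun i j hij => hV.2.1 i j ?_
  have h1 : isotypicComponent A A (J i) = isotypicComponent A A (J j) := congrArg Subtype.val hij
  have := hJs i
  have := hJs j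
  obtain ⟨e⟩ := isIsotypicOfType_submodule_iff.mp
    (IsIsotypicOfType.isotypicComponent A A (J j)) (J i) (h1 ▸ (J i).le_isotypicComponent)
  exact ⟨(hJ i).some ≪≫ₗ e ≪≫ₗ (hJ j).some.symm⟩

theorem Iso.stableIso {X Y : FDModule k A} (h : Iso X Y) : StableIso X Y := by
  obtain ⟨e⟩ := h
  have hP : (of k A PUnit.{u + 1}).IsProjective :=
    have : Subsingleton (of k A PUnit.{u + 1}) := inferInstanceAs (Subsingleton PUnit)
    isProjective_of_subsingleton _
  refine ⟨e.toLinearMap, e.symm.toLinearMap, ⟨_, hP, 0, 0, ?_⟩, ⟨_, hP, 0, 0, ?_⟩⟩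
  · rw [LinearEquiv.symm_comp, sub_self, LinearMap.comp_zero]
  · rw [LinearEquiv.comp_symm, sub_self, LinearMap.comp_zero]

theorem IsProjective.stableIso {X Y : FDModule k A} (hX : X.IsProjective) (hY : Y.IsProjective) :
    StableIso X Y := by
  refine ⟨0, 0, ⟨X, hX, LinearMap.id, -LinearMap.id, ?_⟩, ⟨Y, hY, LinearMap.id, -LinearMap.id, ?_⟩⟩
    <;> ext <;> simp

theorem iso_directSum_of_isCompl {X : FDModule k A} {p q : Submodule A X} (h : IsCompl p q) :
    ∃ Y Z : FDModule k A, Iso X (Y.directSum Z) ∧ Module.finrank k Y = Module.finrank k p ∧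
      Module.finrank k Z = Module.finrank k q := by
  have : Module.Finite k p := Module.Finite.of_injective (p.subtype.restrictScalars k)
    p.subtype_injective
  have : Module.Finite k q := Module.Finite.of_injective (q.subtype.restrictScalars k)
    q.subtype_injective
  exact ⟨of k A p, of k A q, (Iso.of_equiv (X := (of k A p).directSum (of k A q))
    ((p.prodEquivOfIsCompl q h).restrictScalars k)
    fun a x => (p.prodEquivOfIsCompl q h).map_smul a x).symm, rfl, rfl⟩

theorem exists_iso_directSum_of_not_isIndecomposable {X : FDModule k A} [Nontrivial X]
    (h : ¬ X.IsIndecomposable) : ∃ Y Z : FDModule k A, Iso X (Y.directSum Z) ∧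
      Module.finrank k Y < Module.finrank k X ∧ Module.finrank k Z < Module.finrank k X := by
  simp only [IsIndecomposable, not_and, not_forall, not_or] at h
  obtain ⟨p, q, hpq, hp, hq⟩ := h inferInstance
  obtain ⟨Y, Z, hX, hY, hZ⟩ := iso_directSum_of_isCompl hpq
  have h1 := hX.finrank_eq.trans (finrank_directSum Y Z)
  have h2 : 0 < Module.finrank k p := by
    have := Submodule.nontrivial_iff_ne_bot.mpr hp
    have : Module.Finite k p := Module.Finite.of_injective (p.subtype.restrictScalars k)
      p.subtype_injective
    exact Module.finrank_pos
  have h3 : 0 < Module.finrank k q := by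
    have := Submodule.nontrivial_iff_ne_bot.mpr hq
    have : Module.Finite k q := Module.Finite.of_injective (q.subtype.restrictScalars k)
      q.subtype_injective
    exact Module.finrank_pos
  exact ⟨Y, Z, hX, by omega, by omega⟩

end Algebra

end FDModule

/-! ### Green rings of bialgebras -/

section Green

open FDModule

variable {k : Type u} [Field k] {A : Type v} [Ring A] [Bialgebra k A]

theorem freeClass_eq {X Y : FDModule k A} (h : Iso X Y) : freeClass k X = freeClass k Y :=
  congrArg FreeAbelianGroup.of (Quotient.sound h)

theorem freeClass_mul (X Y : FDModule k A) :
    freeClass k X * freeClass k Y = freeClass k (tensor X Y) :=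
  FreeAbelianGroup.of_mul_of _ _

theorem freeClass_induction {P : FreeAbelianGroup (IsoClass k A) → Prop}
    (of : ∀ X, P (freeClass k X)) (zero : P 0) (neg : ∀ x, P x → P (-x))
    (add : ∀ x y, P x → P y → P (x + y)) (x : FreeAbelianGroup (IsoClass k A)) : P x := by
  induction x using FreeAbelianGroup.induction_on with
  | zero => exact zero
  | of x => exact Quotient.inductionOn x of
  | neg x hx => exact neg _ hx
  | add x y hx hy => exact add _ _ hx hy

namespace GreenRing

theorem cls_eq {X Y : FDModule k A} (h : Iso X Y) : cls X = cls Y :=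
  congrArg (RingQuot.mkRingHom (GreenRel k A)) (freeClass_eq h)

theorem cls_directSum (X Y : FDModule k A) : cls (X.directSum Y) = cls X + cls Y :=
  (RingQuot.mkRingHom_rel (GreenRel.directSum X Y)).trans (map_add _ _ _)

theorem cls_of_subsingleton (X : FDModule k A) [Subsingleton X] : cls X = 0 := by
  have := cls_directSum X X
  rwa [cls_eq (iso_directSum_of_subsingleton X X), left_eq_add] at this

/-- The ideal is generated by the indecomposable projectives only; a general projective module is
split repeatedly, its summands being projective of smaller dimension. -/
theorem cls_mem_projIdeal {X : FDModule k A} (hX : X.IsProjective) : cls X ∈ projIdeal k A := by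
  induction hr : Module.finrank k X using Nat.strong_induction_on generalizing X with
  | _ r ih =>
    subst hr
    rcases subsingleton_or_nontrivial X with h | h
    · rw [cls_of_subsingleton]
      exact TwoSidedIdeal.zero_mem _
    by_cases hi : X.IsIndecomposable
    · exact TwoSidedIdeal.subset_span ⟨X, hi, hX, rfl⟩
    obtain ⟨Y, Z, hXYZ, hY, hZ⟩ := exists_iso_directSum_of_not_isIndecomposable hi
    rw [cls_eq hXYZ, cls_directSum]
    have hP := hXYZ.isProjective hX
    exact TwoSidedIdeal.add_mem _
      (ih _ hY (isProjective_of_retract (inl Y Z) (fst Y Z) (fst_inl Y Z) hP) rfl)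
      (ih _ hZ (isProjective_of_retract (inr Y Z) (snd Y Z) (snd_inr Y Z) hP) rfl)

end GreenRing

namespace StableGreenRing

theorem cls_eq_of_stableIso {X Y : FDModule k A} (h : StableIso X Y) : cls X = cls Y :=
  RingQuot.mkRingHom_rel (StableGreenRel.stableIso X Y h)

theorem cls_eq {X Y : FDModule k A} (h : Iso X Y) : cls X = cls Y :=
  congrArg (RingQuot.mkRingHom (StableGreenRel k A)) (freeClass_eq h)

theorem cls_directSum (X Y : FDModule k A) : cls (X.directSum Y) = cls X + cls Y :=
  (RingQuot.mkRingHom_rel (StableGreenRel.directSum X Y)).trans (map_add _ _ _)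

/-- Projective modules are all stably isomorphic, so `[X] = [X ⊕ X] = 2 [X]`. -/
theorem cls_of_isProjective {X : FDModule k A} (hX : X.IsProjective) : cls X = 0 := by
  have := cls_directSum X X
  rwa [← cls_eq_of_stableIso (hX.stableIso (hX.directSum hX)), left_eq_add] at this

theorem cls_mul (X Y : FDModule k A) : cls X * cls Y = cls (tensor X Y) :=
  (map_mul (RingQuot.mkRingHom (StableGreenRel k A)) _ _).symm.trans
    (congrArg (RingQuot.mkRingHom (StableGreenRel k A)) (freeClass_mul X Y))

theorem cls_trivial : cls (trivial k A) = 1 := map_one (RingQuot.mkRingHom (StableGreenRel k A))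

theorem induction {P : StableGreenRing k A → Prop} (of : ∀ X, P (cls X)) (zero : P 0)
    (neg : ∀ x, P x → P (-x)) (add : ∀ x y, P x → P y → P (x + y)) (x : StableGreenRing k A) :
    P x := by
  obtain ⟨x, rfl⟩ := RingQuot.mkRingHom_surjective (StableGreenRel k A) x
  induction x using freeClass_induction with
  | of X => exact of X
  | zero => exact (map_zero (RingQuot.mkRingHom (StableGreenRel k A))).symm ▸ zero
  | neg x hx => exact (map_neg (RingQuot.mkRingHom (StableGreenRel k A)) x).symm ▸ neg _ hx
  | add x y hx hy =>
    exact (map_add (RingQuot.mkRingHom (StableGreenRel k A)) x y).symm ▸ add _ _ hx hy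

/-- Additive maps on the stable Green ring are determined by the classes of modules. -/
theorem addHom_ext {B : Type*} [AddCommGroup B] {f f' : StableGreenRing k A →+ B}
    (h : ∀ X, f (cls X) = f' (cls X)) : f = f' := by
  ext x
  induction x using induction with
  | of X => exact h X
  | zero => rw [map_zero, map_zero]
  | neg x hx => rw [map_neg, map_neg, hx]
  | add x y hx hy => rw [map_add, map_add, hx, hy]

end StableGreenRing

/-- An additive function of modules that is an invariant of stable isomorphism defines an additive
map on the stable Green ring. -/
theorem StableGreenRing.exists_addMonoidHom
    (hl : ∀ {X Y : FDModule k A}, StableIso X Y → ∀ Z, StableIso (tensor X Z) (tensor Y Z))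
    (hr : ∀ {X Y : FDModule k A}, StableIso X Y → ∀ Z, StableIso (tensor Z X) (tensor Z Y))
    (hl' : ∀ X Y Z : FDModule k A,
      Iso (tensor (X.directSum Y) Z) ((tensor X Z).directSum (tensor Y Z)))
    (hr' : ∀ X Y Z : FDModule k A,
      Iso (tensor Z (X.directSum Y)) ((tensor Z X).directSum (tensor Z Y)))
    {B : Type*} [AddCommGroup B] (m : FDModule k A → B) (hm : ∀ X Y, StableIso X Y → m X = m Y)
    (hm' : ∀ X Y, m (X.directSum Y) = m X + m Y) :
    ∃ E : StableGreenRing k A →+ B, ∀ X, E (StableGreenRing.cls X) = m X := by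
  let F : FreeAbelianGroup (IsoClass k A) →+ B :=
    FreeAbelianGroup.lift (Quotient.lift m fun X Y h => hm X Y (Iso.stableIso h))
  have hF : ∀ X, F (freeClass k X) = m X := fun X => FreeAbelianGroup.lift_apply_of _ _
  -- The quotient is by a ring congruence, so the relations must survive multiplication on both
  -- sides. By additivity the multipliers may be taken to be classes of modules, and then the
  -- hypotheses on tensor products apply.
  suffices h : ∀ a b, StableGreenRel k A a b → ∀ c d, F (c * a * d) = F (c * b * d) by
    obtain ⟨E, hE⟩ := RingQuot.exists_addMonoidHom (StableGreenRel k A) F h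
    exact ⟨E, fun X => (hE _).trans (hF X)⟩
  intro a b hab c d
  induction c using freeClass_induction with
  | zero => simp
  | neg c hc => simp only [neg_mul, map_neg, hc]
  | add c c' hc hc' => simp only [add_mul, map_add, hc, hc']
  | of C =>
    induction d using freeClass_induction with
    | zero => simp
    | neg d hd => simp only [mul_neg, map_neg, hd]
    | add d d' hd hd' => simp only [mul_add, map_add, hd, hd']
    | of D =>
      cases hab with
      | stableIso X Y h =>
        simp only [freeClass_mul, hF]
        exact hm _ _ (hl (hr h C) D)
      | directSum X Y =>
        simp only [mul_add, add_mul, freeClass_mul, map_add, hF]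
        rw [← hm', hm _ _ (hl (hr' X Y C).stableIso D), hm _ _ (hl' _ _ D).stableIso]

end Green

/-! ### The stable Green ring of the Hopf algebra of a group datum. -/

namespace GroupDatum

open FDModule

variable {k : Type u} [Field k] [IsAlgClosed k] [CharZero k] {G : Type v} [Group G] [Finite G]
  {D : GroupDatum k G} {Ω : Type w} {V : Ω → FDModule k (MonoidAlgebra k G)}

theorem finite_stableIndex (hV : IsCompleteSetOfSimples V) : Finite (D.StableIndex V) := by
  have : NeZero (Nat.card G : k) := ⟨Nat.cast_ne_zero.mpr Nat.card_pos.ne'⟩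
  have := hV.finite
  let f : D.StableIndex V → Fin D.n × Ω := fun p => (⟨p.1.1, p.2.1.2⟩, p.1.2)
  exact Finite.of_injective f fun p q (h : f p = f q) => Subtype.ext
    (Prod.ext (congrArg (fun x => (x.1 : ℕ)) h) (congrArg (fun x => x.2) h))

open Classical in
theorem mult_stableM_stableM (hV : IsCompleteSetOfSimples V) (p q : D.StableIndex V) :
    mult (D.stableM V p) (D.stableM V q) = if p = q then 1 else 0 := by
  split_ifs with h
  · rw [h]
    exact (D.stableM_isBrick hV q).mult_self
  · exact (D.stableM_isBrick hV p).mult_eq_zero (D.stableM_isBrick hV q).isIndecomposable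
      fun h' => h (stableM_injective hV h').symm

/-- An additive invariant of modules that vanishes on projective modules is determined by its
values on the modules `M(j, i)`. -/
theorem eq_sum_mult_smul (hD : D.IsNonNilpotent) (hV : IsCompleteSetOfSimples V)
    [Fintype (D.StableIndex V)] {B : Type*} [AddCommGroup B] (m : FDModule k D.Alg → B)
    (hm : ∀ {X Y}, Iso X Y → m X = m Y) (hm' : ∀ X Y, m (X.directSum Y) = m X + m Y)
    (hP : ∀ {X}, X.IsProjective → m X = 0) (X : FDModule k D.Alg) :
    m X = ∑ p, mult (D.stableM V p) X • m (D.stableM V p) := by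
  classical
  induction hr : Module.finrank k X using Nat.strong_induction_on generalizing X with
  | _ r ih =>
    subst hr
    rcases isProjective_or_iso_directSum hD hV X with h | ⟨p, Z, hXZ⟩
    · rw [hP h, Finset.sum_eq_zero]
      intro p _
      rw [(D.stableM_isBrick hV p).mult_eq_zero_of_isProjective
        (stableM_not_isProjective hD hV p) h, zero_smul]
    · have hZ : Module.finrank k Z < Module.finrank k X := by
        have := (D.stableM_isBrick hV p).1
        rw [hXZ.finrank_eq, finrank_directSum]
        exact Nat.lt_add_of_pos_left Module.finrank_pos
      have h1 : ∀ q, mult (D.stableM V q) X = (if q = p then 1 else 0) + mult (D.stableM V q) Z :=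
        fun q => by rw [hXZ.mult_eq, mult_directSum, mult_stableM_stableM hV]
      simp only [h1, add_smul, Finset.sum_add_distrib, ite_smul, one_smul, zero_smul,
        Finset.sum_ite_eq', Finset.mem_univ, if_true]
      rw [hm hXZ, hm', ih _ hZ Z rfl]

theorem stableGreenRing_exists_addMonoidHom (hD : D.IsNonNilpotent) {B : Type*} [AddCommGroup B]
    (m : FDModule k D.Alg → B) (hm : ∀ X Y, StableIso X Y → m X = m Y)
    (hm' : ∀ X Y, m (X.directSum Y) = m X + m Y) :
    ∃ E : StableGreenRing k D.Alg →+ B, ∀ X, E (StableGreenRing.cls X) = m X :=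
  StableGreenRing.exists_addMonoidHom (stableIso_tensor_left hD.2) (stableIso_tensor_right hD.2)
    directSum_tensor tensor_directSum m hm hm'

/-- Projective classes vanish stably, which gives the map. Its inverse exists because modulo the
ideal `[X] = ∑ mult(M(p), X) [M(p)]`, and these multiplicities depend only on the stable class of
`X`. -/
theorem exists_quotient_equiv (hD : D.IsNonNilpotent) (hV : IsCompleteSetOfSimples V) :
    ∃ φ : (projIdeal k D.Alg).ringCon.Quotient ≃+* StableGreenRing k D.Alg,
      ∀ X : FDModule k D.Alg,
        φ ((projIdeal k D.Alg).ringCon.mk' (GreenRing.cls X)) = StableGreenRing.cls X := by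
  have := finite_stableIndex (D := D) hV
  have := Fintype.ofFinite (D.StableIndex V)
  let π : FreeAbelianGroup (IsoClass k D.Alg) →+* GreenRing k D.Alg :=
    RingQuot.mkRingHom (GreenRel k D.Alg)
  let σ : FreeAbelianGroup (IsoClass k D.Alg) →+* StableGreenRing k D.Alg :=
    RingQuot.mkRingHom (StableGreenRel k D.Alg)
  have hπ : Function.Surjective π := RingQuot.mkRingHom_surjective _
  have hσ : Function.Surjective σ := RingQuot.mkRingHom_surjective _
  have h1 : ∀ ⦃x y⦄, GreenRel k D.Alg x y → σ x = σ y := by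
    rintro x y ⟨X, Y⟩
    exact RingQuot.mkRingHom_rel (StableGreenRel.directSum X Y)
  let f : GreenRing k D.Alg →+* StableGreenRing k D.Alg := RingQuot.lift ⟨σ, h1⟩
  have hf : ∀ x, f (π x) = σ x := fun x => RingQuot.lift_mkRingHom_apply σ h1 x
  have h2 : projIdeal k D.Alg ≤ TwoSidedIdeal.ker f := by
    refine TwoSidedIdeal.span_le.mpr ?_
    rintro x ⟨X, -, hX, rfl⟩
    exact TwoSidedIdeal.mem_ker f |>.mpr
      ((hf (freeClass k X)).trans (StableGreenRing.cls_of_isProjective hX))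
  let c := (projIdeal k D.Alg).ringCon
  let φ : c.Quotient →+* StableGreenRing k D.Alg :=
    c.lift f (TwoSidedIdeal.ringCon_le_iff.mp h2)
  have hφ : ∀ x, φ (c.mk' (π x)) = σ x := hf
  let m : FDModule k D.Alg → c.Quotient := fun X => c.mk' (GreenRing.cls X)
  have hm : ∀ X, m X = ∑ p, mult (D.stableM V p) X • m (D.stableM V p) :=
    eq_sum_mult_smul hD hV m (fun h => congrArg c.mk' (GreenRing.cls_eq h))
      (fun X Y => (congrArg c.mk' (GreenRing.cls_directSum X Y)).trans (map_add _ _ _))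
      fun h => Quotient.sound (GreenRing.cls_mem_projIdeal h)
  have h3 : ∀ ⦃x y⦄, StableGreenRel k D.Alg x y → (c.mk'.comp π) x = (c.mk'.comp π) y := by
    rintro x y (⟨X, Y, h⟩ | ⟨X, Y⟩)
    · refine ((hm X).trans ?_).trans (hm Y).symm
      exact Finset.sum_congr rfl fun p _ => by
        rw [(D.stableM_isBrick hV p).mult_eq_of_stableIso (stableM_not_isProjective hD hV p) h]
    · exact congrArg c.mk' (RingQuot.mkRingHom_rel (GreenRel.directSum X Y))
  let ψ : StableGreenRing k D.Alg →+* c.Quotient := RingQuot.lift ⟨c.mk'.comp π, h3⟩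
  have hψ : ∀ x, ψ (σ x) = c.mk' (π x) := fun x => RingQuot.lift_mkRingHom_apply _ h3 x
  refine ⟨RingEquiv.ofBijective φ ⟨Function.LeftInverse.injective (g := ψ) fun x => ?_,
    Function.RightInverse.surjective (g := ψ) fun x => ?_⟩, fun X => hφ (freeClass k X)⟩
  · obtain ⟨x, rfl⟩ := c.mk'_surjective x
    obtain ⟨x, rfl⟩ := hπ x
    rw [hφ, hψ]
  · obtain ⟨x, rfl⟩ := hσ x
    rw [hψ, hφ]

/-- The multiplicities define an additive map `E` on the ring which is inverse to forming linear
combinations of the classes of the `M(p)`. Coordinates of classes of modules are therefore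
multiplicities. -/
theorem exists_stableBasis (hD : D.IsNonNilpotent) (hV : IsCompleteSetOfSimples V) :
    ∃ b : Module.Basis (D.StableIndex V) ℤ (StableGreenRing k D.Alg),
      (∀ p, b p = StableGreenRing.cls (D.stableM V p)) ∧
      ∀ X p, b.repr (StableGreenRing.cls X) p = mult (D.stableM V p) X := by
  classical
  have := finite_stableIndex (D := D) hV
  have := Fintype.ofFinite (D.StableIndex V)
  obtain ⟨E, hE⟩ := stableGreenRing_exists_addMonoidHom hD
    (fun X p => (mult (D.stableM V p) X : ℤ))
    (fun X Y h => funext fun p => by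
      rw [(D.stableM_isBrick hV p).mult_eq_of_stableIso (stableM_not_isProjective hD hV p) h])
    (fun X Y => funext fun p => by rw [mult_directSum, Pi.add_apply, Nat.cast_add])
  let L : (D.StableIndex V → ℤ) →ₗ[ℤ] StableGreenRing k D.Alg :=
    Fintype.linearCombination ℤ fun p => StableGreenRing.cls (D.stableM V p)
  have hL : ∀ a, L a = ∑ p, a p • StableGreenRing.cls (D.stableM V p) :=
    Fintype.linearCombination_apply ℤ _
  have h1 : ∀ x, L (E x) = x := fun x => DFunLike.congr_fun
    (StableGreenRing.addHom_ext (f := L.toAddMonoidHom.comp E) (f' := AddMonoidHom.id _)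
      fun X => by
        change L (E (StableGreenRing.cls X)) = StableGreenRing.cls X
        rw [hL, hE, eq_sum_mult_smul hD hV StableGreenRing.cls StableGreenRing.cls_eq
          StableGreenRing.cls_directSum StableGreenRing.cls_of_isProjective X]
        simp only [natCast_zsmul]) x
  have h2 : ∀ a, E (L a) = a := by
    intro a
    funext q
    rw [hL, map_sum, Finset.sum_apply]
    simp only [map_zsmul, hE, Pi.smul_apply, mult_stableM_stableM hV, smul_eq_mul]
    simp
  let e : StableGreenRing k D.Alg ≃ₗ[ℤ] (D.StableIndex V → ℤ) :=
    LinearEquiv.ofLinearMap E.toIntLinearMap L (LinearMap.ext h2) (LinearMap.ext h1)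
  refine ⟨Module.Basis.ofEquivFun e, fun p => ?_, fun X p => ?_⟩
  · rw [Module.Basis.coe_ofEquivFun]
    change L (Pi.single p 1) = _
    rw [hL]
    simp [Pi.single_apply]
  · rw [Module.Basis.ofEquivFun_repr_apply]
    exact congrFun (hE X) p

-- This allows the coordinate at the unit of the basis to be computed with the trivial module
-- itself. Both sides are additive, vanish on projectives and agree on every `M(p)`.
open Classical in
theorem mult_trivial_eq (hD : D.IsNonNilpotent) (hV : IsCompleteSetOfSimples V)
    [Fintype (D.StableIndex V)] {p₁ : D.StableIndex V}
    (hp₁ : Iso (trivial k D.Alg) (D.stableM V p₁)) (X : FDModule k D.Alg) :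
    mult (trivial k D.Alg) X = mult (D.stableM V p₁) X := by
  have hT : (trivial k D.Alg).IsBrick := (D.stableM_isBrick hV p₁).of_iso hp₁.symm
  have hT' : ¬ (trivial k D.Alg).IsProjective := fun h =>
    stableM_not_isProjective hD hV p₁ (hp₁.isProjective h)
  have h1 : ∀ p, mult (trivial k D.Alg) (D.stableM V p) = if p = p₁ then 1 else 0 := by
    intro p
    split_ifs with h
    · rw [h, ← hp₁.mult_eq, hT.mult_self]
    · exact hT.mult_eq_zero (D.stableM_isBrick hV p).isIndecomposable
        fun h' => h (stableM_injective hV (h'.trans hp₁))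
  have h2 := eq_sum_mult_smul hD hV (fun X => (mult (trivial k D.Alg) X : ℤ))
    (fun h => by rw [h.mult_eq]) (fun X Y => by rw [mult_directSum, Nat.cast_add])
    (fun h => by rw [hT.mult_eq_zero_of_isProjective hT' h, Nat.cast_zero]) X
  simpa [h1] using h2

theorem isFusionRing_stableBasis (hD : D.IsNonNilpotent) (hn : 2 ≤ D.n)
    (hV : IsCompleteSetOfSimples V)
    {b : Module.Basis (D.StableIndex V) ℤ (StableGreenRing k D.Alg)}
    (hb : ∀ p, b p = StableGreenRing.cls (D.stableM V p))
    (hb' : ∀ X p, b.repr (StableGreenRing.cls X) p = mult (D.stableM V p) X)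
    {star : D.StableIndex V → D.StableIndex V}
    (hstar : ∀ p, (D.stableM V p).dual.Iso (D.stableM V (star p))) : IsFusionRing b star := by
  classical
  have hfin := finite_stableIndex (D := D) hV
  have := Fintype.ofFinite (D.StableIndex V)
  obtain ⟨p₁, hp₁⟩ := D.exists_trivial_iso_stableM hD hn hV
  have hone : b p₁ = 1 := by
    rw [hb, ← StableGreenRing.cls_eq hp₁, StableGreenRing.cls_trivial]
  have hmul : ∀ p q, b p * b q = StableGreenRing.cls (tensor (D.stableM V p) (D.stableM V q)) := by
    intro p q
    rw [hb, hb, StableGreenRing.cls_mul]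
  have hinv : Function.Involutive star := fun p => stableM_injective hV <|
    (hstar (star p)).symm.trans ((hstar p).symm.dual.trans (D.iso_dual_dual _).symm)
  -- Passing to the dual is additive and preserves projectives, so it is determined by its values on
  -- the `M(p)`, where it is `star` by definition. Anti-multiplicativity can then be read off from
  -- the dual of a tensor product.
  have hS : ∀ X, b.starMap star (StableGreenRing.cls X) = StableGreenRing.cls X.dual := by
    intro X
    rw [eq_sum_mult_smul hD hV (fun X => StableGreenRing.cls X.dual)
      (fun h => StableGreenRing.cls_eq h.dual)
      (fun X Y => (StableGreenRing.cls_eq (dual_directSum X Y)).trans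
        (StableGreenRing.cls_directSum _ _))
      (fun h => StableGreenRing.cls_of_isProjective (dual_isProjective hD hV h)) X,
      Module.Basis.starMap, Module.Basis.constr_apply_fintype]
    refine Finset.sum_congr rfl fun p _ => ?_
    rw [Module.Basis.equivFun_apply, hb', hb, natCast_zsmul, StableGreenRing.cls_eq (hstar p)]
  have hSmul : ∀ x y, b.starMap star (x * y) = b.starMap star y * b.starMap star x := by
    intro x y
    induction x using StableGreenRing.induction with
    | zero => simp only [zero_mul, mul_zero, map_zero]
    | neg x hx => simp only [neg_mul, mul_neg, map_neg, hx]
    | add x x' hx hx' => simp only [add_mul, mul_add, map_add, hx, hx']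
    | of X =>
      induction y using StableGreenRing.induction with
      | zero => simp only [zero_mul, mul_zero, map_zero]
      | neg y hy => simp only [neg_mul, mul_neg, map_neg, hy]
      | add y y' hy hy' => simp only [add_mul, mul_add, map_add, hy, hy']
      | of Y =>
        rw [StableGreenRing.cls_mul, hS, hS, hS, StableGreenRing.cls_mul,
          StableGreenRing.cls_eq (D.dual_tensor X Y)]
  have hSS : b.starMap star (b.starMap star 1) = 1 := by
    rw [← hone, Module.Basis.starMap, Module.Basis.constr_basis, Module.Basis.constr_basis, hinv]
  have hconstr : ∀ x, b.constr ℤ (fun i => if i ∈ ({p₁} : Finset _) then (1 : ℤ) else 0) x =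
      b.repr x p₁ := by
    intro x
    have : b.constr ℤ (fun i => if i ∈ ({p₁} : Finset _) then (1 : ℤ) else 0) = b.coord p₁ :=
      b.ext fun i => by
        rw [Module.Basis.constr_basis, Module.Basis.coord_apply, Module.Basis.repr_self,
          Finsupp.single_apply]
        simp only [Finset.mem_singleton]
    rw [this, Module.Basis.coord_apply]
  refine ⟨hfin, ⟨p₁, hone⟩, fun i j l => ?_, hinv, ?_, hSmul, {p₁}, ?_, fun i j => ?_⟩
  · rw [hmul, hb']
    exact Nat.cast_nonneg _
  -- An anti-multiplicative involution fixes the unit: apply it to `star(1) * 1`.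
  · have h := hSmul (b.starMap star 1) 1
    rwa [mul_one, hSS, mul_one, eq_comm] at h
  · rw [Finset.sum_singleton, hone]
  -- With `I₀ = {p₁}` the functional `ψ` is the coordinate at the unit, i.e. the multiplicity of the
  -- trivial module in `M(i) ⊗ M(j)`, which is `1` or `0` according to whether the dual of `M(i)` is
  -- `M(j)`.
  · rw [hconstr, hmul, hb', ← mult_trivial_eq hD hV hp₁, mult_trivial_stableM hV]
    have h : Iso (dual (D.stableM V i)) (D.stableM V j) ↔ i = star j := by
      constructor
      · intro h
        rw [← stableM_injective hV ((hstar i).symm.trans h), hinv]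
      · rintro rfl
        have := hstar (star j)
        rwa [hinv] at this
    simp only [h]
    split_ifs <;> simp

end GroupDatum

/-! ### The proposition. -/

theorem mainTheorem9 {k : Type u} [Field k] [IsAlgClosed k] [CharZero k]
    {G : Type v} [Group G] [Finite G] (D : GroupDatum k G) (hD : D.IsNonNilpotent) (hn : 2 ≤ D.n)
    {Ω : Type w} (V : Ω → FDModule k (MonoidAlgebra k G))
    (hV : FDModule.IsCompleteSetOfSimples V) :
    (∃ φ : (projIdeal k D.Alg).ringCon.Quotient ≃+* StableGreenRing k D.Alg,
      ∀ X : FDModule k D.Alg,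
        φ ((projIdeal k D.Alg).ringCon.mk' (GreenRing.cls X)) = StableGreenRing.cls X) ∧
    (∀ p, (D.stableM V p).IsIndecomposable ∧ ¬ (D.stableM V p).IsProjective) ∧
    (∀ X : FDModule k D.Alg, X.IsIndecomposable → ¬ X.IsProjective →
      ∃! p, X.Iso (D.stableM V p)) ∧
    ∃ b : Module.Basis (D.StableIndex V) ℤ (StableGreenRing k D.Alg),
      (∀ p, b p = StableGreenRing.cls (D.stableM V p)) ∧
      ∃ star : D.StableIndex V → D.StableIndex V,
        (∀ p, (D.stableM V p).dual.Iso (D.stableM V (star p))) ∧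
        IsFusionRing b star ∧ IsTransitiveBasis b := by
  obtain ⟨b, hb, hb'⟩ := GroupDatum.exists_stableBasis hD hV
  choose star hstar using GroupDatum.exists_dual_iso_stableM hD hV
  have hF := GroupDatum.isFusionRing_stableBasis hD hn hV hb hb' hstar
  refine ⟨GroupDatum.exists_quotient_equiv hD hV, fun p =>
    ⟨(D.stableM_isBrick hV p).isIndecomposable, GroupDatum.stableM_not_isProjective hD hV p⟩,
    fun X hX hP => ?_, b, hb, star, hstar, hF, hF.isTransitiveBasis⟩
  obtain ⟨p, hp⟩ := GroupDatum.exists_iso_stableM hD hV hX hP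
  exact ⟨p, hp, fun q hq => GroupDatum.stableM_injective hV (hq.symm.trans hp)⟩
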